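/- **Theorem (Existence and uniqueness of global solutions).** Let $\kappa>0$ and let $c\in C^1(\mathbb R)$ satisfy $\kappa^{-1}\le c\le\kappa$, with $c'$ locally Lipschitz. For $Z=(t,x,U,J,K)\colon\mathbb R^2\to\mathbb R^5$ consider the system $Z_{XY}=F(Z)(Z_X,Z_Y)$, that is, with $c=c(U)$, $c'=c'(U)$, $$t_{XY}=-\tfrac{c'}{2c}(U_Xt_Y+U_Yt_X),\quad x_{XY}=\tfrac{c'}{2c}(U_Yx_X+U_Xx_Y),\quad U_{XY}=\tfrac{c'}{2c^3}(x_YJ_X+J_Yx_X)-\tfrac{c'}{2c}U_YU_X,$$ $$J_{XY}=\tfrac{c'}{2c}(J_XU_Y+J_YU_X),\quad K_{XY}=-\tfrac{c'}{2c}(K_XU_Y+K_YU_X).$$ *Curves.* $\mathcal C$ is the set of curves $(\mathcal X(s),\mathcal Y(s))$, $s\in\mathbb R$, with $\mathcal X-\mathrm{id},\ \mathcal Y-\mathrm{id}\in W^{1,\infty}(\mathbb R)$, $\dot{\mathcal X},\dot{\mathcal Y}\ge0$ and $\frac12(\mathcal X(s)+\mathcal Y(s))=s$ (horizontal and vertical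 pieces are allowed). Write $\mathcal X^{-1}(X)=\sup\{s:\mathcal X(s)<X\}$, and similarly $\mathcal Y^{-1}$. *Data.* $\mathcal G$ is the set of $\Theta=(\mathcal X,\mathcal Y,\mathcal Z,\mathcal V,\mathcal W)$ with $(\mathcal X,\mathcal Y)\in\mathcal C$, $\mathcal Z(s)\in\mathbb R^5$ locally absolutely continuous in $s$, and measurable $\mathcal V(X),\mathcal W(Y)\in\mathbb R^5$ (identified when equal a.e.) such that, with $\mathcal V^a=\mathcal V-(\frac1{2c(0)},\frac12,0,0,0)$, $\mathcal W^a=\mathcal W-(-\frac1{2c(0)},\frac12,0,0,0)$ and $\mathcal Z^a(s)=\mathcal Z(s)-(0,s,0,0,0)$: 1. $\mathcal Z_3,\mathcal V^a,\mathcal W^a\in L^2(\mathbb R)$ and $\mathcal Z^a,\mathcal V^a,\mathcal W^a,\frac1{\mathcal V_2+\mathcal V_4},\frac1{\mathcal W_2+\mathcal W_4}\in L^\infty(\mathbb R)$; 2. $\mathcal V_2,\mathcal V_4,\mathcal W_2,\mathcal W_4\ge0$ a.e.; 3. $\dot{\mathcal Z}(s)=\mathcal V(\mathcal X(s))\dot{\mathcal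 X}(s)+\mathcal W(\mathcal Y(s))\dot{\mathcal Y}(s)$ for a.e. $s$; 4. for a.e. $X$, with $c$ evaluated at $\mathcal Z_3(\mathcal X^{-1}(X))$: $2\mathcal V_4\mathcal V_2=(c\,\mathcal V_3)^2$, $\mathcal V_2=c\,\mathcal V_1$, $\mathcal V_4=c\,\mathcal V_5$; for a.e. $Y$, with $c$ evaluated at $\mathcal Z_3(\mathcal Y^{-1}(Y))$: $2\mathcal W_4\mathcal W_2=(c\,\mathcal W_3)^2$, $\mathcal W_2=-c\,\mathcal W_1$, $\mathcal W_4=-c\,\mathcal W_5$; 5. $\lim_{s\to-\infty}\mathcal Z_4(s)=0$. *Solutions.* For a rectangle $\Omega=[X_l,X_r]\times[Y_l,Y_r]$, $\mathcal H(\Omega)$ is the set of $Z\in W^{1,\infty}(\Omega)$ with $Z_X\in L^\infty([X_l,X_r],W^{1,\infty}([Y_l,Y_r]))$ and $Z_Y\in L^\infty([Y_l,Y_r],W^{1,\infty}([X_l,X_r]))$ such that a.e. in $\Omega$ one has $(Z_X)_Y=F(Z)(Z_X,Z_Y)$ and $(Z_Y)_X=F(Z)(Z_X,Z_Y)$, and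 such that $$x_X=c(U)t_X,\quad J_X=c(U)K_X,\quad 2J_Xx_X=(c(U)U_X)^2,\quad x_X\ge0,\quad J_X\ge0,\quad x_X+J_X>0$$ for a.e. $X$ and all $Y$, and $$x_Y=-c(U)t_Y,\quad J_Y=-c(U)K_Y,\quad 2J_Yx_Y=(c(U)U_Y)^2,\quad x_Y\ge0,\quad J_Y\ge0,\quad x_Y+J_Y>0$$ for a.e. $Y$ and all $X$. For $(\mathcal X,\mathcal Y)\in\mathcal C$, $Z\bullet(\mathcal X,\mathcal Y)$ denotes $(\mathcal X,\mathcal Y,\mathcal Z,\mathcal V,\mathcal W)$ with $\mathcal Z(s)=Z(\mathcal X(s),\mathcal Y(s))$, $\mathcal V(X)=Z_X(X,\mathcal Y(\mathcal X^{-1}(X)))$ and $\mathcal W(Y)=Z_Y(\mathcal X(\mathcal Y^{-1}(Y)),Y)$. Let $\mathcal H$ be the set of $Z\colon\mathbb R^2\to\mathbb R^5$ such that $Z\in\mathcal H(\Omega)$ for all rectangles $\Omega$ and $Z\bullet(\mathcal X,\mathcal Y)\in\mathcal G$ for some $(\mathcal X,\mathcal Y)\in\mathcal C$. *Claim.* For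 every $\Theta=(\mathcal X,\mathcal Y,\mathcal Z,\mathcal V,\mathcal W)\in\mathcal G$ there is a unique $Z\in\mathcal H$ with $\Theta=Z\bullet(\mathcal X,\mathcal Y)$. This defines a solution map $\mathbf S\colon\mathcal G\to\mathcal H$, which depends on $\mathcal V,\mathcal W$ only up to null sets. -/

import Mathlib

open MeasureTheory Filter Topology Set
open scoped ENNReal NNReal

noncomputable section

namespace NVW

/-- Five-component vectors `(t, x, U, J, K)`. -/
abbrev Vec : Type := Fin 5 → ℝ

namespace Vec

/-- The components of a vector, in the order `(t, x, U, J, K)`. -/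
abbrev t (z : Vec) : ℝ := z 0

abbrev x (z : Vec) : ℝ := z 1

abbrev U (z : Vec) : ℝ := z 2

abbrev J (z : Vec) : ℝ := z 3

abbrev K (z : Vec) : ℝ := z 4

end Vec

/-- The bilinear symmetric right-hand side `F(Z)(V, W)` of `Z_XY = F(Z)(Z_X, Z_Y)`; it depends on
`Z` only through `U`. -/
def F (c : ℝ → ℝ) (z v w : Vec) : Vec :=
  ![-(deriv c z.U / (2 * c z.U)) * (v.U * w.t + w.U * v.t),
    deriv c z.U / (2 * c z.U) * (w.U * v.x + v.U * w.x),
    deriv c z.U / (2 * c z.U ^ 3) * (w.x * v.J + w.J * v.x)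
      - deriv c z.U / (2 * c z.U) * (w.U * v.U),
    deriv c z.U / (2 * c z.U) * (v.J * w.U + w.J * v.U),
    -(deriv c z.U / (2 * c z.U)) * (v.K * w.U + w.K * v.U)]

/-- The set `𝒞` of curves `(𝒳(s), 𝒴(s))`: `𝒳 - id` and `𝒴 - id` are in `W^{1,∞}(ℝ)`, both
functions are nondecreasing, and `(𝒳(s) + 𝒴(s)) / 2 = s`. Horizontal and vertical pieces are
allowed. -/
structure IsCurve (χ ψ : ℝ → ℝ) : Prop where
  bounded_left : ∃ M : ℝ, ∀ s, |χ s - s| ≤ M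
  bounded_right : ∃ M : ℝ, ∀ s, |ψ s - s| ≤ M
  lipschitz_left : ∃ L : ℝ≥0, LipschitzWith L χ
  lipschitz_right : ∃ L : ℝ≥0, LipschitzWith L ψ
  monotone_left : Monotone χ
  monotone_right : Monotone ψ
  normalized : ∀ s, (χ s + ψ s) / 2 = s

/-- The generalized inverse `χ⁻¹(X) = sup {s | χ(s) < X}` of a nondecreasing function. -/
def genInv (χ : ℝ → ℝ) (X : ℝ) : ℝ := sSup {s | χ s < X}

/-- A curve `(𝒳, 𝒴)` together with data `𝒵(s)`, `𝒱(X)`, `𝒲(Y)`. -/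
structure Data where
  /-- first coordinate `𝒳(s)` of the curve -/
  X : ℝ → ℝ
  /-- second coordinate `𝒴(s)` of the curve -/
  Y : ℝ → ℝ
  /-- values `𝒵(s)` of the solution on the curve -/
  Z : ℝ → Vec
  /-- values `𝒱(X)` of the `X`-derivative on the curve -/
  V : ℝ → Vec
  /-- values `𝒲(Y)` of the `Y`-derivative on the curve -/
  W : ℝ → Vec

namespace Data

/-- Equality of data: `𝒱` and `𝒲` are only defined up to null sets. -/
def Same (Θ Θ' : Data) : Prop :=
  Θ.X = Θ'.X ∧ Θ.Y = Θ'.Y ∧ Θ.Z = Θ'.Z ∧ Θ.V =ᵐ[volume] Θ'.V ∧ Θ.W =ᵐ[volume] Θ'.W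

/-- `𝒵^a`, that is `𝒵` with `s` subtracted from the second component. -/
def Za (Θ : Data) (s : ℝ) : Vec := Θ.Z s - ![0, s, 0, 0, 0]

/-- `𝒱^a`, that is `𝒱` minus its value `(1 / (2c(0)), 1/2, 0, 0, 0)` at the rest state. -/
def Va (c : ℝ → ℝ) (Θ : Data) (X : ℝ) : Vec := Θ.V X - ![1 / (2 * c 0), 1 / 2, 0, 0, 0]

/-- `𝒲^a`, that is `𝒲` minus its value `(-1 / (2c(0)), 1/2, 0, 0, 0)` at the rest state. -/
def Wa (c : ℝ → ℝ) (Θ : Data) (Y : ℝ) : Vec := Θ.W Y - ![-(1 / (2 * c 0)), 1 / 2, 0, 0, 0]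

/-- The `L²` norm `‖U‖ + ‖𝒱^a‖ + ‖𝒲^a‖` of the data. -/
def normG (c : ℝ → ℝ) (Θ : Data) : ℝ≥0∞ :=
  eLpNorm (fun s => (Θ.Z s).U) 2 volume + eLpNorm (Va c Θ) 2 volume + eLpNorm (Wa c Θ) 2 volume

/-- The `L^∞` norm of the data. The reciprocals are taken in `[0, ∞]`, where `1 / 0 = ∞`. -/
def tnormG (c : ℝ → ℝ) (Θ : Data) : ℝ≥0∞ :=
  eLpNorm (fun s => Θ.X s - s) ∞ volume + eLpNorm (fun s => Θ.Y s - s) ∞ volume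
    + essSup (fun X => (ENNReal.ofReal ((Θ.V X).x + (Θ.V X).J))⁻¹) volume
    + essSup (fun Y => (ENNReal.ofReal ((Θ.W Y).x + (Θ.W Y).J))⁻¹) volume
    + eLpNorm (Za Θ) ∞ volume + eLpNorm (Va c Θ) ∞ volume + eLpNorm (Wa c Θ) ∞ volume

/-- Membership in `𝒢`. In the compatibility condition `𝒵` is locally absolutely continuous, so
that its almost everywhere derivative is its distributional derivative. -/
structure MemG (c : ℝ → ℝ) (Θ : Data) : Prop where
  curve : IsCurve Θ.X Θ.Y
  meas_V : AEStronglyMeasurable Θ.V volume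
  meas_W : AEStronglyMeasurable Θ.W volume
  norm_lt_top : normG c Θ < ∞
  tnorm_lt_top : tnormG c Θ < ∞
  nonneg_V : ∀ᵐ X : ℝ, 0 ≤ (Θ.V X).x ∧ 0 ≤ (Θ.V X).J
  nonneg_W : ∀ᵐ Y : ℝ, 0 ≤ (Θ.W Y).x ∧ 0 ≤ (Θ.W Y).J
  absCont : ∀ a b : ℝ, AbsolutelyContinuousOnInterval Θ.Z a b
  compat : ∀ᵐ s : ℝ, HasDerivAt Θ.Z
    (deriv Θ.X s • Θ.V (Θ.X s) + deriv Θ.Y s • Θ.W (Θ.Y s)) s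
  energy_V : ∀ᵐ X : ℝ, 2 * (Θ.V X).J * (Θ.V X).x
    = (c (Θ.Z (genInv Θ.X X)).U * (Θ.V X).U) ^ 2
  energy_W : ∀ᵐ Y : ℝ, 2 * (Θ.W Y).J * (Θ.W Y).x
    = (c (Θ.Z (genInv Θ.Y Y)).U * (Θ.W Y).U) ^ 2
  tx_V : ∀ᵐ X : ℝ, (Θ.V X).x = c (Θ.Z (genInv Θ.X X)).U * (Θ.V X).t
  tx_W : ∀ᵐ Y : ℝ, (Θ.W Y).x = -c (Θ.Z (genInv Θ.Y Y)).U * (Θ.W Y).t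
  JK_V : ∀ᵐ X : ℝ, (Θ.V X).J = c (Θ.Z (genInv Θ.X X)).U * (Θ.V X).K
  JK_W : ∀ᵐ Y : ℝ, (Θ.W Y).J = -c (Θ.Z (genInv Θ.Y Y)).U * (Θ.W Y).K
  lim_J : Tendsto (fun s => (Θ.Z s).J) atBot (𝓝 0)

end Data

/-- The set `𝒢` of data. -/
def G (c : ℝ → ℝ) : Set Data := {Θ | Θ.MemG c}

/-- The partial derivative `Z_X`. -/
def dX (Z : ℝ → ℝ → Vec) (X Y : ℝ) : Vec := deriv (fun ξ => Z ξ Y) X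

/-- The partial derivative `Z_Y`. -/
def dY (Z : ℝ → ℝ → Vec) (X Y : ℝ) : Vec := deriv (fun η => Z X η) Y

/-- `Z` solves `Z_XY = F(Z)(Z_X, Z_Y)` on the rectangle `[Xl, Xr] × [Yl, Yr]`:
`Z ∈ W^{1,∞}`, `Z_X ∈ L^∞_X W^{1,∞}_Y`, `Z_Y ∈ L^∞_Y W^{1,∞}_X`, and the equation holds almost
everywhere for both `(Z_X)_Y` and `(Z_Y)_X`. For such a `Z` the representative of the weak
derivative `Z_X` which is continuous in `Y` is the classical partial derivative: for almost every
`X` it exists for all `Y`. The same holds for `Z_Y`. -/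
structure IsSolutionOn (c : ℝ → ℝ) (Z : ℝ → ℝ → Vec) (Xl Xr Yl Yr : ℝ) : Prop where
  lipschitz : ∃ L : ℝ≥0,
    LipschitzOnWith L (fun p : ℝ × ℝ => Z p.1 p.2) (Icc Xl Xr ×ˢ Icc Yl Yr)
  reg_X : ∃ L : ℝ≥0, ∀ᵐ X ∂volume.restrict (Icc Xl Xr),
    (∀ Y ∈ Icc Yl Yr, DifferentiableAt ℝ (fun ξ => Z ξ Y) X) ∧
      LipschitzOnWith L (fun Y => dX Z X Y) (Icc Yl Yr)
  reg_Y : ∃ L : ℝ≥0, ∀ᵐ Y ∂volume.restrict (Icc Yl Yr),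
    (∀ X ∈ Icc Xl Xr, DifferentiableAt ℝ (fun η => Z X η) Y) ∧
      LipschitzOnWith L (fun X => dY Z X Y) (Icc Xl Xr)
  eq_XY : ∀ᵐ X ∂volume.restrict (Icc Xl Xr), ∀ᵐ Y ∂volume.restrict (Icc Yl Yr),
    HasDerivAt (fun η => dX Z X η) (F c (Z X Y) (dX Z X Y) (dY Z X Y)) Y
  eq_YX : ∀ᵐ Y ∂volume.restrict (Icc Yl Yr), ∀ᵐ X ∂volume.restrict (Icc Xl Xr),
    HasDerivAt (fun ξ => dY Z ξ Y) (F c (Z X Y) (dX Z X Y) (dY Z X Y)) X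

/-- Membership in `ℋ(Ω)` for `Ω = [Xl, Xr] × [Yl, Yr]`: a solution on `Ω` with
`x_X = c(U) t_X`, `J_X = c(U) K_X`, `2 J_X x_X = (c(U) U_X)²`, `x_X, J_X ≥ 0`, `x_X + J_X > 0`
for almost every `X` and all `Y`, and the corresponding relations for the `Y`-derivatives. -/
structure MemHOn (c : ℝ → ℝ) (Z : ℝ → ℝ → Vec) (Xl Xr Yl Yr : ℝ) : Prop where
  isSolution : IsSolutionOn c Z Xl Xr Yl Yr
  rel_X : ∀ᵐ X ∂volume.restrict (Icc Xl Xr), ∀ Y ∈ Icc Yl Yr,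
    (dX Z X Y).x = c (Z X Y).U * (dX Z X Y).t ∧
    (dX Z X Y).J = c (Z X Y).U * (dX Z X Y).K ∧
    2 * (dX Z X Y).J * (dX Z X Y).x = (c (Z X Y).U * (dX Z X Y).U) ^ 2 ∧
    0 ≤ (dX Z X Y).x ∧ 0 ≤ (dX Z X Y).J ∧ 0 < (dX Z X Y).x + (dX Z X Y).J
  rel_Y : ∀ᵐ Y ∂volume.restrict (Icc Yl Yr), ∀ X ∈ Icc Xl Xr,
    (dY Z X Y).x = -c (Z X Y).U * (dY Z X Y).t ∧
    (dY Z X Y).J = -c (Z X Y).U * (dY Z X Y).K ∧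
    2 * (dY Z X Y).J * (dY Z X Y).x = (c (Z X Y).U * (dY Z X Y).U) ^ 2 ∧
    0 ≤ (dY Z X Y).x ∧ 0 ≤ (dY Z X Y).J ∧ 0 < (dY Z X Y).x + (dY Z X Y).J

/-- The data `Z • (χ, ψ)` which `Z` induces on the curve `(χ, ψ)`: `𝒵(s) = Z(χ(s), ψ(s))`,
`𝒱(X) = Z_X(X, ψ(χ⁻¹(X)))` and `𝒲(Y) = Z_Y(χ(ψ⁻¹(Y)), Y)`. -/
def bullet (Z : ℝ → ℝ → Vec) (χ ψ : ℝ → ℝ) : Data where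
  X := χ
  Y := ψ
  Z := fun s => Z (χ s) (ψ s)
  V := fun X => dX Z X (ψ (genInv χ X))
  W := fun Y => dY Z (χ (genInv ψ Y)) Y

/-- The set `ℋ` of global solutions: `Z ∈ ℋ(Ω)` for every rectangle `Ω`, and
`Z • (χ, ψ) ∈ 𝒢` for some curve `(χ, ψ) ∈ 𝒞`. -/
def H (c : ℝ → ℝ) : Set (ℝ → ℝ → Vec) :=
  {Z | (∀ Xl Xr Yl Yr : ℝ, Xl < Xr → Yl < Yr → MemHOn c Z Xl Xr Yl Yr) ∧
    ∃ χ ψ : ℝ → ℝ, IsCurve χ ψ ∧ bullet Z χ ψ ∈ G c}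

/-- `Z` takes the data `Θ`, that is `Θ = Z • (𝒳, 𝒴)`. -/
def Matches (Θ : Data) (Z : ℝ → ℝ → Vec) : Prop := Θ.Same (bullet Z Θ.X Θ.Y)

end NVW

end

/-!
In characteristic coordinates the problem is a Goursat problem for a semilinear hyperbolic system.
For given `f` the equation `Z_XY = f` with data `Θ` is solved by integration: `Data.fieldX` and
`Data.fieldY` are the two derivatives and `Data.potential` is the solution. The compatibility
condition of the data makes vertical and horizontal integration agree (`potential_swap`), which
needs a chain rule along curves with horizontal and vertical pieces. The equation to be solved is
therefore `f = F(potential f)(fieldX f, fieldY f)`.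

The quantity `gap`, the parameter length of the part of the curve cut off by the two
characteristics through a point, decreases towards the curve along both characteristics. In the
norm with weight `e^{-λ gap}` integration along a characteristic gains a factor `2 / λ`, so that
the Picard map of the problem with truncated nonlinearity is a contraction
(`Regular.exists_truncated_solution`), and the linear homogeneous Goursat problem has only the zero
solution (`IsCurve.goursat_eq_zero`).

The truncation is removed on each strip `gap ≤ n` by an a priori bound (`exists_apriori_bound`).
The algebraic relations propagate from the curve (`Solves.rel`): the energy defect solves a linear
equation along characteristics, and the defects of the linear relations solve a homogeneous Goursat
problem. Given the relations, `x + J` is increasing along characteristics and dominates the other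
components: `|U_X| ≤ κ (x + J)_X`, and likewise in `Y`. So the variation of `U` on the strip is
controlled by that of `x + J`, hence by the values on the curve, and the derivatives grow at most
exponentially with the variation of `x + J`. Advancing from the curve in short steps, the solution
stays where the truncation is inactive (`Regular.exists_solution_strip`); the solutions on the
strips agree by uniqueness and combine to a global one.

Uniqueness in `ℋ` applies the same Goursat argument to the differences of two solutions and of
their derivatives, on the lines where the derivatives are defined; these lines are dense, and
solutions are continuous.
-/

namespace NVW

/-! ### Locally Lipschitz functions of one variable -/

theorem absolutelyContinuousOnInterval_of_locallyLipschitz {E : Type*} [PseudoMetricSpace E]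
    {g : ℝ → E} (hg : LocallyLipschitz g) (a b : ℝ) : AbsolutelyContinuousOnInterval g a b := by
  obtain ⟨K, hK⟩ := (hg.locallyLipschitzOn (s := uIcc a b)).exists_lipschitzOnWith_of_compact
    isCompact_uIcc
  exact hK.absolutelyContinuousOnInterval

theorem integral_deriv_eq_sub_of_locallyLipschitz {g : ℝ → ℝ} (hg : LocallyLipschitz g) (a b : ℝ) :
    ∫ x in a..b, deriv g x = g b - g a :=
  (absolutelyContinuousOnInterval_of_locallyLipschitz hg a b).integral_deriv_eq_sub

theorem le_of_ae_deriv_nonpos {g g' : ℝ → ℝ} {a b : ℝ} (hg : LocallyLipschitz g) (hab : a ≤ b)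
    (h : ∀ᵐ x, x ∈ Ioo a b → HasDerivAt g (g' x) x ∧ g' x ≤ 0) : g b ≤ g a := by
  have h1 := integral_deriv_eq_sub_of_locallyLipschitz hg a b
  have h2 : 0 ≤ ∫ x in a..b, -deriv g x := by
    apply intervalIntegral.integral_nonneg_of_ae_restrict hab
    rw [EventuallyLE, ae_restrict_iff' measurableSet_Icc]
    filter_upwards [h, Measure.ae_ne volume a, Measure.ae_ne volume b] with x hx hxa hxb hxI
    obtain ⟨h3, h4⟩ := hx ⟨lt_of_le_of_ne hxI.1 hxa.symm, lt_of_le_of_ne hxI.2 hxb⟩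
    simpa [h3.deriv] using h4
  rw [intervalIntegral.integral_neg] at h2
  linarith

theorem le_of_ae_deriv_nonneg {g g' : ℝ → ℝ} {a b : ℝ} (hg : LocallyLipschitz g) (hab : a ≤ b)
    (h : ∀ᵐ x, x ∈ Ioo a b → HasDerivAt g (g' x) x ∧ 0 ≤ g' x) : g a ≤ g b := by
  have h1 := le_of_ae_deriv_nonpos (g := fun x => -g x) (g' := fun x => -g' x) hg.neg hab (by
    filter_upwards [h] with x hx hxI
    exact ⟨(hx hxI).1.neg, by linarith [(hx hxI).2]⟩)
  linarith

theorem contDiff_comp_locallyLipschitz {E F : Type*} [NormedAddCommGroup E] [NormedSpace ℝ E]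
    [NormedAddCommGroup F] [NormedSpace ℝ F] {Φ : E → F} (hΦ : ContDiff ℝ 1 Φ) {g : ℝ → E}
    (hg : LocallyLipschitz g) : LocallyLipschitz fun x => Φ (g x) :=
  hΦ.locallyLipschitz.comp hg

/-- Comparison with a function `N`: if `|h'| ≤ C |h| N'` almost everywhere, then `h² e^{-2CN}` is
nonincreasing and `h² e^{2CN}` is nondecreasing. -/
theorem sq_exp_monotone_of_abs_deriv_le {h h' N N' : ℝ → ℝ} {a b C : ℝ} (hh : LocallyLipschitz h)
    (hN : LocallyLipschitz N) (hab : a ≤ b)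
    (hd : ∀ᵐ x, x ∈ Ioo a b → HasDerivAt h (h' x) x ∧ HasDerivAt N (N' x) x ∧
      |h' x| ≤ C * |h x| * N' x) :
    h b ^ 2 * Real.exp (-(2 * C * N b)) ≤ h a ^ 2 * Real.exp (-(2 * C * N a)) ∧
      h a ^ 2 * Real.exp (2 * C * N a) ≤ h b ^ 2 * Real.exp (2 * C * N b) := by
  have key : ∀ x, |h' x| ≤ C * |h x| * N' x → |h x * h' x| ≤ C * N' x * h x ^ 2 := fun x hx => by
    rw [abs_mul, ← sq_abs (h x)]
    nlinarith [abs_nonneg (h x)]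
  constructor
  · refine le_of_ae_deriv_nonpos (g := fun x => h x ^ 2 * Real.exp (-(2 * C * N x)))
      (g' := fun x => (2 * (h x * h' x) - 2 * C * N' x * h x ^ 2) * Real.exp (-(2 * C * N x)))
      ?_ hab ?_
    · exact contDiff_comp_locallyLipschitz
        (Φ := fun p : ℝ × ℝ => p.1 ^ 2 * Real.exp (-(2 * C * p.2))) (by fun_prop) (hh.prodMk hN)
    · filter_upwards [hd] with x hx hxI
      obtain ⟨h1, h2, h3⟩ := hx hxI
      refine ⟨?_, ?_⟩
      · convert! (h1.pow 2).mul ((h2.const_mul (2 * C)).neg.exp) using 1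
        simp; ring
      · have := (abs_le.1 (key x h3)).2
        exact mul_nonpos_of_nonpos_of_nonneg (by linarith) (Real.exp_pos _).le
  · refine le_of_ae_deriv_nonneg (g := fun x => h x ^ 2 * Real.exp (2 * C * N x))
      (g' := fun x => (2 * (h x * h' x) + 2 * C * N' x * h x ^ 2) * Real.exp (2 * C * N x))
      ?_ hab ?_
    · exact contDiff_comp_locallyLipschitz
        (Φ := fun p : ℝ × ℝ => p.1 ^ 2 * Real.exp (2 * C * p.2)) (by fun_prop) (hh.prodMk hN)
    · filter_upwards [hd] with x hx hxI
      obtain ⟨h1, h2, h3⟩ := hx hxI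
      refine ⟨?_, ?_⟩
      · convert! (h1.pow 2).mul ((h2.const_mul (2 * C)).exp) using 1
        simp; ring
      · have := (abs_le.1 (key x h3)).1
        exact mul_nonneg (by linarith) (Real.exp_pos _).le

/-- Exponential bounds for a nonnegative function with `|h'| ≤ C |h| N'`. -/
theorem le_mul_exp_of_abs_deriv_le {h h' N N' : ℝ → ℝ} {a b C : ℝ} (hh : LocallyLipschitz h)
    (hN : LocallyLipschitz N) (hab : a ≤ b) (ha : 0 ≤ h a) (hb : 0 ≤ h b)
    (hd : ∀ᵐ x, x ∈ Ioo a b → HasDerivAt h (h' x) x ∧ HasDerivAt N (N' x) x ∧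
      |h' x| ≤ C * |h x| * N' x) :
    h b ≤ h a * Real.exp (C * (N b - N a)) ∧ h a ≤ h b * Real.exp (C * (N b - N a)) := by
  obtain ⟨h1, h2⟩ := sq_exp_monotone_of_abs_deriv_le hh hN hab hd
  have hexp : Real.exp (C * (N b - N a)) ^ 2 =
      Real.exp (2 * C * N b) * Real.exp (-(2 * C * N a)) := by
    rw [← Real.exp_nat_mul, ← Real.exp_add]; congr 1; push_cast; ring
  constructor
  · refine (pow_le_pow_iff_left₀ (by assumption) (by positivity) two_ne_zero).1 ?_
    rw [mul_pow, hexp]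
    have := mul_le_mul_of_nonneg_right h1 (Real.exp_pos (2 * C * N b)).le
    rw [mul_assoc, ← Real.exp_add] at this
    simp only [neg_add_cancel, Real.exp_zero, mul_one] at this
    linarith
  · refine (pow_le_pow_iff_left₀ (by assumption) (by positivity) two_ne_zero).1 ?_
    rw [mul_pow, hexp]
    have := mul_le_mul_of_nonneg_right h2 (Real.exp_pos (-(2 * C * N a))).le
    rw [mul_assoc, ← Real.exp_add] at this
    simp only [add_neg_cancel, Real.exp_zero, mul_one] at this
    linarith

/-- Backward and forward uniqueness for `|h'| ≤ k |h|`. -/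
theorem eq_zero_iff_of_abs_deriv_le {h h' : ℝ → ℝ} {a b k : ℝ} (hh : LocallyLipschitz h)
    (hd : ∀ᵐ x, x ∈ uIoc a b → HasDerivAt h (h' x) x ∧ |h' x| ≤ k * |h x|) :
    h a = 0 ↔ h b = 0 := by
  wlog hab : a ≤ b generalizing a b
  · exact (this (by rwa [uIoc_comm]) (le_of_not_ge hab)).symm
  obtain ⟨h1, h2⟩ := sq_exp_monotone_of_abs_deriv_le (N := id) (N' := fun _ => 1) (C := k) hh
    LocallyLipschitz.id hab (by
      filter_upwards [hd] with x hx hxI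
      obtain ⟨h3, h4⟩ := hx (by rw [uIoc_of_le hab]; exact Ioo_subset_Ioc_self hxI)
      exact ⟨h3, hasDerivAt_id x, by simpa using h4⟩)
  constructor
  · intro h0
    rw [h0] at h1
    have : h b ^ 2 ≤ 0 := by
      by_contra hc
      have := mul_pos (not_le.1 hc) (Real.exp_pos (-(2 * k * id b)))
      simp at h1 this; linarith
    exact pow_eq_zero_iff two_ne_zero |>.1 (le_antisymm this (sq_nonneg _))
  · intro h0
    rw [h0] at h2
    have : h a ^ 2 ≤ 0 := by
      by_contra hc
      have := mul_pos (not_le.1 hc) (Real.exp_pos (2 * k * id a))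
      simp at h2 this; linarith
    exact pow_eq_zero_iff two_ne_zero |>.1 (le_antisymm this (sq_nonneg _))

/-- Strongly measurable functions which are bounded on balls, the class in which integrands are
taken. -/
structure LocBounded {α E : Type*} [NormedAddCommGroup α] [MeasurableSpace α]
    [NormedAddCommGroup E] (g : α → E) : Prop where
  meas : StronglyMeasurable g
  bdd : ∀ R : ℝ, ∃ C : ℝ, ∀ x, ‖x‖ ≤ R → ‖g x‖ ≤ C

theorem abs_le_max_abs_of_mem_uIcc {a b x : ℝ} (hx : x ∈ uIcc a b) : |x| ≤ max |a| |b| := by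
  rcases le_total a b with h | h
  · rw [uIcc_of_le h] at hx
    exact abs_le_max_abs_abs hx.1 hx.2
  · rw [uIcc_of_ge h] at hx
    exact max_comm |a| |b| ▸ abs_le_max_abs_abs hx.1 hx.2

theorem LocBounded.intervalIntegrable {E : Type*} [NormedAddCommGroup E] {g : ℝ → E}
    (hg : LocBounded g) (a b : ℝ) : IntervalIntegrable g volume a b := by
  obtain ⟨C, hC⟩ := hg.bdd (max |a| |b|)
  rw [intervalIntegrable_iff]
  refine Measure.integrableOn_of_bounded (M := C) (by simp) hg.meas.aestronglyMeasurable ?_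
  rw [ae_restrict_iff' measurableSet_uIoc]
  refine Eventually.of_forall fun x hx => hC x ?_
  exact abs_le_max_abs_of_mem_uIcc (uIoc_subset_uIcc hx)

theorem LocBounded.locallyIntegrable {E : Type*} [NormedAddCommGroup E] {g : ℝ → E}
    (hg : LocBounded g) : LocallyIntegrable g := by
  intro x
  refine ⟨Ioc (x - 1) (x + 1), Ioc_mem_nhds (by linarith) (by linarith), ?_⟩
  have := hg.intervalIntegrable (x - 1) (x + 1)
  rwa [intervalIntegrable_iff, uIoc_of_le (by linarith)] at this

section Primitive

variable {E : Type*} [NormedAddCommGroup E] [NormedSpace ℝ E]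

/-- A function `G` with increments `∫ g`. -/
def IsPrimitive (G g : ℝ → E) : Prop := ∀ x y, G y - G x = ∫ t in x..y, g t

theorem IsPrimitive.ae_hasDerivAt [CompleteSpace E] {G g : ℝ → E} (h : IsPrimitive G g)
    (hg : LocBounded g) : ∀ᵐ x, HasDerivAt G (g x) x := by
  filter_upwards [LocallyIntegrable.ae_hasDerivAt_integral hg.locallyIntegrable] with x hx
  have : G = fun y => G 0 + ∫ t in (0:ℝ)..y, g t := by
    funext y; rw [← h 0 y]; abel
  rw [this]
  exact (hx 0).const_add _

theorem IsPrimitive.norm_sub_le {G g : ℝ → E} (h : IsPrimitive G g) {x y C : ℝ}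
    (hC : ∀ t ∈ uIoc x y, ‖g t‖ ≤ C) : ‖G y - G x‖ ≤ C * |y - x| := by
  rw [h x y]
  exact intervalIntegral.norm_integral_le_of_norm_le_const hC

theorem IsPrimitive.locallyLipschitz {G g : ℝ → E} (h : IsPrimitive G g) (hg : LocBounded g) :
    LocallyLipschitz G := by
  intro x
  obtain ⟨C, hC⟩ := hg.bdd (|x| + 1)
  refine ⟨C.toNNReal, Icc (x - 1) (x + 1), Icc_mem_nhds (by linarith) (by linarith), ?_⟩
  refine LipschitzOnWith.of_dist_le_mul fun y hy z hz => ?_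
  rw [dist_eq_norm, Real.dist_eq]
  have h1 : ∀ t ∈ uIoc z y, ‖g t‖ ≤ C := fun t ht => hC t (by
    have := uIoc_subset_uIcc ht
    have h2 := uIcc_subset_Icc hz hy this
    rw [Real.norm_eq_abs, abs_le]
    constructor
    · linarith [neg_abs_le x, h2.1]
    · linarith [le_abs_self x, h2.2])
  exact (h.norm_sub_le h1).trans (by gcongr; exact Real.le_coe_toNNReal C)

end Primitive

/-! ### Curves and their generalized inverses -/

namespace IsCurve

variable {χ ψ : ℝ → ℝ}

theorem symm (h : IsCurve χ ψ) : IsCurve ψ χ :=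
  ⟨h.bounded_right, h.bounded_left, h.lipschitz_right, h.lipschitz_left, h.monotone_right,
    h.monotone_left, fun s => by rw [add_comm]; exact h.normalized s⟩

theorem continuous_left (h : IsCurve χ ψ) : Continuous χ :=
  h.lipschitz_left.choose_spec.continuous

theorem bddAbove (h : IsCurve χ ψ) (X : ℝ) : BddAbove {s | χ s < X} := by
  obtain ⟨M, hM⟩ := h.bounded_left
  refine ⟨X + M, fun s hs => ?_⟩
  have h1 := (abs_le.1 (hM s)).1
  simp only [mem_ofPred_eq] at hs
  linarith

theorem nonempty (h : IsCurve χ ψ) (X : ℝ) : {s | χ s < X}.Nonempty := by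
  obtain ⟨M, hM⟩ := h.bounded_left
  refine ⟨X - M - 1, ?_⟩
  have h1 := (abs_le.1 (hM (X - M - 1))).2
  simp only [mem_ofPred_eq]
  linarith

theorem lt_genInv_iff (h : IsCurve χ ψ) {s X : ℝ} : s < genInv χ X ↔ χ s < X := by
  constructor
  · intro hs
    obtain ⟨r, hr, hsr⟩ := exists_lt_of_lt_csSup (h.nonempty X) hs
    exact (h.monotone_left hsr.le).trans_lt hr
  · intro hs
    have h1 : ∀ᶠ r in 𝓝[>] s, χ r < X :=
      (h.continuous_left.continuousAt.eventually_lt_const hs).filter_mono nhdsWithin_le_nhds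
    obtain ⟨r, hr, hsr⟩ := (h1.and self_mem_nhdsWithin).exists
    exact lt_of_lt_of_le hsr (le_csSup (h.bddAbove X) hr)

theorem genInv_le_iff (h : IsCurve χ ψ) {s X : ℝ} : genInv χ X ≤ s ↔ X ≤ χ s := by
  rw [← not_lt, h.lt_genInv_iff, not_lt]

theorem apply_genInv (h : IsCurve χ ψ) (X : ℝ) : χ (genInv χ X) = X := by
  refine le_antisymm ?_ (h.genInv_le_iff.1 le_rfl)
  refine le_of_tendsto (h.continuous_left.continuousAt.tendsto.mono_left
    (nhdsWithin_le_nhds (s := Iio (genInv χ X)))) ?_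
  filter_upwards [self_mem_nhdsWithin] with s hs using (h.lt_genInv_iff.1 hs).le

theorem monotone_genInv (h : IsCurve χ ψ) : Monotone (genInv χ) := fun X Y hXY => by
  rw [h.genInv_le_iff, h.apply_genInv]; exact hXY

theorem sub_le_left (h : IsCurve χ ψ) {s r : ℝ} (hsr : s ≤ r) : χ r - χ s ≤ 2 * (r - s) := by
  have h1 := h.normalized s
  have h2 := h.normalized r
  have h3 := h.monotone_right hsr
  linarith

theorem sub_le_genInv_sub (h : IsCurve χ ψ) {X X' : ℝ} (hX : X ≤ X') :
    (X' - X) / 2 ≤ genInv χ X' - genInv χ X := by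
  have := h.sub_le_left (h.monotone_genInv hX)
  rw [h.apply_genInv, h.apply_genInv] at this
  linarith

theorem measurable_genInv (h : IsCurve χ ψ) : Measurable (genInv χ) := h.monotone_genInv.measurable

end IsCurve

/-- The parameter distance between the two points of the curve which lie on the vertical and on the
horizontal line through `(X, Y)`. It decreases along the characteristics towards the curve. -/
noncomputable def gap (χ ψ : ℝ → ℝ) (X Y : ℝ) : ℝ := |genInv χ X - genInv ψ Y|

theorem gap_comm (χ ψ : ℝ → ℝ) (X Y : ℝ) : gap ψ χ Y X = gap χ ψ X Y := abs_sub_comm _ _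

theorem gap_nonneg (χ ψ : ℝ → ℝ) (X Y : ℝ) : 0 ≤ gap χ ψ X Y := abs_nonneg _

namespace IsCurve

variable {χ ψ : ℝ → ℝ}

theorem measurable_gap (h : IsCurve χ ψ) : Measurable fun p : ℝ × ℝ => gap χ ψ p.1 p.2 :=
  ((h.measurable_genInv.comp measurable_fst).sub
    (h.symm.measurable_genInv.comp measurable_snd)).norm

/-- For `(X, η)` strictly between the curve and `(X, Y)` on a vertical line, the parameter `ψ⁻¹(η)`
lies between `χ⁻¹(X)` and `ψ⁻¹(Y)`, and it stays away from the latter because `ψ` has slope at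
most `2`. -/
theorem genInv_mem_of_between (h : IsCurve χ ψ) {X Y η : ℝ}
    (hη : η ∈ uIoo (ψ (genInv χ X)) Y) :
    (genInv χ X ≤ genInv ψ η ∧ genInv ψ η + (Y - η) / 2 ≤ genInv ψ Y ∧ η < Y) ∨
      (genInv ψ η ≤ genInv χ X ∧ genInv ψ Y + (η - Y) / 2 ≤ genInv ψ η ∧ Y < η) := by
  rcases le_total (ψ (genInv χ X)) Y with hY | hY
  · rw [uIoo_of_le hY] at hη
    refine Or.inl ⟨(h.symm.lt_genInv_iff.2 hη.1).le, ?_, hη.2⟩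
    linarith [h.symm.sub_le_genInv_sub hη.2.le]
  · rw [uIoo_of_ge hY] at hη
    refine Or.inr ⟨h.symm.genInv_le_iff.2 hη.2.le, ?_, hη.1⟩
    linarith [h.symm.sub_le_genInv_sub hη.1.le]

theorem gap_add_le (h : IsCurve χ ψ) {X Y η : ℝ} (hη : η ∈ uIoo (ψ (genInv χ X)) Y) :
    gap χ ψ X η + |Y - η| / 2 ≤ gap χ ψ X Y := by
  unfold gap
  rcases h.genInv_mem_of_between hη with ⟨h1, h2, h3⟩ | ⟨h1, h2, h3⟩
  · have e1 : |genInv χ X - genInv ψ η| = _ := abs_of_nonpos (by linarith)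
    have e2 : |genInv χ X - genInv ψ Y| = _ := abs_of_nonpos (by linarith)
    have e3 : |Y - η| = _ := abs_of_pos (by linarith)
    linarith
  · have e1 : |genInv χ X - genInv ψ η| = _ := abs_of_nonneg (by linarith)
    have e2 : |genInv χ X - genInv ψ Y| = _ := abs_of_nonneg (by linarith)
    have e3 : |Y - η| = _ := abs_of_neg (by linarith)
    linarith

end IsCurve

theorem ae_uIoc_of_uIoo {P : ℝ → Prop} {a b : ℝ} (h : ∀ x ∈ uIoo a b, P x) :
    ∀ᵐ x, x ∈ uIoc a b → P x := by
  filter_upwards [Measure.ae_ne volume (max a b)] with x hx hxI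
  exact h x ⟨hxI.1, lt_of_le_of_ne hxI.2 hx⟩

/-- The exponential kernel has integral at most `1 / μ` on either side of `b`. -/
theorem intervalIntegral_exp_neg_abs_le (a b : ℝ) {μ : ℝ} (hμ : 0 < μ) :
    |∫ t in a..b, Real.exp (-(μ * |b - t|))| ≤ 1 / μ := by
  have hd : ∀ c : ℝ, c ≠ 0 → ∀ t : ℝ, HasDerivAt (fun t => Real.exp (c * (t - b)) / c)
      (Real.exp (c * (t - b))) t := fun c hc t => by
    have := ((((hasDerivAt_id t).sub_const b).const_mul c).exp).div_const c
    convert! this using 1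
    simp; field_simp
  rcases le_total a b with hab | hab
  · rw [intervalIntegral.integral_congr (g := fun t => Real.exp (μ * (t - b)))]
    · rw [intervalIntegral.integral_eq_sub_of_hasDerivAt (fun t _ => hd μ hμ.ne' t)
        (by apply Continuous.intervalIntegrable; fun_prop)]
      have h1 : Real.exp (μ * (a - b)) ≤ 1 := Real.exp_le_one_iff.2 (by nlinarith)
      have h2 := Real.exp_pos (μ * (a - b))
      simp only [sub_self, mul_zero, Real.exp_zero]
      rw [← sub_div, abs_of_nonneg (div_nonneg (by linarith) hμ.le)]
      gcongr; linarith
    · intro t ht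
      rw [uIcc_of_le hab] at ht
      simp only
      rw [abs_of_nonneg (by linarith [ht.2])]; congr 1; ring
  · rw [intervalIntegral.integral_congr (g := fun t => Real.exp (-μ * (t - b)))]
    · rw [intervalIntegral.integral_eq_sub_of_hasDerivAt
        (fun t _ => hd (-μ) (neg_ne_zero.2 hμ.ne') t)
        (by apply Continuous.intervalIntegrable; fun_prop)]
      have h1 : Real.exp (-μ * (a - b)) ≤ 1 := Real.exp_le_one_iff.2 (by nlinarith)
      have h2 := Real.exp_pos (-μ * (a - b))
      simp only [sub_self, mul_zero, Real.exp_zero]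
      rw [← sub_div, div_neg, abs_neg, abs_of_nonneg (div_nonneg (by linarith) hμ.le)]
      gcongr; linarith
    · intro t ht
      rw [uIcc_of_ge hab] at ht
      simp only
      rw [abs_of_nonpos (by linarith [ht.1])]; congr 1; ring

namespace IsCurve

variable {χ ψ : ℝ → ℝ}

/-- Along a characteristic towards the curve the weight `e^{λ gap}` decays exponentially. -/
theorem exp_gap_le (h : IsCurve χ ψ) {X Y η l : ℝ} (hl : 0 < l)
    (hη : η ∈ uIoo (ψ (genInv χ X)) Y) :
    Real.exp (l * gap χ ψ X η) ≤
      Real.exp (l * gap χ ψ X Y) * Real.exp (-(l / 2 * |Y - η|)) := by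
  rw [← Real.exp_add, Real.exp_le_exp]
  have := h.gap_add_le hη
  nlinarith

theorem abs_integral_exp_le (χ ψ : ℝ → ℝ) (X Y : ℝ) {C l : ℝ} (hC : 0 ≤ C) (hl : 0 < l) :
    |∫ η in (ψ (genInv χ X))..Y,
      C * (Real.exp (l * gap χ ψ X Y) * Real.exp (-(l / 2 * |Y - η|)))| ≤
      2 * C / l * Real.exp (l * gap χ ψ X Y) := by
  rw [intervalIntegral.integral_const_mul, intervalIntegral.integral_const_mul, abs_mul, abs_mul,
    abs_of_nonneg hC, abs_of_pos (Real.exp_pos _)]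
  have h1 := intervalIntegral_exp_neg_abs_le (ψ (genInv χ X)) Y (half_pos hl)
  have h2 := Real.exp_pos (l * gap χ ψ X Y)
  calc C * (Real.exp (l * gap χ ψ X Y) * |_|)
      ≤ C * (Real.exp (l * gap χ ψ X Y) * (1 / (l / 2))) := by gcongr
    _ = _ := by field_simp

/-- Integration along a characteristic gains a factor `2 / λ` in the weighted norm. -/
theorem norm_integral_le_exp_gap (h : IsCurve χ ψ) {E : Type*} [NormedAddCommGroup E]
    [NormedSpace ℝ E] {X Y C l : ℝ} {g : ℝ → E} (hC : 0 ≤ C) (hl : 0 < l)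
    (hg : ∀ η ∈ uIoo (ψ (genInv χ X)) Y, ‖g η‖ ≤ C * Real.exp (l * gap χ ψ X η)) :
    ‖∫ η in (ψ (genInv χ X))..Y, g η‖ ≤ 2 * C / l * Real.exp (l * gap χ ψ X Y) := by
  refine (intervalIntegral.norm_integral_le_abs_of_norm_le ?_ ?_).trans
    (abs_integral_exp_le χ ψ X Y hC hl)
  · rw [ae_restrict_iff' measurableSet_uIoc]
    refine ae_uIoc_of_uIoo fun η hη => (hg η hη).trans ?_
    gcongr
    exact h.exp_gap_le hl hη
  · apply Continuous.intervalIntegrable; fun_prop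

/-- **Uniqueness for the homogeneous Goursat problem.** Let `p` and `q` be bounded on a set `S`
which contains, with a point, almost all of the two characteristics joining it to the curve. If `p`
is controlled by the integral of `p + q` along vertical lines and `q` along horizontal lines, then
both vanish on `S`. The integral inequalities are stated through continuous majorants `k`, so that
neither `p` nor `q` has to be measurable. -/
theorem goursat_eq_zero (h : IsCurve χ ψ) {S : Set (ℝ × ℝ)} {p q : ℝ → ℝ → ℝ} {L M : ℝ}
    (hL : 0 ≤ L) (hp : ∀ X Y, (X, Y) ∈ S → 0 ≤ p X Y ∧ p X Y ≤ M)
    (hq : ∀ X Y, (X, Y) ∈ S → 0 ≤ q X Y ∧ q X Y ≤ M)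
    (hS1 : ∀ X Y, (X, Y) ∈ S → ∀ᵐ η, η ∈ uIoc (ψ (genInv χ X)) Y → (X, η) ∈ S)
    (hS2 : ∀ X Y, (X, Y) ∈ S → ∀ᵐ ξ, ξ ∈ uIoc (χ (genInv ψ Y)) X → (ξ, Y) ∈ S)
    (h1 : ∀ X Y, (X, Y) ∈ S → ∀ k : ℝ → ℝ, Continuous k →
      (∀ᵐ η, η ∈ uIoc (ψ (genInv χ X)) Y → L * (p X η + q X η) ≤ k η) →
      p X Y ≤ |∫ η in (ψ (genInv χ X))..Y, k η|)
    (h2 : ∀ X Y, (X, Y) ∈ S → ∀ k : ℝ → ℝ, Continuous k →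
      (∀ᵐ ξ, ξ ∈ uIoc (χ (genInv ψ Y)) X → L * (p ξ Y + q ξ Y) ≤ k ξ) →
      q X Y ≤ |∫ ξ in (χ (genInv ψ Y))..X, k ξ|) :
    ∀ X Y, (X, Y) ∈ S → p X Y = 0 ∧ q X Y = 0 := by
  set l : ℝ := 8 * L + 1 with hl
  have hl0 : 0 < l := by positivity
  set e : ℝ → ℝ → ℝ := fun X Y => Real.exp (l * gap χ ψ X Y) with he
  have he1 : ∀ X Y, 1 ≤ e X Y := fun X Y =>
    Real.one_le_exp (mul_nonneg hl0.le (gap_nonneg _ _ _ _))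
  have key : ∀ n : ℕ, ∀ X Y, (X, Y) ∈ S →
      p X Y ≤ |M| * (1 / 2) ^ n * e X Y ∧ q X Y ≤ |M| * (1 / 2) ^ n * e X Y := by
    intro n
    induction n with
    | zero =>
      intro X Y hXY
      have h3 : |M| ≤ |M| * (1 / 2) ^ 0 * e X Y := by
        rw [pow_zero, mul_one]; exact le_mul_of_one_le_right (abs_nonneg _) (he1 X Y)
      exact ⟨((hp X Y hXY).2.trans (le_abs_self M)).trans h3,
        ((hq X Y hXY).2.trans (le_abs_self M)).trans h3⟩
    | succ n ih =>
      set m := |M| * (1 / 2) ^ n with hm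
      have hm0 : 0 ≤ m := by positivity
      have hfin : ∀ X Y, 2 * (L * (2 * m)) / l * e X Y ≤ |M| * (1 / 2) ^ (n + 1) * e X Y := by
        intro X Y
        have : 2 * (L * (2 * m)) / l ≤ m * (1 / 2) := by
          rw [div_le_iff₀ hl0, hl]; nlinarith
        rw [pow_succ, ← mul_assoc |M|]
        exact mul_le_mul_of_nonneg_right this (Real.exp_pos _).le
      intro X Y hXY
      constructor
      · refine ((h1 X Y hXY (fun η => L * (2 * m) * (e X Y * Real.exp (-(l / 2 * |Y - η|))))
          (by fun_prop) ?_).trans (abs_integral_exp_le χ ψ X Y (by positivity) hl0)).trans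
          (hfin X Y)
        filter_upwards [hS1 X Y hXY, ae_uIoc_of_uIoo (P := fun η => e X η ≤
          e X Y * Real.exp (-(l / 2 * |Y - η|))) fun η hη => h.exp_gap_le hl0 hη] with η h3 h4 h5
        obtain ⟨h6, h7⟩ := ih X η (h3 h5)
        calc L * (p X η + q X η) ≤ L * (m * e X η + m * e X η) := by gcongr
          _ = L * (2 * m) * e X η := by ring
          _ ≤ _ := by gcongr; exact h4 h5
      · have hg : gap ψ χ Y X = gap χ ψ X Y := gap_comm χ ψ X Y
        have h8 := abs_integral_exp_le ψ χ Y X (C := L * (2 * m)) (by positivity) hl0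
        rw [hg] at h8
        refine ((h2 X Y hXY (fun ξ => L * (2 * m) * (e X Y * Real.exp (-(l / 2 * |X - ξ|))))
          (by fun_prop) ?_).trans h8).trans (hfin X Y)
        have h9 : ∀ ξ ∈ uIoo (χ (genInv ψ Y)) X, e ξ Y ≤
            e X Y * Real.exp (-(l / 2 * |X - ξ|)) := fun ξ hξ => by
          have := h.symm.exp_gap_le hl0 hξ
          rwa [gap_comm χ ψ, gap_comm χ ψ] at this
        filter_upwards [hS2 X Y hXY, ae_uIoc_of_uIoo h9] with ξ h3 h4 h5
        obtain ⟨h6, h7⟩ := ih ξ Y (h3 h5)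
        calc L * (p ξ Y + q ξ Y) ≤ L * (m * e ξ Y + m * e ξ Y) := by gcongr
          _ = L * (2 * m) * e ξ Y := by ring
          _ ≤ _ := by gcongr; exact h4 h5
  intro X Y hXY
  have hlim : Tendsto (fun n : ℕ => |M| * (1 / 2) ^ n * e X Y) atTop (𝓝 0) := by
    simpa using ((tendsto_pow_atTop_nhds_zero_of_lt_one (r := (1 / 2 : ℝ)) (by norm_num)
      (by norm_num)).const_mul |M|).mul_const (e X Y)
  exact ⟨le_antisymm (ge_of_tendsto' hlim fun n => (key n X Y hXY).1) (hp X Y hXY).1,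
    le_antisymm (ge_of_tendsto' hlim fun n => (key n X Y hXY).2) (hq X Y hXY).1⟩

/-- A null set is met by a monotone curve coordinate only where its derivative vanishes. -/
theorem ae_deriv_eq_zero_or (h : IsCurve χ ψ) {P : ℝ → Prop} (hP : ∀ᵐ X, P X) :
    ∀ᵐ s, DifferentiableAt ℝ χ s ∧ (deriv χ s = 0 ∨ P (χ s)) := by
  have hdiff : ∀ᵐ s, DifferentiableAt ℝ χ s := h.monotone_left.ae_differentiableAt
  set N := toMeasurable volume {X | ¬ P X} with hN
  have hN0 : volume N = 0 := by rw [hN, measure_toMeasurable]; exact hP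
  set A : Set ℝ := {s | DifferentiableAt ℝ χ s} ∩ χ ⁻¹' N with hA
  have hAm : MeasurableSet A := (measurableSet_of_differentiableAt ℝ χ).inter
    (h.continuous_left.measurable (measurableSet_toMeasurable _ _))
  have h1 : ∫⁻ s in A, ENNReal.ofReal (deriv χ s) = 0 := by
    rw [lintegral_deriv_eq_volume_image_of_monotoneOn hAm
      (fun s hs => hs.1.hasDerivAt.hasDerivWithinAt) (h.monotone_left.monotoneOn _)]
    exact measure_mono_null (by rintro _ ⟨s, hs, rfl⟩; exact hs.2) hN0
  rw [lintegral_eq_zero_iff (by fun_prop), EventuallyEq, ae_restrict_iff' hAm] at h1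
  filter_upwards [hdiff, h1] with s hs h2
  refine ⟨hs, ?_⟩
  by_cases hPs : P (χ s)
  · exact Or.inr hPs
  · left
    have h3 := h2 ⟨hs, subset_toMeasurable _ _ hPs⟩
    simp only [Pi.zero_apply, ENNReal.ofReal_eq_zero] at h3
    exact le_antisymm h3 h.monotone_left.deriv_nonneg

end IsCurve

/-! ### Integrals along characteristics -/

section Param

variable {E : Type*} [NormedAddCommGroup E]

theorem norm_pair_le {X Y R : ℝ} : ‖((X, Y) : ℝ × ℝ)‖ ≤ R ↔ |X| ≤ R ∧ |Y| ≤ R := by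
  rw [Prod.norm_def, max_le_iff]; rfl

theorem LocBounded.exists_bound {f : ℝ → ℝ → E} (hf : LocBounded (Function.uncurry f)) (R : ℝ) :
    ∃ C, 0 ≤ C ∧ ∀ X Y, |X| ≤ R → |Y| ≤ R → ‖f X Y‖ ≤ C := by
  obtain ⟨C, hC⟩ := hf.bdd R
  exact ⟨|C|, abs_nonneg _, fun X Y hX hY => (hC (X, Y) (norm_pair_le.2 ⟨hX, hY⟩)).trans
    (le_abs_self C)⟩

theorem LocBounded.of_exists {f : ℝ → ℝ → E} (hm : StronglyMeasurable (Function.uncurry f))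
    (h : ∀ R, ∃ C, ∀ X Y, |X| ≤ R → |Y| ≤ R → ‖f X Y‖ ≤ C) :
    LocBounded (Function.uncurry f) :=
  ⟨hm, fun R => (h R).imp fun _ hC p hp => hC p.1 p.2 (norm_pair_le.1 hp).1 (norm_pair_le.1 hp).2⟩

theorem LocBounded.left {f : ℝ → ℝ → E} (hf : LocBounded (Function.uncurry f)) (X : ℝ) :
    LocBounded (f X) := by
  refine ⟨hf.meas.comp_measurable measurable_prodMk_left, fun R => ?_⟩
  obtain ⟨C, -, hC⟩ := hf.exists_bound (max R |X|)
  exact ⟨C, fun Y hY => hC X Y (le_max_right _ _) (le_max_of_le_left hY)⟩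

theorem LocBounded.flip {f : ℝ → ℝ → E} (hf : LocBounded (Function.uncurry f)) :
    LocBounded (Function.uncurry (flip f)) := by
  refine LocBounded.of_exists (hf.meas.comp_measurable measurable_swap) fun R => ?_
  obtain ⟨C, -, hC⟩ := hf.exists_bound R
  exact ⟨C, fun X Y hX hY => hC Y X hY hX⟩

theorem LocBounded.right {f : ℝ → ℝ → E} (hf : LocBounded (Function.uncurry f)) (Y : ℝ) :
    LocBounded (fun X => f X Y) := hf.flip.left Y

variable [NormedSpace ℝ E]

theorem stronglyMeasurable_intervalIntegral_param {f : ℝ → ℝ → E} {b : ℝ → ℝ}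
    (hf : StronglyMeasurable (Function.uncurry f)) (hb : Measurable b) :
    StronglyMeasurable (Function.uncurry fun X Y => ∫ η in (b X)..Y, f X η) := by
  have key : ∀ (l u : ℝ × ℝ → ℝ), Measurable l → Measurable u →
      StronglyMeasurable fun p : ℝ × ℝ => ∫ η in Ioc (l p) (u p), f p.1 η := by
    intro l u hl hu
    have hS : MeasurableSet {q : (ℝ × ℝ) × ℝ | l q.1 < q.2 ∧ q.2 ≤ u q.1} :=
      (measurableSet_lt (hl.comp measurable_fst) measurable_snd).inter
        (measurableSet_le measurable_snd (hu.comp measurable_fst))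
    have h1 : StronglyMeasurable (Function.uncurry fun (p : ℝ × ℝ) (η : ℝ) =>
        {q : (ℝ × ℝ) × ℝ | l q.1 < q.2 ∧ q.2 ≤ u q.1}.indicator (fun q => f q.1.1 q.2) (p, η)) :=
      (hf.comp_measurable ((measurable_fst.comp measurable_fst).prodMk measurable_snd)).indicator hS
    convert! h1.integral_prod_right (ν := volume) using 2 with p
    rw [← integral_indicator measurableSet_Ioc]
    rfl
  exact (key _ _ (hb.comp measurable_fst) measurable_snd).sub
    (key _ _ measurable_snd (hb.comp measurable_fst))

theorem isPrimitive_const_add_integral {g : ℝ → E} (hg : LocBounded g) (v : E) (b : ℝ) :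
    IsPrimitive (fun Y => v + ∫ η in b..Y, g η) g := by
  intro x y
  simp only [add_sub_add_left_eq_sub]
  exact intervalIntegral.integral_interval_sub_left (hg.intervalIntegrable _ _)
    (hg.intervalIntegrable _ _)

/-- Differentiation of `∫_0^X g(ξ, Y) dξ` with an exceptional null set that does not depend on the
parameter `Y`, in which `g` is locally Lipschitz: it is enough to treat rational `Y`. -/
theorem ae_forall_hasDerivAt_integral [CompleteSpace E] {g : ℝ → ℝ → E}
    (hg : LocBounded (Function.uncurry g))
    (hlip : ∀ R, ∃ C, 0 ≤ C ∧ ∀ X Y Y', |X| ≤ R → |Y| ≤ R → |Y'| ≤ R →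
      ‖g X Y - g X Y'‖ ≤ C * |Y - Y'|) :
    ∀ᵐ X, ∀ Y, HasDerivAt (fun x => ∫ ξ in (0:ℝ)..x, g ξ Y) (g X Y) X := by
  have h1 : ∀ᵐ X, ∀ r : ℚ, HasDerivAt (fun x => ∫ ξ in (0:ℝ)..x, g ξ r) (g X r) X := by
    rw [ae_all_iff]
    intro r
    filter_upwards [LocallyIntegrable.ae_hasDerivAt_integral (hg.right (r : ℝ)).locallyIntegrable]
      with X hX using hX 0
  filter_upwards [h1] with X hX Y
  obtain ⟨C, hC0, hC⟩ := hlip (|X| + |Y| + 1)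
  rw [hasDerivAt_iff_isLittleO, Asymptotics.isLittleO_iff]
  intro ε hε
  obtain ⟨r, hr1, hr2⟩ := exists_rat_btwn (show Y < Y + min 1 (ε / (4 * (C + 1))) by
    have : 0 < min 1 (ε / (4 * (C + 1))) := by positivity
    linarith)
  have hr3 : |Y - r| ≤ ε / (4 * (C + 1)) := by
    rw [abs_of_neg (by linarith)]; linarith [min_le_right 1 (ε / (4 * (C + 1)))]
  have hr4 : |(r : ℝ)| ≤ |X| + |Y| + 1 := by
    have := min_le_left 1 (ε / (4 * (C + 1)))
    have h2 := le_abs_self Y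
    have h3 := neg_abs_le Y
    have h4 := abs_nonneg X
    rw [abs_le]; constructor <;> linarith
  have hY : |Y| ≤ |X| + |Y| + 1 := by linarith [abs_nonneg X]
  have hCr : C * |Y - r| ≤ ε / 4 := by
    calc C * |Y - r| ≤ (C + 1) * (ε / (4 * (C + 1))) := by gcongr; linarith
      _ = ε / 4 := by field_simp
  have h2 := (hasDerivAt_iff_isLittleO.1 (hX r))
  rw [Asymptotics.isLittleO_iff] at h2
  filter_upwards [h2 (half_pos hε), Metric.ball_mem_nhds X one_pos] with x hx1 hx2
  rw [Metric.mem_ball, Real.dist_eq] at hx2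
  have hint : ∀ Y, ∀ a b : ℝ, IntervalIntegrable (fun ξ => g ξ Y) volume a b := fun Y a b =>
    (hg.right Y).intervalIntegrable a b
  have h3 : ∀ Y', (∫ ξ in (0:ℝ)..x, g ξ Y') - ∫ ξ in (0:ℝ)..X, g ξ Y' = ∫ ξ in X..x, g ξ Y' :=
    fun Y' => intervalIntegral.integral_interval_sub_left (hint _ _ _) (hint _ _ _)
  have hXx : ∀ ξ ∈ uIcc X x, |ξ| ≤ |X| + |Y| + 1 := fun ξ hξ => by
    have h4 := abs_sub_left_of_mem_uIcc hξ
    have h5 := abs_sub_abs_le_abs_sub ξ X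
    linarith [abs_nonneg Y]
  rw [h3] at hx1 ⊢
  have h4 : ‖∫ ξ in X..x, (g ξ Y - g ξ r)‖ ≤ ε / 4 * |x - X| :=
    intervalIntegral.norm_integral_le_of_norm_le_const fun ξ hξ =>
      (hC ξ Y r (hXx ξ (uIoc_subset_uIcc hξ)) hY hr4).trans hCr
  have h5 : ‖(x - X) • (g X r - g X Y)‖ ≤ ε / 4 * |x - X| := by
    rw [norm_smul, Real.norm_eq_abs, mul_comm, norm_sub_rev]
    gcongr
    exact (hC X Y r (hXx X left_mem_uIcc) hY hr4).trans hCr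
  rw [intervalIntegral.integral_sub (hint _ _ _) (hint _ _ _)] at h4
  have h6 : (∫ ξ in X..x, g ξ Y) - (x - X) • g X Y =
      ((∫ ξ in X..x, g ξ r) - (x - X) • g X r) +
      ((∫ ξ in X..x, g ξ Y) - ∫ ξ in X..x, g ξ r) + (x - X) • (g X r - g X Y) := by
    rw [smul_sub]; abel
  rw [h6]
  refine (norm_add₃_le).trans ?_
  rw [Real.norm_eq_abs] at hx1 ⊢
  linarith

end Param

/-! ### The potential of a given right-hand side -/

namespace Data

/-- The field with `∂_Y = f` which equals `𝒱` on the curve. -/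
noncomputable def fieldX (Θ : Data) (f : ℝ → ℝ → Vec) (X Y : ℝ) : Vec :=
  Θ.V X + ∫ η in (Θ.Y (genInv Θ.X X))..Y, f X η

/-- The field with `∂_X = f` which equals `𝒲` on the curve. -/
noncomputable def fieldY (Θ : Data) (f : ℝ → ℝ → Vec) (X Y : ℝ) : Vec :=
  Θ.W Y + ∫ ξ in (Θ.X (genInv Θ.Y Y))..X, f ξ Y

/-- The function with `∂_Y = fieldY` which equals `𝒵` on the curve. It solves `Z_XY = f` with the
given data; that its `X`-derivative is `fieldX` is a consequence of the compatibility condition, see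
`ae_hasDerivAt_potential_left`. -/
noncomputable def potential (Θ : Data) (f : ℝ → ℝ → Vec) (X Y : ℝ) : Vec :=
  Θ.Z (genInv Θ.X X) + ∫ η in (Θ.Y (genInv Θ.X X))..Y, Θ.fieldY f X η

/-- Exchange of the roles of `X` and `Y`. -/
def swap (Θ : Data) : Data := ⟨Θ.Y, Θ.X, Θ.Z, Θ.W, Θ.V⟩

/-- Representatives of the data for which `𝒱` and `𝒲` are measurable and bounded by `m` everywhere;
only the conditions that do not involve `c` are included. -/
structure Regular (Θ : Data) (m : ℝ) : Prop where
  curve : IsCurve Θ.X Θ.Y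
  meas_V : Measurable Θ.V
  meas_W : Measurable Θ.W
  bound_V : ∀ X, ‖Θ.V X‖ ≤ m
  bound_W : ∀ Y, ‖Θ.W Y‖ ≤ m
  bound_Z : ∀ s, ‖Θ.Za s‖ ≤ m
  absCont : ∀ a b : ℝ, AbsolutelyContinuousOnInterval Θ.Z a b
  compat : ∀ᵐ s : ℝ, HasDerivAt Θ.Z
    (deriv Θ.X s • Θ.V (Θ.X s) + deriv Θ.Y s • Θ.W (Θ.Y s)) s

namespace Regular

variable {Θ : Data} {m : ℝ} {f : ℝ → ℝ → Vec}

theorem swap (h : Θ.Regular m) : Θ.swap.Regular m :=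
  ⟨h.curve.symm, h.meas_W, h.meas_V, h.bound_W, h.bound_V, h.bound_Z, h.absCont, by
    filter_upwards [h.compat] with s hs
    rw [add_comm]; exact hs⟩

theorem measurable_base (h : Θ.Regular m) : Measurable fun X => Θ.Y (genInv Θ.X X) :=
  h.curve.symm.continuous_left.measurable.comp h.curve.measurable_genInv

theorem exists_base_bound (h : Θ.Regular m) :
    ∃ M, 0 ≤ M ∧ ∀ X, |Θ.Y (genInv Θ.X X)| ≤ |X| + M := by
  obtain ⟨M₁, h₁⟩ := h.curve.bounded_left
  obtain ⟨M₂, h₂⟩ := h.curve.bounded_right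
  refine ⟨M₁ + M₂, ?_, fun X => ?_⟩
  · exact add_nonneg ((abs_nonneg _).trans (h₁ 0)) ((abs_nonneg _).trans (h₂ 0))
  · have h3 := h₁ (genInv Θ.X X)
    have h4 := h₂ (genInv Θ.X X)
    rw [h.curve.apply_genInv] at h3
    rw [abs_le] at *
    have h5 := le_abs_self X
    have h6 := neg_abs_le X
    constructor <;> linarith [h3.1, h3.2, h4.1, h4.2]

theorem isPrimitive_fieldX (hf : LocBounded (Function.uncurry f)) (X : ℝ) :
    IsPrimitive (Θ.fieldX f X) (f X) :=
  isPrimitive_const_add_integral (hf.left X) _ _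

theorem isPrimitive_fieldY (hf : LocBounded (Function.uncurry f)) (Y : ℝ) :
    IsPrimitive (fun X => Θ.fieldY f X Y) (fun X => f X Y) :=
  isPrimitive_const_add_integral (hf.right Y) _ _

theorem locBounded_fieldX (h : Θ.Regular m) (hf : LocBounded (Function.uncurry f)) :
    LocBounded (Function.uncurry (Θ.fieldX f)) := by
  refine LocBounded.of_exists ?_ fun R => ?_
  · exact (h.meas_V.comp measurable_fst).stronglyMeasurable.add
      (stronglyMeasurable_intervalIntegral_param hf.meas h.measurable_base)
  · obtain ⟨M, hM0, hM⟩ := h.exists_base_bound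
    obtain ⟨C, hC0, hC⟩ := hf.exists_bound (R + M)
    refine ⟨m + C * (2 * (R + M)), fun X Y hX hY => ?_⟩
    refine (norm_add_le _ _).trans (add_le_add (h.bound_V X) ?_)
    have h1 := hM X
    refine (intervalIntegral.norm_integral_le_of_norm_le_const (C := C) fun η hη => ?_).trans ?_
    · have := abs_le_max_abs_of_mem_uIcc (uIoc_subset_uIcc hη)
      refine hC X η (by linarith) (this.trans (max_le (by linarith) (by linarith)))
    · gcongr
      refine (abs_sub _ _).trans ?_
      linarith

theorem locBounded_fieldY (h : Θ.Regular m) (hf : LocBounded (Function.uncurry f)) :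
    LocBounded (Function.uncurry (Θ.fieldY f)) :=
  (h.swap.locBounded_fieldX hf.flip).flip

theorem isPrimitive_potential (h : Θ.Regular m) (hf : LocBounded (Function.uncurry f)) (X : ℝ) :
    IsPrimitive (Θ.potential f X) (Θ.fieldY f X) :=
  isPrimitive_const_add_integral ((h.locBounded_fieldY hf).left X) _ _

theorem fieldX_sub_le (hf : LocBounded (Function.uncurry f)) (R : ℝ) :
    ∃ C, 0 ≤ C ∧ ∀ X Y Y', |X| ≤ R → |Y| ≤ R → |Y'| ≤ R →
      ‖Θ.fieldX f X Y - Θ.fieldX f X Y'‖ ≤ C * |Y - Y'| := by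
  obtain ⟨C, hC0, hC⟩ := hf.exists_bound R
  refine ⟨C, hC0, fun X Y Y' hX hY hY' => ?_⟩
  refine (isPrimitive_fieldX hf X).norm_sub_le fun t ht => hC X t hX ?_
  exact (abs_le_max_abs_of_mem_uIcc (uIoc_subset_uIcc ht)).trans (max_le hY' hY)

/-- The potential of the one-form `fieldX dX + fieldY dY`, normalized at the origin. -/
noncomputable def pot (Θ : Data) (f : ℝ → ℝ → Vec) (X Y : ℝ) : Vec :=
  (∫ ξ in (0:ℝ)..X, Θ.fieldX f ξ 0) + ∫ η in (0:ℝ)..Y, Θ.fieldY f X η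

/-- By Fubini, integration along the other two sides of the rectangle gives the same potential. -/
theorem pot_eq (h : Θ.Regular m) (hf : LocBounded (Function.uncurry f)) (X Y : ℝ) :
    pot Θ f X Y = (∫ η in (0:ℝ)..Y, Θ.fieldY f 0 η) + ∫ ξ in (0:ℝ)..X, Θ.fieldX f ξ Y := by
  have hX := h.locBounded_fieldX hf
  have hY := h.locBounded_fieldY hf
  have h1 : (∫ η in (0:ℝ)..Y, Θ.fieldY f X η) - ∫ η in (0:ℝ)..Y, Θ.fieldY f 0 η =
      ∫ η in (0:ℝ)..Y, ∫ ξ in (0:ℝ)..X, f ξ η := by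
    rw [← intervalIntegral.integral_sub ((hY.left X).intervalIntegrable _ _)
      ((hY.left 0).intervalIntegrable _ _)]
    exact intervalIntegral.integral_congr fun η _ => isPrimitive_fieldY hf η 0 X
  have h2 : (∫ ξ in (0:ℝ)..X, Θ.fieldX f ξ Y) - ∫ ξ in (0:ℝ)..X, Θ.fieldX f ξ 0 =
      ∫ ξ in (0:ℝ)..X, ∫ η in (0:ℝ)..Y, f ξ η := by
    rw [← intervalIntegral.integral_sub ((hX.right Y).intervalIntegrable _ _)
      ((hX.right 0).intervalIntegrable _ _)]
    exact intervalIntegral.integral_congr fun ξ _ => isPrimitive_fieldX hf ξ 0 Y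
  have h3 : ∫ ξ in (0:ℝ)..X, ∫ η in (0:ℝ)..Y, f ξ η = ∫ η in (0:ℝ)..Y, ∫ ξ in (0:ℝ)..X, f ξ η := by
    apply intervalIntegral_intervalIntegral_swap
    obtain ⟨C, -, hC⟩ := hf.exists_bound (max |X| |Y|)
    refine Measure.integrableOn_of_bounded (M := C) ?_ hf.meas.aestronglyMeasurable ?_
    · rw [Measure.volume_eq_prod, Measure.prod_prod]
      exact ENNReal.mul_ne_top (by simp) (by simp)
    · rw [ae_restrict_iff' (measurableSet_uIoc.prod measurableSet_uIoc)]
      refine Eventually.of_forall fun p hp => hC p.1 p.2 ?_ ?_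
      · have := abs_le_max_abs_of_mem_uIcc (uIoc_subset_uIcc hp.1)
        simp at this
        exact this.trans (le_max_left _ _)
      · have := abs_le_max_abs_of_mem_uIcc (uIoc_subset_uIcc hp.2)
        simp at this
        exact this.trans (le_max_right _ _)
  unfold pot
  rw [sub_eq_iff_eq_add.1 h1, sub_eq_iff_eq_add.1 h2, h3]
  abel

theorem pot_sub_le (h : Θ.Regular m) (hf : LocBounded (Function.uncurry f)) (R : ℝ) :
    ∃ C, 0 ≤ C ∧ ∀ X Y X' Y', |X| ≤ R → |Y| ≤ R → |X'| ≤ R → |Y'| ≤ R →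
      ‖pot Θ f X Y - pot Θ f X' Y'‖ ≤ C * (|X - X'| + |Y - Y'|) := by
  obtain ⟨C₁, hC₁0, hC₁⟩ := (h.locBounded_fieldX hf).exists_bound R
  obtain ⟨C₂, hC₂0, hC₂⟩ := (h.locBounded_fieldY hf).exists_bound R
  refine ⟨C₁ + C₂, by positivity, fun X Y X' Y' hX hY hX' hY' => ?_⟩
  have e1 : pot Θ f X Y - pot Θ f X' Y = ∫ ξ in X'..X, Θ.fieldX f ξ Y := by
    rw [h.pot_eq hf, h.pot_eq hf, add_sub_add_left_eq_sub]
    exact intervalIntegral.integral_interval_sub_left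
      (((h.locBounded_fieldX hf).right Y).intervalIntegrable _ _)
      (((h.locBounded_fieldX hf).right Y).intervalIntegrable _ _)
  have e2 : pot Θ f X' Y - pot Θ f X' Y' = ∫ η in Y'..Y, Θ.fieldY f X' η := by
    unfold pot
    rw [add_sub_add_left_eq_sub]
    exact intervalIntegral.integral_interval_sub_left
      (((h.locBounded_fieldY hf).left X').intervalIntegrable _ _)
      (((h.locBounded_fieldY hf).left X').intervalIntegrable _ _)
  have n1 : ‖pot Θ f X Y - pot Θ f X' Y‖ ≤ C₁ * |X - X'| := by
    rw [e1]
    refine intervalIntegral.norm_integral_le_of_norm_le_const fun ξ hξ => hC₁ ξ Y ?_ hY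
    exact (abs_le_max_abs_of_mem_uIcc (uIoc_subset_uIcc hξ)).trans (max_le hX' hX)
  have n2 : ‖pot Θ f X' Y - pot Θ f X' Y'‖ ≤ C₂ * |Y - Y'| := by
    rw [e2]
    refine intervalIntegral.norm_integral_le_of_norm_le_const fun η hη => hC₂ X' η hX' ?_
    exact (abs_le_max_abs_of_mem_uIcc (uIoc_subset_uIcc hη)).trans (max_le hY' hY)
  have n3 := norm_sub_le_norm_sub_add_norm_sub (pot Θ f X Y) (pot Θ f X' Y) (pot Θ f X' Y')
  nlinarith [abs_nonneg (X - X'), abs_nonneg (Y - Y')]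

theorem ae_hasDerivAt_pot_left (h : Θ.Regular m) (hf : LocBounded (Function.uncurry f)) :
    ∀ᵐ X, ∀ Y, HasDerivAt (fun x => pot Θ f x Y) (Θ.fieldX f X Y) X := by
  filter_upwards [ae_forall_hasDerivAt_integral (h.locBounded_fieldX hf) (fieldX_sub_le hf)]
    with X hX Y
  simp_rw [h.pot_eq hf]
  exact (hX Y).const_add _

theorem ae_hasDerivAt_pot_right (h : Θ.Regular m) (hf : LocBounded (Function.uncurry f)) :
    ∀ᵐ Y, ∀ X, HasDerivAt (fun y => pot Θ f X y) (Θ.fieldY f X Y) Y := by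
  filter_upwards [ae_forall_hasDerivAt_integral (h.locBounded_fieldY hf).flip
    (fieldX_sub_le (Θ := Θ.swap) hf.flip)] with Y hY X
  exact (hY X).const_add _

end Regular
end Data

/-! ### The chain rule along the curve -/

theorem IsCurve.genInv_apply_of_deriv_ne_zero {χ ψ : ℝ → ℝ} (h : IsCurve χ ψ) {s : ℝ}
    (hd : DifferentiableAt ℝ χ s) (hs : deriv χ s ≠ 0) : genInv χ (χ s) = s := by
  refine le_antisymm (h.genInv_le_iff.2 le_rfl) (not_lt.1 fun hlt => hs ?_)
  have h1 : HasDerivWithinAt χ 0 (Iic s) s := by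
    refine (hasDerivWithinAt_const s _ (χ s)).congr_of_eventuallyEq ?_ rfl
    filter_upwards [inter_mem_nhdsWithin _ (Ioi_mem_nhds hlt)] with r hr
    refine le_antisymm (h.monotone_left hr.1) ?_
    have := h.monotone_left (le_of_lt hr.2)
    rwa [h.apply_genInv] at this
  exact (uniqueDiffWithinAt_Iic s).eq_deriv _ hd.hasDerivAt.hasDerivWithinAt h1

theorem hasDerivAt_zero_of_norm_le_sq {E : Type*} [NormedAddCommGroup E] [NormedSpace ℝ E]
    {g : ℝ → E} {s C : ℝ} (hg : ∀ᶠ r in 𝓝 s, ‖g r‖ ≤ C * |r - s| ^ 2) :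
    HasDerivAt g 0 s := by
  have h1 : g =O[𝓝 s] fun r => ‖r - s‖ ^ 2 :=
    Asymptotics.IsBigO.of_bound C (by
      filter_upwards [hg] with r hr
      simpa using hr)
  have h2 := Asymptotics.IsBigO.hasFDerivAt (𝕜 := ℝ) h1 one_lt_two
  rw [hasDerivAt_iff_hasFDerivAt]
  convert! h2 using 1
  ext; simp

theorem hasDerivAt_comp_zero {E : Type*} [NormedAddCommGroup E] [NormedSpace ℝ E]
    {g : ℝ → E} {χ : ℝ → ℝ} {s : ℝ} (hg : LocallyLipschitz g) (hχ : HasDerivAt χ 0 s) :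
    HasDerivAt (fun r => g (χ r)) 0 s := by
  obtain ⟨K, t, ht, hK⟩ := hg (χ s)
  rw [hasDerivAt_iff_isLittleO] at hχ ⊢
  simp only [smul_zero, sub_zero] at hχ ⊢
  refine Asymptotics.IsBigO.trans_isLittleO ?_ hχ
  refine Asymptotics.IsBigO.of_bound K ?_
  have hcont : ContinuousAt χ s := by
    have : HasDerivAt χ 0 s := by rw [hasDerivAt_iff_isLittleO]; simpa using hχ
    exact this.continuousAt
  filter_upwards [hcont ht] with r hr
  have := hK.dist_le_mul _ hr _ (mem_of_mem_nhds ht)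
  rwa [dist_eq_norm, dist_eq_norm] at this

namespace Data.Regular

variable {Θ : Data} {m : ℝ} {f : ℝ → ℝ → Vec}

theorem isPrimitive_pot_left (h : Θ.Regular m) (hf : LocBounded (Function.uncurry f)) (Y : ℝ) :
    IsPrimitive (fun X => pot Θ f X Y) (fun X => Θ.fieldX f X Y) := by
  intro x y
  simp only [h.pot_eq hf, add_sub_add_left_eq_sub]
  exact intervalIntegral.integral_interval_sub_left
    (((h.locBounded_fieldX hf).right Y).intervalIntegrable _ _)
    (((h.locBounded_fieldX hf).right Y).intervalIntegrable _ _)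

theorem isPrimitive_pot_right (h : Θ.Regular m) (hf : LocBounded (Function.uncurry f)) (X : ℝ) :
    IsPrimitive (pot Θ f X) (Θ.fieldY f X) := by
  intro x y
  simp only [pot, add_sub_add_left_eq_sub]
  exact intervalIntegral.integral_interval_sub_left
    (((h.locBounded_fieldY hf).left X).intervalIntegrable _ _)
    (((h.locBounded_fieldY hf).left X).intervalIntegrable _ _)

/-- Where a coordinate of the curve has nonzero derivative, the field takes its prescribed value. -/
theorem deriv_smul_fieldX (h : Θ.Regular m) {s : ℝ} (hs : DifferentiableAt ℝ Θ.X s) :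
    deriv Θ.X s • Θ.fieldX f (Θ.X s) (Θ.Y s) = deriv Θ.X s • Θ.V (Θ.X s) := by
  by_cases h0 : deriv Θ.X s = 0
  · rw [h0, zero_smul, zero_smul]
  · rw [fieldX, h.curve.genInv_apply_of_deriv_ne_zero hs h0, intervalIntegral.integral_same,
      add_zero]

/-- The chain rule along the curve. At almost every parameter each coordinate either has vanishing
derivative or meets a point where the corresponding partial derivative exists. -/
theorem ae_hasDerivAt_pot_curve (h : Θ.Regular m) (hf : LocBounded (Function.uncurry f)) :
    ∀ᵐ s, HasDerivAt (fun s => pot Θ f (Θ.X s) (Θ.Y s))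
      (deriv Θ.X s • Θ.V (Θ.X s) + deriv Θ.Y s • Θ.W (Θ.Y s)) s := by
  filter_upwards [h.curve.ae_deriv_eq_zero_or (h.ae_hasDerivAt_pot_left hf),
    h.curve.symm.ae_deriv_eq_zero_or (h.ae_hasDerivAt_pot_right hf)] with s ⟨hs1, hs2⟩ ⟨hs3, hs4⟩
  rw [← h.deriv_smul_fieldX (f := f) hs1]
  have e3 : deriv Θ.Y s • Θ.fieldY f (Θ.X s) (Θ.Y s) = deriv Θ.Y s • Θ.W (Θ.Y s) :=
    h.swap.deriv_smul_fieldX (f := flip f) hs3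
  rw [← e3]
  change HasDerivAt _ (deriv Θ.X s • Θ.fieldX f (Θ.X s) (Θ.Y s) +
    deriv Θ.Y s • Θ.fieldY f (Θ.X s) (Θ.Y s)) s
  have dA : HasDerivAt (fun r => pot Θ f (Θ.X r) (Θ.Y s))
      (deriv Θ.X s • Θ.fieldX f (Θ.X s) (Θ.Y s)) s := by
    rcases hs2 with h0 | hP
    · rw [h0, zero_smul]
      exact hasDerivAt_comp_zero ((h.isPrimitive_pot_left hf _).locallyLipschitz
        ((h.locBounded_fieldX hf).right _)) (h0 ▸ hs1.hasDerivAt)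
    · exact (hP (Θ.Y s)).scomp s hs1.hasDerivAt
  have dB : HasDerivAt (fun r => pot Θ f (Θ.X s) (Θ.Y r))
      (deriv Θ.Y s • Θ.fieldY f (Θ.X s) (Θ.Y s)) s := by
    rcases hs4 with h0 | hP
    · rw [h0, zero_smul]
      exact hasDerivAt_comp_zero ((h.isPrimitive_pot_right hf _).locallyLipschitz
        ((h.locBounded_fieldY hf).left _)) (h0 ▸ hs3.hasDerivAt)
    · exact (hP (Θ.X s)).scomp s hs3.hasDerivAt
  -- The mixed second difference of the potential is quadratically small.
  have dR : HasDerivAt (fun r => pot Θ f (Θ.X r) (Θ.Y r) - pot Θ f (Θ.X r) (Θ.Y s) -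
      (pot Θ f (Θ.X s) (Θ.Y r) - pot Θ f (Θ.X s) (Θ.Y s))) 0 s := by
    obtain ⟨K₁, hK₁⟩ := h.curve.lipschitz_left
    obtain ⟨K₂, hK₂⟩ := h.curve.lipschitz_right
    set R := max (|Θ.X s| + 1) (|Θ.Y s| + 1) with hR
    obtain ⟨C, hC0, hC⟩ := fieldX_sub_le (Θ := Θ.swap) hf.flip R
    refine hasDerivAt_zero_of_norm_le_sq (C := C * K₁ * K₂) ?_
    have c1 : ∀ᶠ r in 𝓝 s, |Θ.X r| < |Θ.X s| + 1 :=
      (h.curve.continuous_left.abs.continuousAt).eventually_lt_const (lt_add_one _)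
    have c2 : ∀ᶠ r in 𝓝 s, |Θ.Y r| < |Θ.Y s| + 1 :=
      (h.curve.symm.continuous_left.abs.continuousAt).eventually_lt_const (lt_add_one _)
    filter_upwards [c1, c2] with r hr1 hr2
    have hY := h.locBounded_fieldY hf
    rw [h.isPrimitive_pot_right hf (Θ.X r) (Θ.Y s) (Θ.Y r),
      h.isPrimitive_pot_right hf (Θ.X s) (Θ.Y s) (Θ.Y r),
      ← intervalIntegral.integral_sub ((hY.left _).intervalIntegrable _ _)
        ((hY.left _).intervalIntegrable _ _)]
    have l1 := hK₁.dist_le_mul r s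
    have l2 := hK₂.dist_le_mul r s
    rw [Real.dist_eq, Real.dist_eq] at l1 l2
    refine (intervalIntegral.norm_integral_le_of_norm_le_const (C := C * |Θ.X r - Θ.X s|)
      fun η hη => ?_).trans ?_
    · refine hC η (Θ.X r) (Θ.X s) ?_ ?_ ?_
      · refine (abs_le_max_abs_of_mem_uIcc (uIoc_subset_uIcc hη)).trans (max_le ?_ ?_)
        · exact le_max_of_le_right (by linarith)
        · exact le_max_of_le_right hr2.le
      · exact le_max_of_le_left hr1.le
      · exact le_max_of_le_left (by linarith)
    · calc C * |Θ.X r - Θ.X s| * |Θ.Y r - Θ.Y s| ≤ C * (K₁ * |r - s|) * (K₂ * |r - s|) := by gcongr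
        _ = C * K₁ * K₂ * |r - s| ^ 2 := by ring
  have := (dR.add dA).add dB
  rw [zero_add] at this
  refine (this.sub_const (pot Θ f (Θ.X s) (Θ.Y s))).congr_of_eventuallyEq
    (Eventually.of_forall fun r => ?_)
  simp only [Pi.add_apply]
  abel

/-- The compatibility condition says that `𝒵` and the potential have the same derivative along the
curve, so they differ by a constant. -/
theorem exists_pot_curve_eq (h : Θ.Regular m) (hf : LocBounded (Function.uncurry f)) :
    ∃ e : Vec, ∀ s, pot Θ f (Θ.X s) (Θ.Y s) = Θ.Z s + e := by
  have hac : ∀ a b, AbsolutelyContinuousOnInterval (fun s => pot Θ f (Θ.X s) (Θ.Y s)) a b := by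
    intro a b
    apply absolutelyContinuousOnInterval_of_locallyLipschitz
    obtain ⟨K₁, hK₁⟩ := h.curve.lipschitz_left
    obtain ⟨K₂, hK₂⟩ := h.curve.lipschitz_right
    intro s
    set R := max (|Θ.X s| + 1) (|Θ.Y s| + 1) with hR
    obtain ⟨C, hC0, hC⟩ := h.pot_sub_le hf R
    have c1 : ∀ᶠ r in 𝓝 s, |Θ.X r| < |Θ.X s| + 1 :=
      (h.curve.continuous_left.abs.continuousAt).eventually_lt_const (lt_add_one _)
    have c2 : ∀ᶠ r in 𝓝 s, |Θ.Y r| < |Θ.Y s| + 1 :=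
      (h.curve.symm.continuous_left.abs.continuousAt).eventually_lt_const (lt_add_one _)
    refine ⟨(C * (K₁ + K₂)).toNNReal, _, c1.and c2, LipschitzOnWith.of_dist_le_mul ?_⟩
    intro r hr r' hr'
    rw [dist_eq_norm, Real.coe_toNNReal _ (by positivity)]
    have l1 := hK₁.dist_le_mul r r'
    have l2 := hK₂.dist_le_mul r r'
    rw [Real.dist_eq] at l1 l2
    refine (hC _ _ _ _ (le_max_of_le_left hr.1.le) (le_max_of_le_right hr.2.le)
      (le_max_of_le_left hr'.1.le) (le_max_of_le_right hr'.2.le)).trans ?_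
    calc C * (|Θ.X r - Θ.X r'| + |Θ.Y r - Θ.Y r'|)
        ≤ C * (K₁ * dist r r' + K₂ * dist r r') := by gcongr
      _ = _ := by ring
  refine ⟨pot Θ f (Θ.X 0) (Θ.Y 0) - Θ.Z 0, fun s => ?_⟩
  obtain ⟨e, he⟩ := ((hac 0 s).sub (h.absCont 0 s)).const_of_ae_hasDerivAt_zero (by
    filter_upwards [h.ae_hasDerivAt_pot_curve hf, h.compat] with r h1 h2 _
    have := h1.sub h2
    rwa [sub_self] at this)
  have h1 := he s right_mem_uIcc
  have h2 := he 0 left_mem_uIcc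
  simp only [Pi.sub_apply] at h1 h2
  rw [h2, ← h1]; abel

theorem exists_potential_eq_pot (h : Θ.Regular m) (hf : LocBounded (Function.uncurry f)) :
    ∃ e : Vec, (∀ X Y, Θ.potential f X Y = pot Θ f X Y - e) ∧
      (∀ s, pot Θ f (Θ.X s) (Θ.Y s) = Θ.Z s + e) := by
  obtain ⟨e, he⟩ := h.exists_pot_curve_eq hf
  refine ⟨e, fun X Y => ?_, he⟩
  have h1 := he (genInv Θ.X X)
  rw [h.curve.apply_genInv] at h1
  rw [potential, ← h.isPrimitive_pot_right hf X, h1]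
  abel

/-- The compatibility condition of the data makes the vertical and the horizontal definition of the
potential agree. -/
theorem potential_swap (h : Θ.Regular m) (hf : LocBounded (Function.uncurry f)) (X Y : ℝ) :
    Θ.swap.potential (flip f) Y X = Θ.potential f X Y := by
  obtain ⟨e, he, he'⟩ := h.exists_potential_eq_pot hf
  have h1 := he' (genInv Θ.Y Y)
  rw [h.curve.symm.apply_genInv] at h1
  have h2 := h.isPrimitive_pot_left hf Y (Θ.X (genInv Θ.Y Y)) X
  rw [he]
  change Θ.Z (genInv Θ.Y Y) + ∫ ξ in (Θ.X (genInv Θ.Y Y))..X, Θ.fieldX f ξ Y = _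
  rw [← h2]
  simp only [h1]
  abel

theorem potential_curve (h : Θ.Regular m) (hf : LocBounded (Function.uncurry f)) (s : ℝ) :
    Θ.potential f (Θ.X s) (Θ.Y s) = Θ.Z s := by
  obtain ⟨e, he, he'⟩ := h.exists_potential_eq_pot hf
  rw [he, he']; abel

theorem ae_hasDerivAt_potential_left (h : Θ.Regular m) (hf : LocBounded (Function.uncurry f)) :
    ∀ᵐ X, ∀ Y, HasDerivAt (fun x => Θ.potential f x Y) (Θ.fieldX f X Y) X := by
  obtain ⟨e, he, he'⟩ := h.exists_potential_eq_pot hf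
  filter_upwards [h.ae_hasDerivAt_pot_left hf] with X hX Y
  simp_rw [he]
  exact (hX Y).sub_const _

theorem ae_hasDerivAt_potential_right (h : Θ.Regular m) (hf : LocBounded (Function.uncurry f)) :
    ∀ᵐ Y, ∀ X, HasDerivAt (fun y => Θ.potential f X y) (Θ.fieldY f X Y) Y := by
  obtain ⟨e, he, he'⟩ := h.exists_potential_eq_pot hf
  filter_upwards [h.ae_hasDerivAt_pot_right hf] with Y hY X
  simp_rw [he]
  exact (hY X).sub_const _

theorem potential_sub_le (h : Θ.Regular m) (hf : LocBounded (Function.uncurry f)) (R : ℝ) :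
    ∃ C, 0 ≤ C ∧ ∀ X Y X' Y', |X| ≤ R → |Y| ≤ R → |X'| ≤ R → |Y'| ≤ R →
      ‖Θ.potential f X Y - Θ.potential f X' Y'‖ ≤ C * (|X - X'| + |Y - Y'|) := by
  obtain ⟨e, he, he'⟩ := h.exists_potential_eq_pot hf
  simp_rw [he, sub_sub_sub_cancel_right]
  exact h.pot_sub_le hf R

theorem continuous_potential (h : Θ.Regular m) (hf : LocBounded (Function.uncurry f)) :
    Continuous (Function.uncurry (Θ.potential f)) := by
  rw [continuous_iff_continuousAt]
  rintro ⟨X, Y⟩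
  obtain ⟨C, hC0, hC⟩ := h.potential_sub_le hf (‖((X, Y) : ℝ × ℝ)‖ + 1)
  refine continuousAt_of_locally_lipschitz one_pos (2 * C) fun p hp => ?_
  have hp' : ‖p‖ ≤ ‖((X, Y) : ℝ × ℝ)‖ + 1 := by
    rw [dist_eq_norm] at hp
    linarith [norm_sub_norm_le p ((X, Y) : ℝ × ℝ)]
  obtain ⟨h1, h2⟩ := norm_pair_le.1 (show ‖(p.1, p.2)‖ ≤ _ from hp')
  obtain ⟨h3, h4⟩ := norm_pair_le.1 (show ‖(X, Y)‖ ≤ ‖((X, Y) : ℝ × ℝ)‖ + 1 by linarith)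
  rw [dist_eq_norm]
  refine (hC _ _ _ _ h1 h2 h3 h4).trans ?_
  have h5 : |p.1 - X| ≤ dist p (X, Y) := le_max_left _ _
  have h6 : |p.2 - Y| ≤ dist p (X, Y) := le_max_right _ _
  nlinarith

theorem locBounded_potential (h : Θ.Regular m) (hf : LocBounded (Function.uncurry f)) :
    LocBounded (Function.uncurry (Θ.potential f)) := by
  refine ⟨(h.continuous_potential hf).stronglyMeasurable, fun R => ?_⟩
  obtain ⟨C, hC⟩ := (isCompact_closedBall (0 : ℝ × ℝ) R).exists_bound_of_continuousOn
    (h.continuous_potential hf).continuousOn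
  exact ⟨C, fun x hx => hC x (by simpa using hx)⟩

end Data.Regular

/-! ### The nonlinearity -/

/-- The standing assumptions on the wave speed. -/
structure Speed (c : ℝ → ℝ) (κ : ℝ) : Prop where
  pos : 0 < κ
  contDiff : ContDiff ℝ 1 c
  lip : LocallyLipschitz (deriv c)
  bounds : ∀ u, κ⁻¹ ≤ c u ∧ c u ≤ κ

/-- The coefficient `c' / (2c)`. -/
noncomputable def coef (c : ℝ → ℝ) (u : ℝ) : ℝ := deriv c u / (2 * c u)

theorem F_symm (c : ℝ → ℝ) (z v w : Vec) : F c z v w = F c z w v := by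
  unfold F
  congr! 1
  · ring
  · congr! 1
    · ring
    · congr! 1
      · ring
      · congr! 1
        · ring
        · congr! 1
          ring

namespace Speed

variable {c : ℝ → ℝ} {κ : ℝ}

theorem c_pos (hc : Speed c κ) (u : ℝ) : 0 < c u :=
  (inv_pos.2 hc.pos).trans_le (hc.bounds u).1

theorem hasDerivAt (hc : Speed c κ) (u : ℝ) : HasDerivAt c (deriv c u) u :=
  (hc.contDiff.differentiable one_ne_zero u).hasDerivAt

theorem deriv_eq (hc : Speed c κ) (u : ℝ) : deriv c u = 2 * coef c u * c u := by
  unfold coef; have := (hc.c_pos u).ne'; field_simp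

theorem inv_le (hc : Speed c κ) (u : ℝ) : (c u)⁻¹ ≤ κ := by
  rw [inv_le_comm₀ (hc.c_pos u) hc.pos]; exact (hc.bounds u).1

theorem continuous_coef (hc : Speed c κ) : Continuous (coef c) :=
  hc.lip.continuous.div (hc.contDiff.continuous.const_mul 2 |>.congr fun _ => rfl)
    fun u => by have := hc.c_pos u; positivity

theorem exists_coef_bound (hc : Speed c κ) (R : ℝ) :
    ∃ A, 0 ≤ A ∧ ∀ u, |u| ≤ R → |coef c u| ≤ A := by
  obtain ⟨A, hA⟩ := (isCompact_Icc (a := -R) (b := R)).exists_bound_of_continuousOn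
    hc.continuous_coef.continuousOn
  exact ⟨|A|, abs_nonneg _, fun u hu => (hA u (abs_le.1 hu)).trans (le_abs_self A)⟩

theorem locallyLipschitz_deriv_div (hc : Speed c κ) {g : ℝ → ℝ} (hg : ContDiff ℝ 1 g)
    (hg0 : ∀ u, g u ≠ 0) : LocallyLipschitz fun u => deriv c u / g u := by
  have h1 : ContDiff ℝ 1 fun w : ℝ × ℝ => w.1 / g w.2 :=
    ContDiff.div (by fun_prop) (by fun_prop) fun w => hg0 w.2
  exact h1.locallyLipschitz.comp (hc.lip.prodMk LocallyLipschitz.id)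

/-- `F` as a function of `U` and of the two derivatives, the only quantities on which it depends. -/
theorem locallyLipschitz_F (hc : Speed c κ) :
    LocallyLipschitz fun w : ℝ × Vec × Vec => F c (fun _ => w.1) w.2.1 w.2.2 := by
  have hcd := hc.contDiff
  have h1 : LocallyLipschitz fun u => deriv c u / (2 * c u) :=
    hc.locallyLipschitz_deriv_div (by fun_prop) fun u => by have := hc.c_pos u; positivity
  have h2 : LocallyLipschitz fun u => deriv c u / (2 * c u ^ 3) :=
    hc.locallyLipschitz_deriv_div (by fun_prop) fun u => by have := hc.c_pos u; positivity
  have h3 : LocallyLipschitz fun w : ℝ × Vec × Vec =>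
      (deriv c w.1 / (2 * c w.1), deriv c w.1 / (2 * c w.1 ^ 3), w.2.1, w.2.2) :=
    (h1.comp LipschitzWith.prod_fst.locallyLipschitz).prodMk
      ((h2.comp LipschitzWith.prod_fst.locallyLipschitz).prodMk
        LipschitzWith.prod_snd.locallyLipschitz)
  have hΦ : ContDiff ℝ 1 fun w : ℝ × ℝ × Vec × Vec =>
      (![-w.1 * (w.2.2.1 2 * w.2.2.2 0 + w.2.2.2 2 * w.2.2.1 0),
        w.1 * (w.2.2.2 2 * w.2.2.1 1 + w.2.2.1 2 * w.2.2.2 1),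
        w.2.1 * (w.2.2.2 1 * w.2.2.1 3 + w.2.2.2 3 * w.2.2.1 1)
          - w.1 * (w.2.2.2 2 * w.2.2.1 2),
        w.1 * (w.2.2.1 3 * w.2.2.2 2 + w.2.2.2 3 * w.2.2.1 2),
        -w.1 * (w.2.2.1 4 * w.2.2.2 2 + w.2.2.2 4 * w.2.2.1 2)] : Vec) := by
    rw [contDiff_pi]
    intro i
    fin_cases i <;> simp <;> fun_prop
  have h4 := hΦ.locallyLipschitz.comp h3
  exact h4

/-- `F` is Lipschitz and bounded on bounded sets, uniformly in all components of `Z` except `U`. -/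
theorem exists_F_lipschitz (hc : Speed c κ) (R : ℝ) :
    ∃ L, 0 ≤ L ∧ ∀ z z' p p' q q' : Vec, |z 2| ≤ R → |z' 2| ≤ R → ‖p‖ ≤ R → ‖p'‖ ≤ R →
      ‖q‖ ≤ R → ‖q'‖ ≤ R → ‖F c z p q‖ ≤ L ∧
      ‖F c z p q - F c z' p' q'‖ ≤ L * max |z 2 - z' 2| (max ‖p - p'‖ ‖q - q'‖) := by
  obtain ⟨K, hK⟩ := (hc.locallyLipschitz_F.locallyLipschitzOn
    (s := Metric.closedBall 0 R)).exists_lipschitzOnWith_of_compact (isCompact_closedBall _ _)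
  obtain ⟨B, hB⟩ := (isCompact_closedBall (0 : ℝ × Vec × Vec) R).exists_bound_of_continuousOn
    hc.locallyLipschitz_F.continuous.continuousOn
  have hmem : ∀ z p q : Vec, |z 2| ≤ R → ‖p‖ ≤ R → ‖q‖ ≤ R →
      (z 2, p, q) ∈ Metric.closedBall (0 : ℝ × Vec × Vec) R := fun z p q h1 h2 h3 => by
    rw [mem_closedBall_zero_iff, Prod.norm_def, Prod.norm_def]
    exact max_le h1 (max_le h2 h3)
  refine ⟨max K B, le_max_of_le_left K.2, fun z z' p p' q q' h1 h2 h3 h4 h5 h6 => ⟨?_, ?_⟩⟩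
  · exact (hB _ (hmem z p q h1 h3 h5)).trans (le_max_right _ _)
  · have := hK.dist_le_mul _ (hmem z p q h1 h3 h5) _ (hmem z' p' q' h2 h4 h6)
    rw [dist_eq_norm, dist_eq_norm, Prod.norm_def, Prod.norm_def] at this
    exact this.trans (mul_le_mul_of_nonneg_right (le_max_left _ _) (by positivity))

end Speed

/-! ### Conserved relations along characteristics -/

/-- The relations satisfied by `Z_X` (for `σ = 1`) and by `Z_Y` (for `σ = -1`). -/
structure Rel (c : ℝ → ℝ) (σ u : ℝ) (p : Vec) : Prop where
  tx : p 1 = σ * c u * p 0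
  JK : p 3 = σ * c u * p 4
  energy : 2 * p 3 * p 1 = (c u * p 2) ^ 2
  pos : 0 < p 1 + p 3

namespace Rel

variable {c : ℝ → ℝ} {κ σ u : ℝ} {p : Vec}

theorem nonneg (h : Rel c σ u p) : 0 ≤ p 1 ∧ 0 ≤ p 3 := by
  have h1 := h.energy
  have h2 := h.pos
  constructor <;> by_contra! h3 <;> nlinarith [sq_nonneg (c u * p 2)]

end Rel

/-- The energy relation controls the derivative of `U` by that of `x + J`. -/
theorem abs_U_le_of_energy {c : ℝ → ℝ} {κ u : ℝ} {p : Vec} (hc : Speed c κ)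
    (h : 2 * p 3 * p 1 = (c u * p 2) ^ 2) : |p 2| ≤ κ * |p 1 + p 3| := by
  have h1 : (c u * p 2) ^ 2 ≤ (p 1 + p 3) ^ 2 := by rw [← h]; nlinarith [sq_nonneg (p 1 - p 3)]
  have h2 := sq_le_sq.1 h1
  rw [abs_mul, abs_of_pos (hc.c_pos u)] at h2
  have h3 := hc.inv_le u
  have h4 := hc.c_pos u
  calc |p 2| = (c u)⁻¹ * (c u * |p 2|) := by field_simp
    _ ≤ κ * |p 1 + p 3| := by gcongr; exact hc.pos.le

/-- The relations control the whole derivative by its component `x + J`. -/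
theorem Rel.norm_le {c : ℝ → ℝ} {κ σ u : ℝ} {p : Vec} (hc : Speed c κ) (hσ : |σ| = 1)
    (h : Rel c σ u p) : ‖p‖ ≤ (1 + κ) * (p 1 + p 3) := by
  obtain ⟨h1, h3⟩ := h.nonneg
  have h2 := abs_U_le_of_energy hc h.energy
  rw [abs_of_pos h.pos] at h2
  have hκ := hc.pos
  have key : ∀ i j : Fin 5, 0 ≤ p j → p j = σ * c u * p i → |p i| ≤ κ * p j := fun i j h0 hij => by
    have h5 := congrArg abs hij
    rw [abs_mul, abs_mul, hσ, one_mul, abs_of_pos (hc.c_pos u), abs_of_nonneg h0] at h5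
    have h4 := hc.c_pos u
    calc |p i| = (c u)⁻¹ * (c u * |p i|) := by field_simp
      _ ≤ κ * p j := by rw [← h5]; gcongr; exact hc.inv_le u
  have k0 := key 0 1 h1 h.tx
  have k4 := key 4 3 h3 h.JK
  have hs := h.pos
  refine (pi_norm_le_iff_of_nonneg (by positivity)).2 fun i => ?_
  rw [Real.norm_eq_abs]
  fin_cases i
  · change |p 0| ≤ _; nlinarith
  · change |p 1| ≤ _; rw [abs_of_nonneg h1]; nlinarith
  · change |p 2| ≤ _; nlinarith
  · change |p 3| ≤ _; rw [abs_of_nonneg h3]; nlinarith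
  · change |p 4| ≤ _; nlinarith

section Ode

variable {c : ℝ → ℝ} {κ : ℝ} {z p : ℝ → Vec} {q : Vec} {y : ℝ}

theorem hasDerivAt_speed_comp (hc : Speed c κ) (hz : HasDerivAt z q y) :
    HasDerivAt (fun y => c (z y 2)) (2 * coef c (z y 2) * c (z y 2) * q 2) y := by
  rw [← hc.deriv_eq]
  exact (hc.hasDerivAt (z y 2)).comp y (hasDerivAt_pi.1 hz 2)

/-- The energy defect solves a linear homogeneous equation along characteristics. -/
theorem hasDerivAt_energy_defect (hc : Speed c κ) (hz : HasDerivAt z q y)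
    (hp : HasDerivAt p (F c (z y) (p y) q) y) :
    HasDerivAt (fun y => 2 * p y 3 * p y 1 - (c (z y 2) * p y 2) ^ 2)
      (2 * coef c (z y 2) * q 2 * (2 * p y 3 * p y 1 - (c (z y 2) * p y 2) ^ 2)) y := by
  have hp' := hasDerivAt_pi.1 hp
  have h1 := (((hp' 3).const_mul 2).mul (hp' 1)).sub
    (((hasDerivAt_speed_comp hc hz).mul (hp' 2)).pow 2)
  convert! h1 using 1
  have := (hc.c_pos (z y 2)).ne'
  simp [F, coef]
  field_simp
  ring

/-- The structure of the components of `F` in the pairs `(t, x)` and `(K, J)`. -/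
structure IsPair (c : ℝ → ℝ) (i j : Fin 5) : Prop where
  fst : ∀ z v w : Vec, F c z v w i = -(coef c (z 2) * (v 2 * w i + w 2 * v i))
  snd : ∀ z v w : Vec, F c z v w j = coef c (z 2) * (v 2 * w j + w 2 * v j)

theorem isPair_tx (c : ℝ → ℝ) : IsPair c 0 1 := by
  constructor <;> intro z v w <;> simp only [F, coef, Matrix.cons_val] <;> ring

theorem isPair_KJ (c : ℝ → ℝ) : IsPair c 4 3 := by
  constructor <;> intro z v w <;> simp only [F, coef, Matrix.cons_val] <;> ring

/-- The defects of the linear relations for `Z_X` and `Z_Y` solve a linear homogeneous system, which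
is of Goursat type: the equation for one of them contains the other. -/
theorem hasDerivAt_linear_defect (hc : Speed c κ) {i j : Fin 5} (hij : IsPair c i j) (σ : ℝ)
    (hz : HasDerivAt z q y) (hp : HasDerivAt p (F c (z y) (p y) q) y) :
    HasDerivAt (fun y => c (z y 2) * p y i - σ * p y j)
      (coef c (z y 2) * q 2 * (c (z y 2) * p y i - σ * p y j) -
        coef c (z y 2) * p y 2 * (c (z y 2) * q i + σ * q j)) y := by
  have hp' := hasDerivAt_pi.1 hp
  have h1 := ((hasDerivAt_speed_comp hc hz).mul (hp' i)).sub ((hp' j).const_mul σ)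
  convert! h1 using 1
  rw [hij.fst, hij.snd]
  ring

theorem hasDerivAt_x_add_J (hp : HasDerivAt p (F c (z y) (p y) q) y) :
    HasDerivAt (fun y => p y 1 + p y 3)
      (coef c (z y 2) * (q 2 * (p y 1 + p y 3) + p y 2 * (q 1 + q 3))) y := by
  have hp' := hasDerivAt_pi.1 hp
  convert! (hp' 1).add (hp' 3) using 1
  rw [(isPair_tx c).snd, (isPair_KJ c).snd]
  ring

end Ode

section OdeInterval

variable {c : ℝ → ℝ} {κ : ℝ} {z p q : ℝ → Vec} {a b R : ℝ}

/-- Propagation of the energy relation along a characteristic. -/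
theorem energy_of_ode (hc : Speed c κ) (hz : LocallyLipschitz z) (hp : LocallyLipschitz p)
    (hd : ∀ᵐ y, y ∈ uIoc a b → HasDerivAt z (q y) y ∧ HasDerivAt p (F c (z y) (p y) (q y)) y)
    (hR : ∀ᵐ y, y ∈ uIoc a b → |z y 2| ≤ R ∧ ‖q y‖ ≤ R)
    (h0 : 2 * p a 3 * p a 1 = (c (z a 2) * p a 2) ^ 2) :
    2 * p b 3 * p b 1 = (c (z b 2) * p b 2) ^ 2 := by
  obtain ⟨A, hA0, hA⟩ := hc.exists_coef_bound R
  have hcd := hc.contDiff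
  rw [← sub_eq_zero] at h0 ⊢
  refine (eq_zero_iff_of_abs_deriv_le (k := 2 * A * R)
    (h := fun y => 2 * p y 3 * p y 1 - (c (z y 2) * p y 2) ^ 2)
    (h' := fun y => 2 * coef c (z y 2) * q y 2 *
      (2 * p y 3 * p y 1 - (c (z y 2) * p y 2) ^ 2)) ?_ ?_).1 h0
  · exact contDiff_comp_locallyLipschitz
      (Φ := fun w : Vec × Vec => 2 * w.2 3 * w.2 1 - (c (w.1 2) * w.2 2) ^ 2)
      (by fun_prop) (hz.prodMk hp)
  · filter_upwards [hd, hR] with y h1 h2 hy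
    refine ⟨hasDerivAt_energy_defect hc (h1 hy).1 (h1 hy).2, ?_⟩
    have h3 := hA _ (h2 hy).1
    have h4 : |q y 2| ≤ R := (norm_le_pi_norm (q y) 2).trans (h2 hy).2
    rw [abs_mul, abs_mul, abs_mul, abs_two]
    gcongr

/-- Propagation of `x + J > 0` along a characteristic: by the energy relation `x + J` solves a
linear homogeneous differential inequality, so it cannot reach zero. -/
theorem x_add_J_pos_of_ode (hc : Speed c κ) (hp : LocallyLipschitz p)
    (hd : ∀ᵐ y, y ∈ uIoc a b → HasDerivAt p (F c (z y) (p y) (q y)) y)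
    (hR : ∀ᵐ y, y ∈ uIoc a b → |z y 2| ≤ R ∧ ‖q y‖ ≤ R)
    (he : ∀ y ∈ uIcc a b, 2 * p y 3 * p y 1 = (c (z y 2) * p y 2) ^ 2)
    (h0 : 0 < p a 1 + p a 3) : 0 < p b 1 + p b 3 := by
  obtain ⟨A, hA0, hA⟩ := hc.exists_coef_bound R
  have hlip : LocallyLipschitz fun y => p y 1 + p y 3 :=
    contDiff_comp_locallyLipschitz (Φ := fun w : Vec => w 1 + w 3) (by fun_prop) hp
  by_contra! hb
  have hcont : ContinuousOn (fun y => p y 1 + p y 3) (uIcc a b) := hlip.continuous.continuousOn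
  obtain ⟨y₀, hy₀, hy₀'⟩ := intermediate_value_uIcc hcont
    (show (0 : ℝ) ∈ uIcc (p a 1 + p a 3) (p b 1 + p b 3) by
      rw [uIcc_of_ge (by linarith)]; exact ⟨hb, h0.le⟩)
  have hκ := hc.pos
  refine h0.ne' ((eq_zero_iff_of_abs_deriv_le (k := A * (R + κ * (2 * R))) hlip
    (h' := fun y => coef c (z y 2) * (q y 2 * (p y 1 + p y 3) + p y 2 * (q y 1 + q y 3)))
    ?_).2 hy₀')
  have hsub : uIoc a y₀ ⊆ uIoc a b := uIoc_subset_uIoc_of_uIcc_subset_uIcc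
    (uIcc_subset_uIcc_left hy₀)
  filter_upwards [hd, hR] with y h1 h2 hy
  replace hy := hsub hy
  refine ⟨hasDerivAt_x_add_J (h1 hy), ?_⟩
  have h3 := hA _ (h2 hy).1
  have h4 : ∀ i, |q y i| ≤ R := fun i => (norm_le_pi_norm (q y) i).trans (h2 hy).2
  have h5 := abs_U_le_of_energy hc (he y (uIoc_subset_uIcc hy))
  have h6 : |q y 1 + q y 3| ≤ 2 * R := (abs_add_le _ _).trans (by linarith [h4 1, h4 3])
  rw [abs_mul, mul_assoc]
  gcongr
  refine (abs_add_le _ _).trans ?_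
  rw [abs_mul, abs_mul, add_mul]
  have hR0 : 0 ≤ R := (abs_nonneg _).trans (h4 0)
  calc |q y 2| * |p y 1 + p y 3| + |p y 2| * |q y 1 + q y 3|
      ≤ R * |p y 1 + p y 3| + κ * |p y 1 + p y 3| * (2 * R) := by gcongr; exact h4 2
    _ = _ := by ring

/-- The growth of the `x + J` component of a derivative `p` along a characteristic is controlled by
the variation `ν` of the `x + J` component of `z`, and so is the variation of `U`. -/
theorem bounds_of_ode (hc : Speed c κ) {A ν : ℝ} (hab : a ≤ b) (hz : LocallyLipschitz z)
    (hp : LocallyLipschitz p)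
    (hd : ∀ᵐ y, y ∈ Ioo a b → HasDerivAt z (q y) y ∧ HasDerivAt p (F c (z y) (p y) (q y)) y)
    (hA : ∀ y ∈ Ioo a b, |coef c (z y 2)| ≤ A)
    (hpos : ∀ y ∈ Ioo a b, 0 < q y 1 + q y 3)
    (hep : ∀ y ∈ Ioo a b, 2 * p y 3 * p y 1 = (c (z y 2) * p y 2) ^ 2)
    (heq : ∀ y ∈ Ioo a b, 2 * q y 3 * q y 1 = (c (z y 2) * q y 2) ^ 2)
    (ha : 0 < p a 1 + p a 3) (hb : 0 < p b 1 + p b 3)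
    (hA0 : 0 ≤ A) (hν : z b 1 + z b 3 - (z a 1 + z a 3) ≤ ν) :
    |z b 2 - z a 2| ≤ κ * ν ∧
      p b 1 + p b 3 ≤ (p a 1 + p a 3) * Real.exp (2 * κ * A * ν) ∧
      p a 1 + p a 3 ≤ (p b 1 + p b 3) * Real.exp (2 * κ * A * ν) := by
  have hκ := hc.pos
  have hlip : LocallyLipschitz fun y => p y 1 + p y 3 :=
    contDiff_comp_locallyLipschitz (Φ := fun w : Vec => w 1 + w 3) (by fun_prop) hp
  have hN : LocallyLipschitz fun y => z y 1 + z y 3 :=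
    contDiff_comp_locallyLipschitz (Φ := fun w : Vec => w 1 + w 3) (by fun_prop) hz
  have hUm : LocallyLipschitz fun y => z y 2 - κ * (z y 1 + z y 3) :=
    contDiff_comp_locallyLipschitz (Φ := fun w : Vec => w 2 - κ * (w 1 + w 3)) (by fun_prop) hz
  have hUp : LocallyLipschitz fun y => z y 2 + κ * (z y 1 + z y 3) :=
    contDiff_comp_locallyLipschitz (Φ := fun w : Vec => w 2 + κ * (w 1 + w 3)) (by fun_prop) hz
  have hqU : ∀ y ∈ Ioo a b, |q y 2| ≤ κ * (q y 1 + q y 3) := fun y hy => by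
    have := abs_U_le_of_energy hc (heq y hy)
    rwa [abs_of_pos (hpos y hy)] at this
  have u1 := le_of_ae_deriv_nonpos hUm (g' := fun y => q y 2 - κ * (q y 1 + q y 3)) hab (by
    filter_upwards [hd] with y h1 hy
    have h2 := hasDerivAt_pi.1 (h1 hy).1
    exact ⟨(h2 2).sub (((h2 1).add (h2 3)).const_mul κ), by linarith [(abs_le.1 (hqU y hy)).2]⟩)
  have u2 := le_of_ae_deriv_nonneg hUp (g' := fun y => q y 2 + κ * (q y 1 + q y 3)) hab (by
    filter_upwards [hd] with y h1 hy
    have h2 := hasDerivAt_pi.1 (h1 hy).1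
    exact ⟨(h2 2).add (((h2 1).add (h2 3)).const_mul κ), by linarith [(abs_le.1 (hqU y hy)).1]⟩)
  have hle := le_mul_exp_of_abs_deriv_le (C := 2 * κ * A) hlip hN hab ha.le hb.le
    (h' := fun y => coef c (z y 2) * (q y 2 * (p y 1 + p y 3) + p y 2 * (q y 1 + q y 3)))
    (N' := fun y => q y 1 + q y 3) (by
    filter_upwards [hd] with y h1 hy
    have h2 := hasDerivAt_pi.1 (h1 hy).1
    refine ⟨hasDerivAt_x_add_J (h1 hy).2, (h2 1).add (h2 3), ?_⟩
    have h3 := abs_U_le_of_energy hc (hep y hy)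
    have h4 := hqU y hy
    have h5 := hpos y hy
    have h6 : |q y 2 * (p y 1 + p y 3) + p y 2 * (q y 1 + q y 3)| ≤
        2 * κ * |p y 1 + p y 3| * (q y 1 + q y 3) := by
      refine (abs_add_le _ _).trans ?_
      rw [abs_mul, abs_mul, abs_of_pos h5]
      calc |q y 2| * |p y 1 + p y 3| + |p y 2| * (q y 1 + q y 3)
          ≤ κ * (q y 1 + q y 3) * |p y 1 + p y 3| +
            κ * |p y 1 + p y 3| * (q y 1 + q y 3) := by gcongr
        _ = _ := by ring
    rw [abs_mul]
    calc |coef c (z y 2)| * _ ≤ A * (2 * κ * |p y 1 + p y 3| * (q y 1 + q y 3)) :=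
          mul_le_mul (hA y hy) h6 (abs_nonneg _) ((abs_nonneg _).trans (hA y hy))
      _ = _ := by ring)
  refine ⟨?_, ?_, ?_⟩
  · rw [abs_le]
    constructor <;> nlinarith
  · refine hle.1.trans ?_
    gcongr
  · refine hle.2.trans ?_
    gcongr

end OdeInterval

/-! ### A priori estimates -/

namespace Data

/-- The algebraic conditions on the data; exchanging `X` and `Y` changes the sign `σ`. -/
structure Admissible (c : ℝ → ℝ) (σ : ℝ) (Θ : Data) : Prop where
  sign : σ * σ = 1
  rel_V : ∀ X, Rel c σ (Θ.Z (genInv Θ.X X) 2) (Θ.V X)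
  rel_W : ∀ Y, Rel c (-σ) (Θ.Z (genInv Θ.Y Y) 2) (Θ.W Y)

theorem Admissible.swap {c : ℝ → ℝ} {σ : ℝ} {Θ : Data} (h : Θ.Admissible c σ) :
    Θ.swap.Admissible c (-σ) :=
  ⟨by rw [neg_mul_neg]; exact h.sign, h.rel_W, by rw [neg_neg]; exact h.rel_V⟩

theorem Admissible.abs_sign {c : ℝ → ℝ} {σ : ℝ} {Θ : Data} (h : Θ.Admissible c σ) : |σ| = 1 := by
  have h1 : |σ| * |σ| = 1 := by rw [← abs_mul, h.sign, abs_one]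
  nlinarith [abs_nonneg σ]

/-- `f` is the right-hand side of a solution with data `Θ` on the set `S`, which contains the
characteristics from its points to the curve, and the solution is bounded by `R` there. -/
structure Solves (c : ℝ → ℝ) (σ m R : ℝ) (Θ : Data) (f : ℝ → ℝ → Vec) (S : Set (ℝ × ℝ)) :
    Prop where
  reg : Θ.Regular m
  adm : Θ.Admissible c σ
  hf : LocBounded (Function.uncurry f)
  closed_left : ∀ X Y, (X, Y) ∈ S → ∀ η ∈ uIoo (Θ.Y (genInv Θ.X X)) Y, (X, η) ∈ S
  closed_right : ∀ X Y, (X, Y) ∈ S → ∀ ξ ∈ uIoo (Θ.X (genInv Θ.Y Y)) X, (ξ, Y) ∈ S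
  eq : ∀ X Y, (X, Y) ∈ S →
    f X Y = F c (Θ.potential f X Y) (Θ.fieldX f X Y) (Θ.fieldY f X Y)
  bound : ∀ X Y, (X, Y) ∈ S →
    |Θ.potential f X Y 2| ≤ R ∧ ‖Θ.fieldX f X Y‖ ≤ R ∧ ‖Θ.fieldY f X Y‖ ≤ R

namespace Solves

variable {c : ℝ → ℝ} {κ σ m R : ℝ} {Θ : Data} {f : ℝ → ℝ → Vec} {S : Set (ℝ × ℝ)}

theorem swap (h : Θ.Solves c σ m R f S) : Θ.swap.Solves c (-σ) m R (flip f) (Prod.swap ⁻¹' S) where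
  reg := h.reg.swap
  adm := h.adm.swap
  hf := h.hf.flip
  closed_left X Y hXY := h.closed_right Y X hXY
  closed_right X Y hXY := h.closed_left Y X hXY
  eq X Y hXY := by
    rw [h.reg.potential_swap h.hf, F_symm]
    exact h.eq Y X hXY
  bound X Y hXY := by
    rw [h.reg.potential_swap h.hf]
    obtain ⟨h1, h2, h3⟩ := h.bound Y X hXY
    exact ⟨h1, h3, h2⟩

theorem ae_ode (h : Θ.Solves c σ m R f S) {X Y : ℝ} (hXY : (X, Y) ∈ S) :
    ∀ᵐ η, η ∈ uIoc (Θ.Y (genInv Θ.X X)) Y → (X, η) ∈ S ∧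
      HasDerivAt (Θ.potential f X) (Θ.fieldY f X η) η ∧
      HasDerivAt (Θ.fieldX f X)
        (F c (Θ.potential f X η) (Θ.fieldX f X η) (Θ.fieldY f X η)) η := by
  filter_upwards [ae_uIoc_of_uIoo (h.closed_left X Y hXY),
    (h.reg.isPrimitive_potential h.hf X).ae_hasDerivAt ((h.reg.locBounded_fieldY h.hf).left X),
    (Regular.isPrimitive_fieldX (Θ := Θ) h.hf X).ae_hasDerivAt (h.hf.left X)] with η h1 h2 h3 hη
  refine ⟨h1 hη, h2, ?_⟩
  rw [← h.eq X η (h1 hη)]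
  exact h3

theorem locallyLipschitz_potential (h : Θ.Solves c σ m R f S) (X : ℝ) :
    LocallyLipschitz (Θ.potential f X) :=
  (h.reg.isPrimitive_potential h.hf X).locallyLipschitz ((h.reg.locBounded_fieldY h.hf).left X)

theorem locallyLipschitz_fieldX (h : Θ.Solves c σ m R f S) (X : ℝ) :
    LocallyLipschitz (Θ.fieldX f X) :=
  (Regular.isPrimitive_fieldX (Θ := Θ) h.hf X).locallyLipschitz (h.hf.left X)

theorem fieldX_base (Θ : Data) (f : ℝ → ℝ → Vec) (X : ℝ) :
    Θ.fieldX f X (Θ.Y (genInv Θ.X X)) = Θ.V X := by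
  rw [fieldX, intervalIntegral.integral_same, add_zero]

theorem potential_base (Θ : Data) (f : ℝ → ℝ → Vec) (X : ℝ) :
    Θ.potential f X (Θ.Y (genInv Θ.X X)) = Θ.Z (genInv Θ.X X) := by
  rw [potential, intervalIntegral.integral_same, add_zero]

theorem linear_defect_le (h : Θ.Solves c σ m R f S) (hc : Speed c κ) {i j : Fin 5}
    (hij : IsPair c i j) (hV : ∀ X, Θ.V X j = σ * c (Θ.Z (genInv Θ.X X) 2) * Θ.V X i)
    {A : ℝ} (hA0 : 0 ≤ A) (hA : ∀ u, |u| ≤ R → |coef c u| ≤ A)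
    {X Y : ℝ} (hXY : (X, Y) ∈ S) {k : ℝ → ℝ} (hk : Continuous k)
    (hle : ∀ᵐ η, η ∈ uIoc (Θ.Y (genInv Θ.X X)) Y → A * R *
      (|c (Θ.potential f X η 2) * Θ.fieldX f X η i - σ * Θ.fieldX f X η j| +
        |c (Θ.potential f X η 2) * Θ.fieldY f X η i + σ * Θ.fieldY f X η j|) ≤ k η) :
    |c (Θ.potential f X Y 2) * Θ.fieldX f X Y i - σ * Θ.fieldX f X Y j| ≤
      |∫ η in (Θ.Y (genInv Θ.X X))..Y, k η| := by
  have hcd := hc.contDiff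
  have hlip : LocallyLipschitz fun η =>
      c (Θ.potential f X η 2) * Θ.fieldX f X η i - σ * Θ.fieldX f X η j :=
    contDiff_comp_locallyLipschitz (Φ := fun w : Vec × Vec => c (w.1 2) * w.2 i - σ * w.2 j)
      (by fun_prop) ((h.locallyLipschitz_potential X).prodMk (h.locallyLipschitz_fieldX X))
  have h1 := integral_deriv_eq_sub_of_locallyLipschitz hlip (Θ.Y (genInv Θ.X X)) Y
  simp only [fieldX_base, potential_base, hV] at h1
  rw [show ∀ u v : ℝ,
    u - (c (Θ.Z (genInv Θ.X X) 2) * v - σ * (σ * c (Θ.Z (genInv Θ.X X) 2) * v)) = u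
    from fun u v => by
      linear_combination (c (Θ.Z (genInv Θ.X X) 2) * v) * h.adm.sign] at h1
  rw [← h1, ← Real.norm_eq_abs]
  refine intervalIntegral.norm_integral_le_abs_of_norm_le ?_ (hk.intervalIntegrable _ _)
  rw [ae_restrict_iff' measurableSet_uIoc]
  filter_upwards [h.ae_ode hXY, hle] with η h2 h3 hη
  obtain ⟨hS, h4, h5⟩ := h2 hη
  rw [(hasDerivAt_linear_defect hc hij σ h4 h5).deriv, Real.norm_eq_abs]
  refine le_trans ?_ (h3 hη)
  obtain ⟨b1, b2, b3⟩ := h.bound X η hS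
  have b4 := hA _ b1
  have b5 : |Θ.fieldX f X η 2| ≤ R := (norm_le_pi_norm (Θ.fieldX f X η) 2).trans b2
  have b6 : |Θ.fieldY f X η 2| ≤ R := (norm_le_pi_norm (Θ.fieldY f X η) 2).trans b3
  refine (abs_sub _ _).trans ?_
  rw [abs_mul, abs_mul, abs_mul, abs_mul, mul_add]
  gcongr

/-- The linear relations hold on `S`: the two defects solve a homogeneous Goursat problem. -/
theorem linear_defect_eq_zero (h : Θ.Solves c σ m R f S) (hc : Speed c κ) {i j : Fin 5}
    (hij : IsPair c i j) (hV : ∀ X, Θ.V X j = σ * c (Θ.Z (genInv Θ.X X) 2) * Θ.V X i)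
    (hW : ∀ Y, Θ.W Y j = -σ * c (Θ.Z (genInv Θ.Y Y) 2) * Θ.W Y i) {X Y : ℝ} (hXY : (X, Y) ∈ S) :
    Θ.fieldX f X Y j = σ * c (Θ.potential f X Y 2) * Θ.fieldX f X Y i := by
  obtain ⟨A, hA0, hA⟩ := hc.exists_coef_bound R
  have hR0 : 0 ≤ R := (abs_nonneg _).trans (h.bound X Y hXY).1
  have hκ := hc.pos
  have hbd : ∀ (u τ : ℝ) (p : Vec), |τ| = 1 → ‖p‖ ≤ R → |c u * p i - τ * p j| ≤ κ * R + R := by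
    intro u τ p hτ hp
    have e1 : |p i| ≤ R := (norm_le_pi_norm p i).trans hp
    have e2 : |p j| ≤ R := (norm_le_pi_norm p j).trans hp
    refine (abs_sub _ _).trans ?_
    rw [abs_mul, abs_mul, hτ, one_mul, abs_of_pos (hc.c_pos u)]
    have := (hc.bounds u).2
    gcongr
  have key := h.reg.curve.goursat_eq_zero (S := S) (L := A * R) (M := κ * R + R)
    (p := fun X Y => |c (Θ.potential f X Y 2) * Θ.fieldX f X Y i - σ * Θ.fieldX f X Y j|)
    (q := fun X Y => |c (Θ.potential f X Y 2) * Θ.fieldY f X Y i + σ * Θ.fieldY f X Y j|)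
    (by positivity)
    (fun X Y hXY => ⟨abs_nonneg _, hbd _ _ _ h.adm.abs_sign (h.bound X Y hXY).2.1⟩)
    (fun X Y hXY => ⟨abs_nonneg _, by
      have := hbd (Θ.potential f X Y 2) _ _ h.swap.adm.abs_sign (h.bound X Y hXY).2.2
      rwa [neg_mul, sub_neg_eq_add] at this⟩)
    (fun X Y hXY => ae_uIoc_of_uIoo (h.closed_left X Y hXY))
    (fun X Y hXY => ae_uIoc_of_uIoo (h.closed_right X Y hXY))
    (fun X Y hXY k hk hle => h.linear_defect_le hc hij hV hA0 hA hXY hk hle)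
    (fun X Y hXY k hk hle => by
      have := h.swap.linear_defect_le hc hij hW hA0 hA (X := Y) (Y := X) hXY hk (by
        filter_upwards [hle] with ξ h1 hξ
        rw [h.reg.potential_swap h.hf, neg_mul, sub_neg_eq_add, neg_mul, ← sub_eq_add_neg, add_comm]
        exact h1 hξ)
      rw [h.reg.potential_swap h.hf, neg_mul, sub_neg_eq_add] at this
      exact this)
  have h1 := abs_eq_zero.1 (key X Y hXY).1
  linear_combination (-σ) * h1 - Θ.fieldX f X Y j * h.adm.sign

theorem energy (h : Θ.Solves c σ m R f S) (hc : Speed c κ) {X Y : ℝ} (hXY : (X, Y) ∈ S) :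
    2 * Θ.fieldX f X Y 3 * Θ.fieldX f X Y 1 =
      (c (Θ.potential f X Y 2) * Θ.fieldX f X Y 2) ^ 2 := by
  refine energy_of_ode (a := Θ.Y (genInv Θ.X X)) hc (h.locallyLipschitz_potential X)
    (h.locallyLipschitz_fieldX X) (q := Θ.fieldY f X) (R := R) ?_ ?_ ?_
  · filter_upwards [h.ae_ode hXY] with η h1 hη using (h1 hη).2
  · filter_upwards [h.ae_ode hXY] with η h1 hη
    exact ⟨(h.bound X η (h1 hη).1).1, (h.bound X η (h1 hη).1).2.2⟩
  · rw [fieldX_base, potential_base]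
    exact (h.adm.rel_V X).energy

/-- The energy relation on a closed characteristic segment, whose endpoint on the curve need not
belong to `S`. -/
theorem energy_uIcc (h : Θ.Solves c σ m R f S) (hc : Speed c κ) {X Y : ℝ} (hXY : (X, Y) ∈ S)
    {η : ℝ} (hη : η ∈ uIcc (Θ.Y (genInv Θ.X X)) Y) :
    2 * Θ.fieldX f X η 3 * Θ.fieldX f X η 1 =
      (c (Θ.potential f X η 2) * Θ.fieldX f X η 2) ^ 2 := by
  by_cases h1 : η = Θ.Y (genInv Θ.X X)
  · rw [h1, fieldX_base, potential_base]
    exact (h.adm.rel_V X).energy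
  by_cases h2 : η = Y
  · rw [h2]; exact h.energy hc hXY
  refine h.energy hc (h.closed_left X Y hXY η ?_)
  exact ⟨lt_of_le_of_ne hη.1 fun h3 => (min_choice (Θ.Y (genInv Θ.X X)) Y).elim
      (fun h4 => h1 (h3 ▸ h4)) (fun h4 => h2 (h3 ▸ h4)),
    lt_of_le_of_ne hη.2 fun h3 => (max_choice (Θ.Y (genInv Θ.X X)) Y).elim
      (fun h4 => h1 (h3 ▸ h4)) (fun h4 => h2 (h3 ▸ h4))⟩

/-- The algebraic relations propagate from the curve to the whole of `S`. -/
theorem rel (h : Θ.Solves c σ m R f S) (hc : Speed c κ) {X Y : ℝ} (hXY : (X, Y) ∈ S) :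
    Rel c σ (Θ.potential f X Y 2) (Θ.fieldX f X Y) where
  tx := h.linear_defect_eq_zero hc (isPair_tx c) (fun X => (h.adm.rel_V X).tx)
    (fun Y => (h.adm.rel_W Y).tx) hXY
  JK := h.linear_defect_eq_zero hc (isPair_KJ c) (fun X => (h.adm.rel_V X).JK)
    (fun Y => (h.adm.rel_W Y).JK) hXY
  energy := h.energy hc hXY
  pos := by
    refine x_add_J_pos_of_ode (a := Θ.Y (genInv Θ.X X)) hc (h.locallyLipschitz_fieldX X)
      (z := Θ.potential f X) (q := Θ.fieldY f X) (R := R) ?_ ?_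
      (fun η hη => h.energy_uIcc hc hXY hη) ?_
    · filter_upwards [h.ae_ode hXY] with η h1 hη using (h1 hη).2.2
    · filter_upwards [h.ae_ode hXY] with η h1 hη
      exact ⟨(h.bound X η (h1 hη).1).1, (h.bound X η (h1 hη).1).2.2⟩
    · rw [fieldX_base]
      exact (h.adm.rel_V X).pos

theorem rel_right (h : Θ.Solves c σ m R f S) (hc : Speed c κ) {X Y : ℝ} (hXY : (X, Y) ∈ S) :
    Rel c (-σ) (Θ.potential f X Y 2) (Θ.fieldY f X Y) := by
  have := h.swap.rel hc (X := Y) (Y := X) hXY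
  rwa [h.reg.potential_swap h.hf] at this

/-- `x + J` is nondecreasing along vertical characteristics. -/
theorem mono_vertical (h : Θ.Solves c σ m R f S) (hc : Speed c κ) {X a b : ℝ} (hab : a ≤ b)
    (hS : ∀ η ∈ Ioo a b, (X, η) ∈ S) :
    Θ.potential f X a 1 + Θ.potential f X a 3 ≤ Θ.potential f X b 1 + Θ.potential f X b 3 := by
  refine le_of_ae_deriv_nonneg (g := fun η => Θ.potential f X η 1 + Θ.potential f X η 3)
    (g' := fun η => Θ.fieldY f X η 1 + Θ.fieldY f X η 3) ?_ hab ?_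
  · exact contDiff_comp_locallyLipschitz (Φ := fun w : Vec => w 1 + w 3) (by fun_prop)
      (h.locallyLipschitz_potential X)
  · filter_upwards [(h.reg.isPrimitive_potential h.hf X).ae_hasDerivAt
      ((h.reg.locBounded_fieldY h.hf).left X)] with η h1 hη
    have h2 := hasDerivAt_pi.1 h1
    exact ⟨(h2 1).add (h2 3), (h.rel_right hc (hS η hη)).pos.le⟩

theorem mono_horizontal (h : Θ.Solves c σ m R f S) (hc : Speed c κ) {Y a b : ℝ} (hab : a ≤ b)
    (hS : ∀ ξ ∈ Ioo a b, (ξ, Y) ∈ S) :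
    Θ.potential f a Y 1 + Θ.potential f a Y 3 ≤ Θ.potential f b Y 1 + Θ.potential f b Y 3 := by
  have := h.swap.mono_vertical hc (X := Y) hab hS
  simpa only [h.reg.potential_swap h.hf] using this

theorem abs_x_add_J_curve (hreg : Θ.Regular m) (s : ℝ) : |Θ.Z s 1 + Θ.Z s 3 - s| ≤ 2 * m := by
  have h1 := (norm_le_pi_norm (Θ.Za s) 1).trans (hreg.bound_Z s)
  have h3 := (norm_le_pi_norm (Θ.Za s) 3).trans (hreg.bound_Z s)
  simp only [Za, Pi.sub_apply, Matrix.cons_val, sub_zero, Real.norm_eq_abs] at h1 h3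
  rw [abs_le] at *
  constructor <;> linarith [h1.1, h1.2, h3.1, h3.2]

/-- Variation of `x + J` between a point and the curve point on the same vertical line. Because
`x + J` is also monotone along horizontal lines, its value at `(X, Y)` is controlled by its value
at the curve point with ordinate `Y`, and on the curve `x + J` differs from the parameter by at
most `2m`. -/
theorem x_add_J_le (h : Θ.Solves c σ m R f S) (hc : Speed c κ) {X Y θ : ℝ} (hXY : (X, Y) ∈ S)
    (hθ : gap Θ.X Θ.Y X Y ≤ θ) :
    (Θ.Y (genInv Θ.X X) ≤ Y → Θ.potential f X Y 1 + Θ.potential f X Y 3 -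
      (Θ.Z (genInv Θ.X X) 1 + Θ.Z (genInv Θ.X X) 3) ≤ θ + 4 * m) ∧
    (Y ≤ Θ.Y (genInv Θ.X X) → Θ.Z (genInv Θ.X X) 1 + Θ.Z (genInv Θ.X X) 3 -
      (Θ.potential f X Y 1 + Θ.potential f X Y 3) ≤ θ + 4 * m) := by
  set s := genInv Θ.X X with hs
  set r := genInv Θ.Y Y with hr
  have hcv := h.reg.curve
  have e1 := abs_le.1 (abs_x_add_J_curve h.reg s)
  have e2 := abs_le.1 (abs_x_add_J_curve h.reg r)
  have e3 : |s - r| ≤ θ := hθ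
  rw [abs_le] at e3
  have hXs : Θ.X s = X := hcv.apply_genInv X
  have hYr : Θ.Y r = Y := hcv.symm.apply_genInv Y
  have hr0 : Θ.potential f (Θ.X r) Y = Θ.Z r := by
    conv_lhs => rw [← hYr]
    exact h.reg.potential_curve h.hf r
  have hs0 : Θ.potential f X (Θ.Y s) = Θ.Z s := by
    conv_lhs => rw [← hXs]
    exact h.reg.potential_curve h.hf s
  have hcl := h.closed_right X Y hXY
  rw [← hr] at hcl
  constructor
  · intro hY
    rcases hY.eq_or_lt with hY | hY
    · rw [← hY, hs0, sub_self]
      linarith [(norm_nonneg _).trans (h.reg.bound_Z s), hθ.trans' (gap_nonneg _ _ _ _)]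
    · have hsr : s ≤ r := (hcv.symm.lt_genInv_iff.2 hY).le
      have hX : X ≤ Θ.X r := by rw [← hXs]; exact hcv.monotone_left hsr
      have := h.mono_horizontal hc hX fun ξ hξ => hcl ξ (by rwa [uIoo_of_ge hX])
      rw [hr0] at this
      linarith [e1.1, e2.2, e3.1]
  · intro hY
    have hsr : r ≤ s := hcv.symm.genInv_le_iff.2 hY
    have hX : Θ.X r ≤ X := by rw [← hXs]; exact hcv.monotone_left hsr
    have := h.mono_horizontal hc hX fun ξ hξ => hcl ξ (by rwa [uIoo_of_le hX])
    rw [hr0] at this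
    linarith [e1.2, e2.1, e3.2]

/-- Bounds for `U` and for the derivative of `x + J` at a point of a strip. The bound for `U` does
not involve the bound `A` for the coefficient. -/
theorem ode_bounds (h : Θ.Solves c σ m R f S) (hc : Speed c κ) {X Y θ A : ℝ} (hXY : (X, Y) ∈ S)
    (hθ : gap Θ.X Θ.Y X Y ≤ θ) (hA0 : 0 ≤ A)
    (hA : ∀ η ∈ uIoo (Θ.Y (genInv Θ.X X)) Y, |coef c (Θ.potential f X η 2)| ≤ A) :
    |Θ.potential f X Y 2 - Θ.Z (genInv Θ.X X) 2| ≤ κ * (θ + 4 * m) ∧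
      Θ.fieldX f X Y 1 + Θ.fieldX f X Y 3 ≤
        (Θ.V X 1 + Θ.V X 3) * Real.exp (2 * κ * A * (θ + 4 * m)) := by
  have hν := h.x_add_J_le hc hXY hθ
  have hcl := h.closed_left X Y hXY
  have hode := h.ae_ode hXY
  have hV := (h.adm.rel_V X).pos
  have hP := (h.rel hc hXY).pos
  have b1 := fieldX_base Θ f X
  have b2 := potential_base Θ f X
  rcases le_total (Θ.Y (genInv Θ.X X)) Y with hY | hY
  · rw [uIoo_of_le hY] at hcl hA
    rw [uIoc_of_le hY] at hode
    obtain ⟨h1, h2, -⟩ := bounds_of_ode hc hY (h.locallyLipschitz_potential X)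
      (h.locallyLipschitz_fieldX X) (q := Θ.fieldY f X) (A := A) (ν := θ + 4 * m)
      (by filter_upwards [hode] with η h1 hη using (h1 (Ioo_subset_Ioc_self hη)).2) hA
      (fun η hη => (h.rel_right hc (hcl η hη)).pos) (fun η hη => (h.rel hc (hcl η hη)).energy)
      (fun η hη => (h.rel_right hc (hcl η hη)).energy) (by rwa [b1]) hP hA0
      (by rw [b2]; exact hν.1 hY)
    rw [b1] at h2
    rw [b2] at h1
    exact ⟨h1, h2⟩
  · rw [uIoo_of_ge hY] at hcl hA
    rw [uIoc_of_ge hY] at hode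
    obtain ⟨h1, -, h2⟩ := bounds_of_ode hc hY (h.locallyLipschitz_potential X)
      (h.locallyLipschitz_fieldX X) (q := Θ.fieldY f X) (A := A) (ν := θ + 4 * m)
      (by filter_upwards [hode] with η h1 hη using (h1 (Ioo_subset_Ioc_self hη)).2) hA
      (fun η hη => (h.rel_right hc (hcl η hη)).pos) (fun η hη => (h.rel hc (hcl η hη)).energy)
      (fun η hη => (h.rel_right hc (hcl η hη)).energy) hP (by rwa [b1]) hA0
      (by rw [b2]; exact hν.2 hY)
    rw [b1] at h2
    rw [b2, abs_sub_comm] at h1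
    exact ⟨h1, h2⟩

theorem abs_U_curve (hreg : Θ.Regular m) (s : ℝ) : |Θ.Z s 2| ≤ m := by
  have h1 := (norm_le_pi_norm (Θ.Za s) 2).trans (hreg.bound_Z s)
  simpa only [Za, Pi.sub_apply, Matrix.cons_val, sub_zero, Real.norm_eq_abs] using h1

end Solves

/-- **A priori bound.** On the strip `gap ≤ θ` every solution satisfies a bound which depends only
on `c`, `θ` and the size `m` of the data. -/
theorem exists_apriori_bound {c : ℝ → ℝ} {κ : ℝ} (hc : Speed c κ) {m : ℝ} (hm : 0 ≤ m) (θ : ℝ) :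
    ∃ R₀, m ≤ R₀ ∧ ∀ (σ R : ℝ) (Θ : Data) (f : ℝ → ℝ → Vec) (S : Set (ℝ × ℝ)),
      Θ.Solves c σ m R f S → (∀ X Y, (X, Y) ∈ S → gap Θ.X Θ.Y X Y ≤ θ) →
      ∀ X Y, (X, Y) ∈ S → |Θ.potential f X Y 2| ≤ R₀ ∧ ‖Θ.fieldX f X Y‖ ≤ R₀ ∧
        ‖Θ.fieldY f X Y‖ ≤ R₀ := by
  have hκ := hc.pos
  set RU := m + κ * (|θ| + 4 * m) with hRU
  obtain ⟨A, hA0, hA⟩ := hc.exists_coef_bound RU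
  set E := Real.exp (2 * κ * A * (|θ| + 4 * m)) with hE
  have hE1 : 1 ≤ E := Real.one_le_exp (by positivity)
  have hRm : m ≤ RU := by rw [hRU]; linarith [show 0 ≤ κ * (|θ| + 4 * m) by positivity]
  refine ⟨max RU ((1 + κ) * (2 * m * E)), le_max_of_le_left hRm, ?_⟩
  intro σ R Θ f S h hS
  have hS' : ∀ X Y, (X, Y) ∈ S → gap Θ.X Θ.Y X Y ≤ |θ| := fun X Y hXY =>
    (hS X Y hXY).trans (le_abs_self θ)
  have hU : ∀ X Y, (X, Y) ∈ S → |Θ.potential f X Y 2| ≤ RU := fun X Y hXY => by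
    obtain ⟨B, hB0, hB⟩ := hc.exists_coef_bound R
    have h1 := (h.ode_bounds hc hXY (hS' X Y hXY) hB0 fun η hη =>
      hB _ (h.bound X η (h.closed_left X Y hXY η hη)).1).1
    have h2 := Solves.abs_U_curve h.reg (genInv Θ.X X)
    have h3 := abs_sub_abs_le_abs_sub (Θ.potential f X Y 2) (Θ.Z (genInv Θ.X X) 2)
    linarith
  have hfin : ∀ (τ u : ℝ) (p v : Vec), |τ| = 1 → Rel c τ u p → ‖v‖ ≤ m →
      p 1 + p 3 ≤ (v 1 + v 3) * E → ‖p‖ ≤ max RU ((1 + κ) * (2 * m * E)) := by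
    intro τ u p v hτ hp hv hle
    refine ((hp.norm_le hc hτ).trans ?_).trans (le_max_right _ _)
    have e1 := (le_abs_self _).trans ((norm_le_pi_norm v 1).trans hv)
    have e3 := (le_abs_self _).trans ((norm_le_pi_norm v 3).trans hv)
    refine mul_le_mul_of_nonneg_left (hle.trans ?_) (by positivity)
    exact mul_le_mul_of_nonneg_right (by linarith) (by positivity)
  intro X Y hXY
  refine ⟨(hU X Y hXY).trans (le_max_left _ _), ?_, ?_⟩
  · exact hfin σ _ _ _ h.adm.abs_sign (h.rel hc hXY) (h.reg.bound_V X)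
      (h.ode_bounds hc hXY (hS' X Y hXY) hA0 fun η hη =>
        hA _ (hU X η (h.closed_left X Y hXY η hη))).2
  · have hsw := h.swap
    exact hfin (-σ) _ _ _ hsw.adm.abs_sign (h.rel_right hc hXY) (h.reg.bound_W Y)
      (hsw.ode_bounds hc (X := Y) (Y := X) hXY
        (by rw [show gap Θ.swap.X Θ.swap.Y Y X = gap Θ.X Θ.Y X Y from gap_comm _ _ _ _]
            exact hS' X Y hXY) hA0 fun ξ hξ => by
          rw [h.reg.potential_swap h.hf]
          exact hA _ (hU ξ Y (h.closed_right X Y hXY ξ hξ))).2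

end Data

/-! ### The truncated problem -/

/-- Truncation of a number to `[-R, R]`. -/
noncomputable def clamp (R x : ℝ) : ℝ := max (-R) (min R x)

theorem abs_clamp_le {R : ℝ} (hR : 0 ≤ R) (x : ℝ) : |clamp R x| ≤ R :=
  abs_le.2 ⟨le_max_left _ _, max_le (by linarith) (min_le_left _ _)⟩

theorem clamp_eq {R x : ℝ} (hx : |x| ≤ R) : clamp R x = x := by
  rw [abs_le] at hx
  rw [clamp, min_eq_right hx.2, max_eq_right hx.1]

theorem abs_clamp_sub_le (R x y : ℝ) : |clamp R x - clamp R y| ≤ |x - y| := by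
  unfold clamp
  refine (abs_max_sub_max_le_max _ _ _ _).trans ?_
  rw [sub_self, abs_zero, max_eq_right (abs_nonneg _)]
  refine (abs_min_sub_min_le_max _ _ _ _).trans ?_
  rw [sub_self, abs_zero, max_eq_right (abs_nonneg _)]

theorem continuous_clamp (R : ℝ) : Continuous (clamp R) :=
  continuous_const.max (continuous_const.min continuous_id)

/-- `F` with `U` and the two derivatives truncated componentwise. -/
noncomputable def truncF (c : ℝ → ℝ) (R : ℝ) (z v w : Vec) : Vec :=
  F c (fun _ => clamp R (z 2)) (fun i => clamp R (v i)) (fun i => clamp R (w i))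

theorem norm_clamp_le {R : ℝ} (hR : 0 ≤ R) (v : Vec) : ‖(fun i => clamp R (v i) : Vec)‖ ≤ R :=
  (pi_norm_le_iff_of_nonneg hR).2 fun i => abs_clamp_le hR (v i)

theorem norm_clamp_sub_le (R : ℝ) (v w : Vec) :
    ‖(fun i => clamp R (v i) : Vec) - (fun i => clamp R (w i) : Vec)‖ ≤ ‖v - w‖ :=
  (pi_norm_le_iff_of_nonneg (norm_nonneg _)).2 fun i =>
    (abs_clamp_sub_le R (v i) (w i)).trans (norm_le_pi_norm (v - w) i)

theorem truncF_eq (c : ℝ → ℝ) {R : ℝ} {z v w : Vec} (hz : |z 2| ≤ R) (hv : ‖v‖ ≤ R)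
    (hw : ‖w‖ ≤ R) : truncF c R z v w = F c z v w := by
  have h : ∀ u : Vec, ‖u‖ ≤ R → (fun i => clamp R (u i)) = u := fun u hu => by
    funext i; exact clamp_eq ((norm_le_pi_norm u i).trans hu)
  rw [truncF, h v hv, h w hw, clamp_eq hz]
  rfl

theorem Speed.exists_truncF_lipschitz {c : ℝ → ℝ} {κ : ℝ} (hc : Speed c κ) {R : ℝ} (hR : 0 ≤ R) :
    ∃ L, 0 ≤ L ∧ ∀ z z' p p' q q' : Vec, ‖truncF c R z p q‖ ≤ L ∧
      ‖truncF c R z p q - truncF c R z' p' q'‖ ≤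
        L * max ‖z - z'‖ (max ‖p - p'‖ ‖q - q'‖) := by
  obtain ⟨L, hL0, hL⟩ := hc.exists_F_lipschitz R
  refine ⟨L, hL0, fun z z' p p' q q' => ?_⟩
  obtain ⟨h1, h2⟩ := hL (fun _ => clamp R (z 2)) (fun _ => clamp R (z' 2))
    (fun i => clamp R (p i)) (fun i => clamp R (p' i)) (fun i => clamp R (q i))
    (fun i => clamp R (q' i)) (abs_clamp_le hR _) (abs_clamp_le hR _) (norm_clamp_le hR _)
    (norm_clamp_le hR _) (norm_clamp_le hR _) (norm_clamp_le hR _)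
  refine ⟨h1, h2.trans ?_⟩
  gcongr
  · exact (abs_clamp_sub_le R _ _).trans (norm_le_pi_norm (z - z') 2)
  · exact norm_clamp_sub_le R p p'
  · exact norm_clamp_sub_le R q q'

theorem Speed.continuous_truncF {c : ℝ → ℝ} {κ : ℝ} (hc : Speed c κ) (R : ℝ) :
    Continuous fun w : Vec × Vec × Vec => truncF c R w.1 w.2.1 w.2.2 := by
  have h1 : Continuous fun w : Vec × Vec × Vec =>
      ((clamp R (w.1 2), (fun i => clamp R (w.2.1 i)), fun i => clamp R (w.2.2 i)) :
        ℝ × Vec × Vec) := by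
    have := continuous_clamp R
    fun_prop
  exact hc.locallyLipschitz_F.continuous.comp h1

namespace Data

variable {c : ℝ → ℝ} {κ m R : ℝ} {Θ : Data}

/-- The Picard map of the truncated problem. -/
noncomputable def picard (c : ℝ → ℝ) (R : ℝ) (Θ : Data) (f : ℝ → ℝ → Vec) (X Y : ℝ) : Vec :=
  truncF c R (Θ.potential f X Y) (Θ.fieldX f X Y) (Θ.fieldY f X Y)

theorem Regular.norm_fieldX_sub_le (h : Θ.Regular m) {f g : ℝ → ℝ → Vec}
    (hf : LocBounded (Function.uncurry f)) (hg : LocBounded (Function.uncurry g)) {M l : ℝ}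
    (hM : 0 ≤ M) (hl : 0 < l)
    (hfg : ∀ X Y, ‖f X Y - g X Y‖ ≤ M * Real.exp (l * gap Θ.X Θ.Y X Y)) (X Y : ℝ) :
    ‖Θ.fieldX f X Y - Θ.fieldX g X Y‖ ≤ 2 * M / l * Real.exp (l * gap Θ.X Θ.Y X Y) := by
  rw [fieldX, fieldX, add_sub_add_left_eq_sub, ← intervalIntegral.integral_sub
    ((hf.left X).intervalIntegrable _ _) ((hg.left X).intervalIntegrable _ _)]
  exact h.curve.norm_integral_le_exp_gap hM hl fun η _ => hfg X η

theorem Regular.norm_fieldY_sub_le (h : Θ.Regular m) {f g : ℝ → ℝ → Vec}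
    (hf : LocBounded (Function.uncurry f)) (hg : LocBounded (Function.uncurry g)) {M l : ℝ}
    (hM : 0 ≤ M) (hl : 0 < l)
    (hfg : ∀ X Y, ‖f X Y - g X Y‖ ≤ M * Real.exp (l * gap Θ.X Θ.Y X Y)) (X Y : ℝ) :
    ‖Θ.fieldY f X Y - Θ.fieldY g X Y‖ ≤ 2 * M / l * Real.exp (l * gap Θ.X Θ.Y X Y) := by
  have hsw : ∀ X Y, gap Θ.swap.X Θ.swap.Y Y X = gap Θ.X Θ.Y X Y := fun X Y => gap_comm _ _ _ _
  have := h.swap.norm_fieldX_sub_le hf.flip hg.flip hM hl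
    (fun Y X => by rw [hsw]; exact hfg X Y) Y X
  rwa [hsw] at this

theorem Regular.norm_potential_sub_le (h : Θ.Regular m) {f g : ℝ → ℝ → Vec}
    (hf : LocBounded (Function.uncurry f)) (hg : LocBounded (Function.uncurry g)) {M l : ℝ}
    (hM : 0 ≤ M) (hl : 0 < l)
    (hfg : ∀ X Y, ‖f X Y - g X Y‖ ≤ M * Real.exp (l * gap Θ.X Θ.Y X Y)) (X Y : ℝ) :
    ‖Θ.potential f X Y - Θ.potential g X Y‖ ≤
      2 * (2 * M / l) / l * Real.exp (l * gap Θ.X Θ.Y X Y) := by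
  rw [potential, potential, add_sub_add_left_eq_sub, ← intervalIntegral.integral_sub
    (((h.locBounded_fieldY hf).left X).intervalIntegrable _ _)
    (((h.locBounded_fieldY hg).left X).intervalIntegrable _ _)]
  exact h.curve.norm_integral_le_exp_gap (by positivity) hl fun η _ =>
    h.norm_fieldY_sub_le hf hg hM hl hfg X η

/-- The truncated problem has a bounded global solution: the Picard map is a contraction in the
norm with weight `e^{-λ gap}` for large `λ`. -/
theorem Regular.exists_truncated_solution (h : Θ.Regular m) (hc : Speed c κ) (hR : 0 ≤ R) :
    ∃ f : ℝ → ℝ → Vec, LocBounded (Function.uncurry f) ∧ (∃ C, ∀ X Y, ‖f X Y‖ ≤ C) ∧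
      ∀ X Y, f X Y = truncF c R (Θ.potential f X Y) (Θ.fieldX f X Y) (Θ.fieldY f X Y) := by
  obtain ⟨L, hL0, hL⟩ := hc.exists_truncF_lipschitz hR
  set l : ℝ := 4 * L + 2 with hl
  have hl0 : 0 < l := by positivity
  have hbdd : ∀ f X Y, ‖picard c R Θ f X Y‖ ≤ L := fun f X Y => (hL _ 0 _ 0 _ 0).1
  have hloc : ∀ f, LocBounded (Function.uncurry f) →
      LocBounded (Function.uncurry (picard c R Θ f)) := fun f hf =>
    LocBounded.of_exists ((hc.continuous_truncF R).comp_stronglyMeasurable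
      ((h.locBounded_potential hf).meas.prodMk ((h.locBounded_fieldX hf).meas.prodMk
        (h.locBounded_fieldY hf).meas))) fun _ => ⟨L, fun X Y _ _ => hbdd f X Y⟩
  have hcontr : ∀ f g, LocBounded (Function.uncurry f) → LocBounded (Function.uncurry g) →
      ∀ M, 0 ≤ M → (∀ X Y, ‖f X Y - g X Y‖ ≤ M * Real.exp (l * gap Θ.X Θ.Y X Y)) →
      ∀ X Y, ‖picard c R Θ f X Y - picard c R Θ g X Y‖ ≤
        M / 2 * Real.exp (l * gap Θ.X Θ.Y X Y) := by
    intro f g hf hg M hM hfg X Y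
    have e0 := Real.exp_pos (l * gap Θ.X Θ.Y X Y)
    have e1 := h.norm_fieldX_sub_le hf hg hM hl0 hfg X Y
    have e2 := h.norm_fieldY_sub_le hf hg hM hl0 hfg X Y
    have e3 := h.norm_potential_sub_le hf hg hM hl0 hfg X Y
    have e4 : 2 * (2 * M / l) / l ≤ 2 * M / l := by
      rw [div_le_iff₀ hl0]
      have : 0 ≤ 2 * M / l := by positivity
      nlinarith
    have e5 : L * (2 * M / l) ≤ M / 2 := by
      rw [mul_div_assoc', div_le_iff₀ hl0, hl]; nlinarith
    refine (hL _ _ _ _ _ _).2.trans ?_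
    calc L * _ ≤ L * (2 * M / l * Real.exp (l * gap Θ.X Θ.Y X Y)) := by
          gcongr
          exact max_le (e3.trans (by gcongr)) (max_le e1 e2)
      _ = L * (2 * M / l) * Real.exp (l * gap Θ.X Θ.Y X Y) := by ring
      _ ≤ _ := by gcongr
  set it : ℕ → ℝ → ℝ → Vec := fun n => (picard c R Θ)^[n] 0 with hit
  have hsucc : ∀ n, it (n + 1) = picard c R Θ (it n) := fun n =>
    Function.iterate_succ_apply' _ _ _
  have hitl : ∀ n, LocBounded (Function.uncurry (it n)) := by
    intro n
    induction n with
    | zero => exact LocBounded.of_exists stronglyMeasurable_const fun _ => ⟨0, fun X Y _ _ => by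
        simp [hit]⟩
    | succ n ih => rw [hsucc]; exact hloc _ ih
  have hstep : ∀ n X Y, ‖it n X Y - it (n + 1) X Y‖ ≤
      L * (1 / 2) ^ n * Real.exp (l * gap Θ.X Θ.Y X Y) := by
    intro n
    induction n with
    | zero =>
      intro X Y
      rw [hsucc, pow_zero, mul_one]
      have : it 0 X Y = 0 := rfl
      rw [this, zero_sub, norm_neg]
      exact (hbdd _ X Y).trans (le_mul_of_one_le_right hL0
        (Real.one_le_exp (mul_nonneg hl0.le (gap_nonneg _ _ _ _))))
    | succ n ih =>
      intro X Y
      have := hcontr _ _ (hitl n) (hitl (n + 1)) _ (by positivity) ih X Y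
      rw [← hsucc, ← hsucc] at this
      refine this.trans (le_of_eq ?_)
      ring
  have hdist : ∀ X Y n, dist (it n X Y) (it (n + 1) X Y) ≤
      L * Real.exp (l * gap Θ.X Θ.Y X Y) * (1 / 2) ^ n := fun X Y n => by
    rw [dist_eq_norm]
    exact (hstep n X Y).trans (le_of_eq (by ring))
  have hex : ∀ X Y, ∃ v, Tendsto (fun n => it n X Y) atTop (𝓝 v) := fun X Y =>
    cauchySeq_tendsto_of_complete (cauchySeq_of_le_geometric _ _ (by norm_num) (hdist X Y))
  choose f hf using hex
  have hfb : ∀ X Y, ‖f X Y‖ ≤ L := fun X Y => by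
    refine le_of_tendsto ((hf X Y).norm) ?_
    filter_upwards [eventually_ge_atTop 1] with n hn
    obtain ⟨k, rfl⟩ := Nat.exists_eq_add_of_le' hn
    rw [hsucc]; exact hbdd _ X Y
  have hfl : LocBounded (Function.uncurry f) := LocBounded.of_exists
    (stronglyMeasurable_of_tendsto atTop (fun n => (hitl n).meas)
      (tendsto_pi_nhds.2 fun p => hf p.1 p.2)) fun _ => ⟨L, fun X Y _ _ => hfb X Y⟩
  refine ⟨f, hfl, ⟨L, hfb⟩, fun X Y => ?_⟩
  have hclose : ∀ n X Y, ‖it n X Y - f X Y‖ ≤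
      2 * L * (1 / 2) ^ n * Real.exp (l * gap Θ.X Θ.Y X Y) := fun n X Y => by
    rw [← dist_eq_norm]
    exact (dist_le_of_le_geometric_of_tendsto _ _ (by norm_num) (hdist X Y) (hf X Y) n).trans
      (le_of_eq (by ring))
  refine tendsto_nhds_unique ((hf X Y).comp (tendsto_add_atTop_nat 1)) ?_
  rw [tendsto_iff_norm_sub_tendsto_zero]
  refine squeeze_zero (g := fun n : ℕ =>
    2 * L * (1 / 2) ^ n / 2 * Real.exp (l * gap Θ.X Θ.Y X Y)) (fun n => norm_nonneg _)
    (fun n => ?_) ?_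
  · have := hcontr _ _ (hitl n) hfl _ (by positivity) (hclose n) X Y
    rw [← hsucc] at this
    exact this
  · have := (((tendsto_pow_atTop_nhds_zero_of_lt_one (r := (1 / 2 : ℝ)) (by norm_num)
      (by norm_num)).const_mul (2 * L)).div_const 2).mul_const
      (Real.exp (l * gap Θ.X Θ.Y X Y))
    simpa using this

/-! ### Removal of the truncation -/

/-- A function with slope at most `C` is bounded at `Y` by `R₀ + C ε` if it is bounded by `R₀` at
`b` and at the point at distance `ε` from `Y` in the direction of `b`. -/
theorem norm_le_of_short_step {E : Type*} [NormedAddCommGroup E] {G : ℝ → E} {b Y R₀ C ε : ℝ}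
    (hε : 0 < ε) (hC : 0 ≤ C) (hG : ∀ η ∈ uIcc b Y, ‖G Y - G η‖ ≤ C * |Y - η|) (hb : ‖G b‖ ≤ R₀)
    (hη : ∀ η ∈ uIoo b Y, |Y - η| = ε → ‖G η‖ ≤ R₀) : ‖G Y‖ ≤ R₀ + C * ε := by
  have key : ∀ η ∈ uIcc b Y, |Y - η| ≤ ε → ‖G η‖ ≤ R₀ → ‖G Y‖ ≤ R₀ + C * ε := fun η h1 h2 h3 => by
    have h4 := (hG η h1).trans (mul_le_mul_of_nonneg_left h2 hC)
    have h5 := norm_sub_norm_le (G Y) (G η)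
    linarith
  by_cases hbY : |Y - b| ≤ ε
  · exact key b left_mem_uIcc hbY hb
  · push Not at hbY
    have main : ∃ η ∈ uIoo b Y, |Y - η| = ε := by
      rcases le_total b Y with h1 | h1
      · rw [abs_of_nonneg (by linarith)] at hbY
        refine ⟨Y - ε, ?_, by rw [sub_sub_cancel, abs_of_pos hε]⟩
        rw [uIoo_of_le h1]; exact ⟨by linarith, by linarith⟩
      · rw [abs_of_nonpos (by linarith)] at hbY
        refine ⟨Y + ε, ?_, by rw [sub_add_cancel_left, abs_neg, abs_of_pos hε]⟩
        rw [uIoo_of_ge h1]; exact ⟨by linarith, by linarith⟩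
    obtain ⟨η, h1, h2⟩ := main
    exact key η (uIoo_subset_uIcc_self h1) h2.le (hη η h1 h2)

theorem gap_closed_left (h : Θ.Regular m) {X Y η : ℝ} (hη : η ∈ uIoo (Θ.Y (genInv Θ.X X)) Y) :
    gap Θ.X Θ.Y X η ≤ gap Θ.X Θ.Y X Y := by
  linarith [h.curve.gap_add_le hη, abs_nonneg (Y - η)]

theorem gap_closed_right (h : Θ.Regular m) {X Y ξ : ℝ} (hξ : ξ ∈ uIoo (Θ.X (genInv Θ.Y Y)) X) :
    gap Θ.X Θ.Y ξ Y ≤ gap Θ.X Θ.Y X Y := by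
  have := gap_closed_left h.swap (X := Y) (Y := X) hξ
  rw [← gap_comm Θ.X Θ.Y X Y, ← gap_comm Θ.X Θ.Y ξ Y]
  exact this

/-- On every strip around the curve the problem has a solution. The truncation radius exceeds the a
priori bound by one; proceeding away from the curve in short steps, the solution cannot leave the
region where the truncation is inactive. -/
theorem Regular.exists_solution_strip (h : Θ.Regular m) {σ : ℝ} (hadm : Θ.Admissible c σ)
    (hc : Speed c κ) (θ : ℝ) :
    ∃ (f : ℝ → ℝ → Vec) (R₀ : ℝ), Θ.Solves c σ m R₀ f {p | gap Θ.X Θ.Y p.1 p.2 ≤ θ} := by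
  have hm : 0 ≤ m := (norm_nonneg _).trans (h.bound_V 0)
  obtain ⟨R₀, hmR, hR₀⟩ := exists_apriori_bound hc hm θ
  set R := R₀ + 1 with hR
  have hR0 : 0 ≤ R := by linarith
  obtain ⟨f, hf, ⟨C, hC⟩, hfe⟩ := h.exists_truncated_solution hc hR0
  have hC0 : 0 ≤ C := (norm_nonneg _).trans (hC 0 0)
  set ε := 1 / (2 * (C + R + 1)) with hε
  have hε0 : 0 < ε := by positivity
  have hεC : C * (2 * ε) ≤ 1 := by
    rw [hε, ← mul_div_assoc, ← mul_div_assoc, div_le_one (by positivity)]; linarith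
  have hεR : R * (2 * ε) ≤ 1 := by
    rw [hε, ← mul_div_assoc, ← mul_div_assoc, div_le_one (by positivity)]; linarith
  have key : ∀ k : ℕ, ∀ X Y, gap Θ.X Θ.Y X Y < k * ε → gap Θ.X Θ.Y X Y ≤ θ →
      |Θ.potential f X Y 2| ≤ R₀ ∧ ‖Θ.fieldX f X Y‖ ≤ R₀ ∧ ‖Θ.fieldY f X Y‖ ≤ R₀ := by
    intro k
    induction k with
    | zero =>
      intro X Y h1
      have := gap_nonneg Θ.X Θ.Y X Y
      simp only [Nat.cast_zero, zero_mul] at h1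
      linarith
    | succ k ih =>
      push_cast
      -- A step of length `2ε` towards the curve reaches the region already treated.
      have hstepX : ∀ X Y η, gap Θ.X Θ.Y X Y < (k + 1) * ε → gap Θ.X Θ.Y X Y ≤ θ →
          η ∈ uIoo (Θ.Y (genInv Θ.X X)) Y → |Y - η| = 2 * ε →
          gap Θ.X Θ.Y X η < k * ε ∧ gap Θ.X Θ.Y X η ≤ θ := fun X Y η h1 h2 h3 h4 => by
        have := h.curve.gap_add_le h3
        rw [h4] at this
        constructor <;> linarith
      have hstepY : ∀ X Y ξ, gap Θ.X Θ.Y X Y < (k + 1) * ε → gap Θ.X Θ.Y X Y ≤ θ →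
          ξ ∈ uIoo (Θ.X (genInv Θ.Y Y)) X → |X - ξ| = 2 * ε →
          gap Θ.X Θ.Y ξ Y < k * ε ∧ gap Θ.X Θ.Y ξ Y ≤ θ := fun X Y ξ h1 h2 h3 h4 => by
        have := h.curve.symm.gap_add_le h3
        rw [h4, gap_comm Θ.X Θ.Y, gap_comm Θ.X Θ.Y] at this
        constructor <;> linarith
      have hPX : ∀ X Y, gap Θ.X Θ.Y X Y < (k + 1) * ε → gap Θ.X Θ.Y X Y ≤ θ →
          ‖Θ.fieldX f X Y‖ ≤ R := fun X Y h1 h2 => by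
        refine (norm_le_of_short_step (G := Θ.fieldX f X) (b := Θ.Y (genInv Θ.X X))
          (R₀ := R₀) (C := C) (ε := 2 * ε) (by positivity) hC0 (fun η _ => ?_) ?_ ?_).trans
          (by linarith)
        · exact (isPrimitive_fieldX hf X).norm_sub_le fun t _ => hC X t
        · rw [Solves.fieldX_base]; exact (h.bound_V X).trans hmR
        · intro η h3 h4
          obtain ⟨h5, h6⟩ := hstepX X Y η h1 h2 h3 h4
          exact (ih X η h5 h6).2.1
      have hPY : ∀ X Y, gap Θ.X Θ.Y X Y < (k + 1) * ε → gap Θ.X Θ.Y X Y ≤ θ →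
          ‖Θ.fieldY f X Y‖ ≤ R := fun X Y h1 h2 => by
        refine (norm_le_of_short_step (G := fun X => Θ.fieldY f X Y) (b := Θ.X (genInv Θ.Y Y))
          (R₀ := R₀) (C := C) (ε := 2 * ε) (by positivity) hC0 (fun ξ _ => ?_) ?_ ?_).trans
          (by linarith)
        · exact (isPrimitive_fieldY hf Y).norm_sub_le fun t _ => hC t Y
        · have e : Θ.fieldY f (Θ.X (genInv Θ.Y Y)) Y = Θ.W Y :=
            Solves.fieldX_base Θ.swap (flip f) Y
          simp only [e]
          exact (h.bound_W Y).trans hmR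
        · intro ξ h3 h4
          obtain ⟨h5, h6⟩ := hstepY X Y ξ h1 h2 h3 h4
          exact (ih ξ Y h5 h6).2.2
      have hU : ∀ X Y, gap Θ.X Θ.Y X Y < (k + 1) * ε → gap Θ.X Θ.Y X Y ≤ θ →
          |Θ.potential f X Y 2| ≤ R := fun X Y h1 h2 => by
        refine (norm_le_of_short_step (G := fun η => Θ.potential f X η 2)
          (b := Θ.Y (genInv Θ.X X)) (R₀ := R₀) (C := R) (ε := 2 * ε) (by positivity) hR0
          (fun η hη => ?_) ?_ ?_).trans (by linarith)
        · refine (norm_le_pi_norm (Θ.potential f X Y - Θ.potential f X η) 2).trans ?_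
          rw [h.isPrimitive_potential hf X]
          refine intervalIntegral.norm_integral_le_of_norm_le_const_ae ?_
          filter_upwards [ae_uIoc_of_uIoo (P := fun t => ‖Θ.fieldY f X t‖ ≤ R)
            (a := Θ.Y (genInv Θ.X X)) (b := Y) fun t ht => hPY X t
              ((gap_closed_left h ht).trans_lt h1) ((gap_closed_left h ht).trans h2)] with t ht ht'
          exact ht (uIoc_subset_uIoc_of_uIcc_subset_uIcc (uIcc_subset_uIcc_right hη) ht')
        · simp only [Solves.potential_base]
          exact (Solves.abs_U_curve h _).trans hmR
        · intro η h3 h4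
          obtain ⟨h5, h6⟩ := hstepX X Y η h1 h2 h3 h4
          exact (ih X η h5 h6).1
      have hsol : Θ.Solves c σ m R f
          {p | gap Θ.X Θ.Y p.1 p.2 < (k + 1) * ε ∧ gap Θ.X Θ.Y p.1 p.2 ≤ θ} := {
        reg := h
        adm := hadm
        hf := hf
        closed_left := fun X Y hXY η hη =>
          ⟨(gap_closed_left h hη).trans_lt hXY.1, (gap_closed_left h hη).trans hXY.2⟩
        closed_right := fun X Y hXY ξ hξ =>
          ⟨(gap_closed_right h hξ).trans_lt hXY.1, (gap_closed_right h hξ).trans hXY.2⟩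
        eq := fun X Y hXY => by
          rw [← truncF_eq c (hU X Y hXY.1 hXY.2) (hPX X Y hXY.1 hXY.2) (hPY X Y hXY.1 hXY.2)]
          exact hfe X Y
        bound := fun X Y hXY =>
          ⟨hU X Y hXY.1 hXY.2, hPX X Y hXY.1 hXY.2, hPY X Y hXY.1 hXY.2⟩ }
      intro X Y h1 h2
      exact hR₀ σ R Θ f _ hsol (fun X Y hXY => hXY.2) X Y ⟨h1, h2⟩
  obtain ⟨k, hk⟩ := exists_nat_gt (θ / ε)
  rw [div_lt_iff₀ hε0] at hk
  have hfin : ∀ X Y, gap Θ.X Θ.Y X Y ≤ θ →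
      |Θ.potential f X Y 2| ≤ R₀ ∧ ‖Θ.fieldX f X Y‖ ≤ R₀ ∧ ‖Θ.fieldY f X Y‖ ≤ R₀ :=
    fun X Y hXY => key k X Y (hXY.trans_lt hk) hXY
  refine ⟨f, R₀, h, hadm, hf, fun X Y hXY η hη => (gap_closed_left h hη).trans hXY,
    fun X Y hXY ξ hξ => (gap_closed_right h hξ).trans hXY, fun X Y hXY => ?_, hfin⟩
  obtain ⟨h1, h2, h3⟩ := hfin X Y hXY
  rw [← truncF_eq c (h1.trans (by linarith : R₀ ≤ R)) (h2.trans (by linarith))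
    (h3.trans (by linarith))]
  exact hfe X Y

end Data

/-! ### Uniqueness and global existence -/

/-- **Uniqueness.** Two bounded solutions `(Z, P, Q)` of the integrated equations with the same data
agree on every set that contains almost all of the characteristics from its points to the curve. -/
theorem IsCurve.solution_unique {χ ψ : ℝ → ℝ} (h : IsCurve χ ψ) {c : ℝ → ℝ} {κ R : ℝ}
    (hc : Speed c κ) {S : Set (ℝ × ℝ)} {Z P Q Z' P' Q' : ℝ → ℝ → Vec}
    (hS1 : ∀ X Y, (X, Y) ∈ S → ∀ᵐ η, η ∈ uIoc (ψ (genInv χ X)) Y → (X, η) ∈ S)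
    (hS2 : ∀ X Y, (X, Y) ∈ S → ∀ᵐ ξ, ξ ∈ uIoc (χ (genInv ψ Y)) X → (ξ, Y) ∈ S)
    (hb : ∀ X Y, (X, Y) ∈ S → |Z X Y 2| ≤ R ∧ ‖P X Y‖ ≤ R ∧ ‖Q X Y‖ ≤ R)
    (hb' : ∀ X Y, (X, Y) ∈ S → |Z' X Y 2| ≤ R ∧ ‖P' X Y‖ ≤ R ∧ ‖Q' X Y‖ ≤ R)
    (hZ : ∀ X Y, (X, Y) ∈ S → Z X Y - Z' X Y =
      ∫ η in (ψ (genInv χ X))..Y, (Q X η - Q' X η))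
    (hP : ∀ X Y, (X, Y) ∈ S → ∃ g : ℝ → Vec, P X Y - P' X Y =
      ∫ η in (ψ (genInv χ X))..Y, g η ∧ ∀ᵐ η, η ∈ uIoc (ψ (genInv χ X)) Y →
        g η = F c (Z X η) (P X η) (Q X η) - F c (Z' X η) (P' X η) (Q' X η))
    (hQ : ∀ X Y, (X, Y) ∈ S → ∃ g : ℝ → Vec, Q X Y - Q' X Y =
      ∫ ξ in (χ (genInv ψ Y))..X, g ξ ∧ ∀ᵐ ξ, ξ ∈ uIoc (χ (genInv ψ Y)) X →
        g ξ = F c (Z ξ Y) (P ξ Y) (Q ξ Y) - F c (Z' ξ Y) (P' ξ Y) (Q' ξ Y)) :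
    ∀ X Y, (X, Y) ∈ S → Z X Y 2 = Z' X Y 2 ∧ P X Y = P' X Y ∧ Q X Y = Q' X Y := by
  obtain ⟨L, hL0, hL⟩ := hc.exists_F_lipschitz R
  have hF : ∀ X Y, (X, Y) ∈ S → ‖F c (Z X Y) (P X Y) (Q X Y) - F c (Z' X Y) (P' X Y) (Q' X Y)‖ ≤
      (L + 1) * (max |Z X Y 2 - Z' X Y 2| ‖P X Y - P' X Y‖ + ‖Q X Y - Q' X Y‖) := fun X Y hXY => by
    obtain ⟨a1, a2, a3⟩ := hb X Y hXY
    obtain ⟨b1, b2, b3⟩ := hb' X Y hXY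
    refine (hL _ _ _ _ _ _ a1 b1 a2 b2 a3 b3).2.trans ?_
    have h1 : 0 ≤ max |Z X Y 2 - Z' X Y 2| ‖P X Y - P' X Y‖ := le_max_of_le_left (abs_nonneg _)
    have h2 := norm_nonneg (Q X Y - Q' X Y)
    rw [← max_assoc]
    exact mul_le_mul (by linarith) (max_le (by linarith) (by linarith))
      (le_max_of_le_left h1) (by linarith)
  have key := h.goursat_eq_zero (S := S) (L := L + 1) (M := 2 * R)
    (p := fun X Y => max |Z X Y 2 - Z' X Y 2| ‖P X Y - P' X Y‖)
    (q := fun X Y => ‖Q X Y - Q' X Y‖) (by positivity)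
    (fun X Y hXY => ⟨le_max_of_le_left (abs_nonneg _), by
      obtain ⟨a1, a2, -⟩ := hb X Y hXY
      obtain ⟨b1, b2, -⟩ := hb' X Y hXY
      exact max_le ((abs_sub _ _).trans (by linarith)) ((norm_sub_le _ _).trans (by linarith))⟩)
    (fun X Y hXY => ⟨norm_nonneg _, (norm_sub_le _ _).trans (by
      linarith [(hb X Y hXY).2.2, (hb' X Y hXY).2.2])⟩) hS1 hS2 ?_ ?_
  · intro X Y hXY
    obtain ⟨h1, h2⟩ := key X Y hXY
    have h3 : |Z X Y 2 - Z' X Y 2| ≤ 0 := h1 ▸ le_max_left _ _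
    have h4 : ‖P X Y - P' X Y‖ ≤ 0 := h1 ▸ le_max_right _ _
    exact ⟨sub_eq_zero.1 (abs_nonpos_iff.1 h3), sub_eq_zero.1 (norm_le_zero_iff.1 h4),
      sub_eq_zero.1 (norm_eq_zero.1 h2)⟩
  · intro X Y hXY k hk hle
    refine max_le ?_ ?_
    · refine (norm_le_pi_norm (Z X Y - Z' X Y) 2).trans ?_
      rw [hZ X Y hXY]
      refine intervalIntegral.norm_integral_le_abs_of_norm_le ?_ (hk.intervalIntegrable _ _)
      rw [ae_restrict_iff' measurableSet_uIoc]
      filter_upwards [hle] with η h1 hη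
      refine le_trans ?_ (h1 hη)
      have h2 := norm_nonneg (Q X η - Q' X η)
      have h3 : 0 ≤ max |Z X η 2 - Z' X η 2| ‖P X η - P' X η‖ :=
        le_max_of_le_left (abs_nonneg _)
      nlinarith
    · obtain ⟨g, hg, hg'⟩ := hP X Y hXY
      rw [hg]
      refine intervalIntegral.norm_integral_le_abs_of_norm_le ?_ (hk.intervalIntegrable _ _)
      rw [ae_restrict_iff' measurableSet_uIoc]
      filter_upwards [hle, hg', hS1 X Y hXY] with η h1 h2 h3 hη
      rw [h2 hη]
      exact (hF X η (h3 hη)).trans (h1 hη)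
  · intro X Y hXY k hk hle
    obtain ⟨g, hg, hg'⟩ := hQ X Y hXY
    rw [hg]
    refine intervalIntegral.norm_integral_le_abs_of_norm_le ?_ (hk.intervalIntegrable _ _)
    rw [ae_restrict_iff' measurableSet_uIoc]
    filter_upwards [hle, hg', hS2 X Y hXY] with ξ h1 h2 h3 hξ
    rw [h2 hξ]
    exact (hF ξ Y (h3 hξ)).trans (h1 hξ)

namespace Data

variable {c : ℝ → ℝ} {κ σ m R R' : ℝ} {Θ : Data} {f f' : ℝ → ℝ → Vec} {S : Set (ℝ × ℝ)}

theorem Solves.unique (h : Θ.Solves c σ m R f S) (h' : Θ.Solves c σ m R' f' S) (hc : Speed c κ)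
    {X Y : ℝ} (hXY : (X, Y) ∈ S) : f X Y = f' X Y := by
  have hcl1 := fun X Y hXY => ae_uIoc_of_uIoo (h.closed_left X Y hXY)
  have hcl2 := fun X Y hXY => ae_uIoc_of_uIoo (h.closed_right X Y hXY)
  have key := h.reg.curve.solution_unique hc (S := S) (R := max R R')
    (Z := Θ.potential f) (P := Θ.fieldX f) (Q := Θ.fieldY f)
    (Z' := Θ.potential f') (P' := Θ.fieldX f') (Q' := Θ.fieldY f') hcl1 hcl2
    (fun X Y hXY => by
      obtain ⟨h1, h2, h3⟩ := h.bound X Y hXY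
      exact ⟨le_max_of_le_left h1, le_max_of_le_left h2, le_max_of_le_left h3⟩)
    (fun X Y hXY => by
      obtain ⟨h1, h2, h3⟩ := h'.bound X Y hXY
      exact ⟨le_max_of_le_right h1, le_max_of_le_right h2, le_max_of_le_right h3⟩)
    (fun X Y hXY => by
      rw [intervalIntegral.integral_sub
        (((h.reg.locBounded_fieldY h.hf).left X).intervalIntegrable _ _)
        (((h.reg.locBounded_fieldY h'.hf).left X).intervalIntegrable _ _), potential, potential,
        add_sub_add_left_eq_sub])
    (fun X Y hXY => ⟨fun η => f X η - f' X η, by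
      rw [intervalIntegral.integral_sub ((h.hf.left X).intervalIntegrable _ _)
        ((h'.hf.left X).intervalIntegrable _ _), fieldX, fieldX, add_sub_add_left_eq_sub], by
      filter_upwards [hcl1 X Y hXY] with η h1 hη
      rw [h.eq X η (h1 hη), h'.eq X η (h1 hη)]⟩)
    (fun X Y hXY => ⟨fun ξ => f ξ Y - f' ξ Y, by
      rw [intervalIntegral.integral_sub ((h.hf.right Y).intervalIntegrable _ _)
        ((h'.hf.right Y).intervalIntegrable _ _), fieldY, fieldY, add_sub_add_left_eq_sub], by
      filter_upwards [hcl2 X Y hXY] with ξ h1 hξ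
      rw [h.eq ξ Y (h1 hξ), h'.eq ξ Y (h1 hξ)]⟩)
  obtain ⟨h1, h2, h3⟩ := key X Y hXY
  rw [h.eq X Y hXY, h'.eq X Y hXY, h2, h3]
  unfold F
  simp only [h1]

theorem Solves.mono (h : Θ.Solves c σ m R f S) {θ : ℝ}
    (hS : {p : ℝ × ℝ | gap Θ.X Θ.Y p.1 p.2 ≤ θ} ⊆ S) :
    Θ.Solves c σ m R f {p | gap Θ.X Θ.Y p.1 p.2 ≤ θ} where
  reg := h.reg
  adm := h.adm
  hf := h.hf
  closed_left _ _ hXY _ hη := (gap_closed_left h.reg hη).trans hXY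
  closed_right _ _ hXY _ hξ := (gap_closed_right h.reg hξ).trans hXY
  eq X Y hXY := h.eq X Y (hS hXY)
  bound X Y hXY := h.bound X Y (hS hXY)

/-- The fields and the potential depend only on the values of `f` closer to the curve. -/
theorem Regular.fields_congr (h : Θ.Regular m) {θ : ℝ}
    (hff' : ∀ X Y, gap Θ.X Θ.Y X Y ≤ θ → f X Y = f' X Y) {X Y : ℝ} (hXY : gap Θ.X Θ.Y X Y ≤ θ) :
    Θ.fieldX f X Y = Θ.fieldX f' X Y ∧ Θ.fieldY f X Y = Θ.fieldY f' X Y ∧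
      Θ.potential f X Y = Θ.potential f' X Y := by
  have hY : ∀ X Y, gap Θ.X Θ.Y X Y ≤ θ → Θ.fieldY f X Y = Θ.fieldY f' X Y := fun X Y hXY => by
    rw [fieldY, fieldY, intervalIntegral.integral_congr_ae (ae_uIoc_of_uIoo fun ξ hξ =>
      hff' ξ Y ((gap_closed_right h hξ).trans hXY))]
  refine ⟨?_, hY X Y hXY, ?_⟩
  · rw [fieldX, fieldX, intervalIntegral.integral_congr_ae (ae_uIoc_of_uIoo fun η hη =>
      hff' X η ((gap_closed_left h hη).trans hXY))]
  · rw [potential, potential, intervalIntegral.integral_congr_ae (ae_uIoc_of_uIoo fun η hη =>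
      hY X η ((gap_closed_left h hη).trans hXY))]

theorem Regular.exists_gap_bound (h : Θ.Regular m) :
    ∃ M, ∀ X Y, gap Θ.X Θ.Y X Y ≤ |X| + |Y| + M := by
  obtain ⟨M₁, h₁⟩ := h.curve.bounded_left
  obtain ⟨M₂, h₂⟩ := h.curve.bounded_right
  refine ⟨M₁ + M₂, fun X Y => ?_⟩
  have h3 := h₁ (genInv Θ.X X)
  have h4 := h₂ (genInv Θ.Y Y)
  rw [h.curve.apply_genInv] at h3
  rw [h.curve.symm.apply_genInv] at h4
  unfold gap
  rw [abs_le] at *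
  have h5 := le_abs_self X
  have h6 := neg_abs_le X
  have h7 := le_abs_self Y
  have h8 := neg_abs_le Y
  constructor <;> linarith [h3.1, h3.2, h4.1, h4.2]

/-- **Global existence** for regular data, in the form of a right-hand side that solves the equation
on all strips around the curve. -/
theorem Regular.exists_global_solution (h : Θ.Regular m) (hadm : Θ.Admissible c σ)
    (hc : Speed c κ) : ∃ f : ℝ → ℝ → Vec, LocBounded (Function.uncurry f) ∧
      ∀ n : ℕ, ∃ R, Θ.Solves c σ m R f {p | gap Θ.X Θ.Y p.1 p.2 ≤ n} := by
  choose fs Rs hs using fun n : ℕ => h.exists_solution_strip hadm hc (n : ℝ)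
  set N : ℝ × ℝ → ℕ := fun p => ⌈gap Θ.X Θ.Y p.1 p.2⌉₊ with hN
  set f : ℝ → ℝ → Vec := fun X Y => fs (N (X, Y)) X Y with hf
  have heq : ∀ n : ℕ, ∀ X Y, gap Θ.X Θ.Y X Y ≤ n → f X Y = fs n X Y := fun n X Y hXY => by
    have h1 : N (X, Y) ≤ n := Nat.ceil_le.2 hXY
    refine (hs (N (X, Y))).unique ((hs n).mono fun p hp => ?_) hc
      (show gap Θ.X Θ.Y X Y ≤ _ from Nat.le_ceil (gap Θ.X Θ.Y X Y))
    exact le_trans (show gap Θ.X Θ.Y p.1 p.2 ≤ _ from hp) (Nat.cast_le.2 h1)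
  have hfm : Measurable (Function.uncurry f) := by
    have h1 : Measurable fun q : ℕ × (ℝ × ℝ) => fs q.1 q.2.1 q.2.2 :=
      measurable_from_prod_countable_right fun n => (hs n).hf.meas.measurable
    have h2 : Measurable N := Nat.measurable_ceil.comp h.curve.measurable_gap
    exact h1.comp (h2.prodMk measurable_id)
  have hfl : LocBounded (Function.uncurry f) := by
    refine LocBounded.of_exists hfm.stronglyMeasurable fun R => ?_
    obtain ⟨M, hM⟩ := h.exists_gap_bound
    obtain ⟨C, -, hC⟩ := (hs ⌈R + R + M⌉₊).hf.exists_bound R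
    refine ⟨C, fun X Y hX hY => ?_⟩
    rw [heq ⌈R + R + M⌉₊ X Y ((hM X Y).trans ((by linarith : _ ≤ R + R + M).trans (Nat.le_ceil _)))]
    exact hC X Y hX hY
  refine ⟨f, hfl, fun n => ⟨Rs n, h, hadm, hfl, (hs n).closed_left, (hs n).closed_right,
    fun X Y hXY => ?_, fun X Y hXY => ?_⟩⟩
  · obtain ⟨e1, e2, e3⟩ := h.fields_congr (heq n) hXY
    rw [e1, e2, e3, heq n X Y hXY]
    exact (hs n).eq X Y hXY
  · obtain ⟨e1, e2, e3⟩ := h.fields_congr (heq n) hXY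
    rw [e1, e2, e3]
    exact (hs n).bound X Y hXY

end Data

/-! ### Regular representatives of the data -/

/-- A derivative given almost everywhere has a bounded measurable representative which satisfies the
algebraic relations everywhere: on the exceptional null set it is replaced by a vector at rest. -/
theorem exists_rel_representative {c : ℝ → ℝ} {κ σ C : ℝ} (hc : Speed c κ) (hσ : σ * σ = 1)
    {V : ℝ → Vec} (hV : AEStronglyMeasurable V volume) {u : ℝ → ℝ} (hu : Measurable u)
    (hb : ∀ᵐ X, ‖V X‖ ≤ C) (hrel : ∀ᵐ X, Rel c σ (u X) (V X)) :
    ∃ V' : ℝ → Vec, Measurable V' ∧ V =ᵐ[volume] V' ∧ (∀ X, ‖V' X‖ ≤ max C (κ + 1)) ∧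
      ∀ X, Rel c σ (u X) (V' X) := by
  classical
  set N := toMeasurable volume {X | ¬ (V X = hV.mk V X ∧ ‖V X‖ ≤ C ∧ Rel c σ (u X) (V X))} with hN
  have hNm : MeasurableSet N := measurableSet_toMeasurable _ _
  have hN0 : volume N = 0 := by
    rw [hN, measure_toMeasurable]
    exact hV.ae_eq_mk.and (hb.and hrel)
  have hgood : ∀ X, X ∉ N → V X = hV.mk V X ∧ ‖V X‖ ≤ C ∧ Rel c σ (u X) (V X) := fun X hX => by
    by_contra h
    exact hX (subset_toMeasurable _ _ h)
  set W : ℝ → Vec := fun X => ![σ / (2 * c (u X)), 1 / 2, 0, 0, 0] with hW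
  have hcm : Measurable fun X => c (u X) := hc.contDiff.continuous.measurable.comp hu
  have hWm : Measurable W := by
    rw [measurable_pi_iff]
    intro i
    fin_cases i
    · exact measurable_const.div (measurable_const.mul hcm)
    all_goals exact measurable_const
  have hσ1 : |σ| = 1 := by
    have h1 : |σ| * |σ| = 1 := by rw [← abs_mul, hσ, abs_one]
    nlinarith [abs_nonneg σ]
  have hWrel : ∀ X, Rel c σ (u X) (W X) := fun X => by
    have h1 := (hc.c_pos (u X)).ne'
    refine ⟨?_, ?_, ?_, ?_⟩ <;> simp only [hW, Matrix.cons_val]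
    · field_simp
      linear_combination -hσ
    · simp
    · simp
    · norm_num
  have hWb : ∀ X, ‖W X‖ ≤ κ + 1 := fun X => by
    have h1 := (hWrel X).norm_le hc hσ1
    simp only [hW, Matrix.cons_val] at h1
    have hκ := hc.pos
    refine h1.trans ?_
    linarith
  refine ⟨N.piecewise W (hV.mk V), ?_, ?_, fun X => ?_, fun X => ?_⟩
  · exact hWm.piecewise hNm hV.stronglyMeasurable_mk.measurable
  · have : ∀ᵐ X, X ∉ N := measure_eq_zero_iff_ae_notMem.1 hN0
    filter_upwards [this] with X hX
    rw [piecewise_eq_of_notMem _ _ _ hX]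
    exact (hgood X hX).1
  · by_cases hX : X ∈ N
    · rw [piecewise_eq_of_mem _ _ _ hX]; exact (hWb X).trans (le_max_right _ _)
    · rw [piecewise_eq_of_notMem _ _ _ hX, ← (hgood X hX).1]
      exact (hgood X hX).2.1.trans (le_max_left _ _)
  · by_cases hX : X ∈ N
    · rw [piecewise_eq_of_mem _ _ _ hX]; exact hWrel X
    · rw [piecewise_eq_of_notMem _ _ _ hX, ← (hgood X hX).1]
      exact (hgood X hX).2.2

theorem exists_ae_bound_of_eLpNorm_top {g : ℝ → Vec} (h : eLpNorm g ∞ volume < ∞) :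
    ∃ C, ∀ᵐ x, ‖g x‖ ≤ C := by
  rw [eLpNorm_exponent_top] at h
  refine ⟨(eLpNormEssSup g volume).toReal, ?_⟩
  filter_upwards [enorm_ae_le_eLpNormEssSup g volume] with x hx
  rw [← toReal_enorm]
  exact ENNReal.toReal_mono h.ne hx

/-- In `[0, ∞]` the reciprocal of a number `≤ 0`, truncated to `0`, is infinite. -/
theorem ae_pos_of_essSup_inv {g : ℝ → ℝ}
    (h : essSup (fun x => (ENNReal.ofReal (g x))⁻¹) volume < ∞) : ∀ᵐ x, 0 < g x := by
  filter_upwards [ENNReal.ae_le_essSup fun x => (ENNReal.ofReal (g x))⁻¹] with x hx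
  by_contra! h0
  rw [ENNReal.ofReal_eq_zero.2 h0, ENNReal.inv_zero] at hx
  exact absurd (hx.trans_lt h) (lt_irrefl _)

/-- The compatibility condition does not depend on the representative of `𝒱`. -/
theorem IsCurve.ae_deriv_smul_congr {χ ψ : ℝ → ℝ} (h : IsCurve χ ψ) {V V' : ℝ → Vec}
    (hV : V =ᵐ[volume] V') :
    ∀ᵐ s, deriv χ s • V (χ s) = deriv χ s • V' (χ s) := by
  filter_upwards [h.ae_deriv_eq_zero_or hV] with s hs
  rcases hs.2 with h0 | h0
  · rw [h0, zero_smul, zero_smul]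
  · rw [h0]

namespace Data

theorem Same.trans {Θ Θ' Θ'' : Data} (h : Θ.Same Θ') (h' : Θ'.Same Θ'') : Θ.Same Θ'' :=
  ⟨h.1.trans h'.1, h.2.1.trans h'.2.1, h.2.2.1.trans h'.2.2.1, h.2.2.2.1.trans h'.2.2.2.1,
    h.2.2.2.2.trans h'.2.2.2.2⟩

/-- The set `𝒢` is stable under modification of `𝒱` and `𝒲` on null sets. -/
theorem MemG.congr {c : ℝ → ℝ} {Θ Θ' : Data} (h : Θ.MemG c) (hs : Θ.Same Θ') : Θ'.MemG c := by
  obtain ⟨X, Y, Z, V, W⟩ := Θ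
  obtain ⟨X', Y', Z', V', W'⟩ := Θ'
  obtain ⟨hX, hY, hZ, hV, hW⟩ := hs
  simp only at hX hY hZ hV hW
  subst hX hY hZ
  have hVa : Va c ⟨X, Y, Z, V, W⟩ =ᵐ[volume] Va c ⟨X, Y, Z, V', W'⟩ := by
    filter_upwards [hV] with x hx
    simp only [Va, hx]
  have hWa : Wa c ⟨X, Y, Z, V, W⟩ =ᵐ[volume] Wa c ⟨X, Y, Z, V', W'⟩ := by
    filter_upwards [hW] with x hx
    simp only [Wa, hx]
  have hVi : (fun x => (ENNReal.ofReal ((V x).x + (V x).J))⁻¹) =ᵐ[volume]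
      fun x => (ENNReal.ofReal ((V' x).x + (V' x).J))⁻¹ := by
    filter_upwards [hV] with x hx
    rw [hx]
  have hWi : (fun x => (ENNReal.ofReal ((W x).x + (W x).J))⁻¹) =ᵐ[volume]
      fun x => (ENNReal.ofReal ((W' x).x + (W' x).J))⁻¹ := by
    filter_upwards [hW] with x hx
    rw [hx]
  refine ⟨h.curve, h.meas_V.congr hV, h.meas_W.congr hW, ?_, ?_, ?_, ?_, h.absCont, ?_, ?_, ?_,
    ?_, ?_, ?_, ?_, h.lim_J⟩
  · have := h.norm_lt_top
    simp only [normG] at this ⊢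
    rwa [← eLpNorm_congr_ae hVa, ← eLpNorm_congr_ae hWa]
  · have := h.tnorm_lt_top
    simp only [tnormG] at this ⊢
    rw [← eLpNorm_congr_ae hVa, ← eLpNorm_congr_ae hWa, ← essSup_congr_ae hVi,
      ← essSup_congr_ae hWi]
    exact this
  · filter_upwards [h.nonneg_V, hV] with x h1 h2 using by simpa only [h2] using h1
  · filter_upwards [h.nonneg_W, hW] with x h1 h2 using by simpa only [h2] using h1
  · filter_upwards [h.compat, h.curve.ae_deriv_smul_congr hV,
      h.curve.symm.ae_deriv_smul_congr hW] with s h1 h2 h3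
    have h4 : deriv X s • V' (X s) + deriv Y s • W' (Y s) =
        deriv X s • V (X s) + deriv Y s • W (Y s) := congrArg₂ (· + ·) h2.symm h3.symm
    exact h4 ▸ h1
  · filter_upwards [h.energy_V, hV] with x h1 h2 using by simpa only [h2] using h1
  · filter_upwards [h.energy_W, hW] with x h1 h2 using by simpa only [h2] using h1
  · filter_upwards [h.tx_V, hV] with x h1 h2 using by simpa only [h2] using h1
  · filter_upwards [h.tx_W, hW] with x h1 h2 using by simpa only [h2] using h1
  · filter_upwards [h.JK_V, hV] with x h1 h2 using by simpa only [h2] using h1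
  · filter_upwards [h.JK_W, hW] with x h1 h2 using by simpa only [h2] using h1

/-- All elements of `𝒢` agree almost everywhere with regular admissible data. -/
theorem MemG.exists_regular {c : ℝ → ℝ} {κ : ℝ} (hc : Speed c κ) {Θ : Data} (h : Θ.MemG c) :
    ∃ (Θ' : Data) (m : ℝ), Θ'.Regular m ∧ Θ'.Admissible c 1 ∧ Θ.Same Θ' := by
  have hn := h.tnorm_lt_top
  simp only [tnormG, ENNReal.add_lt_top] at hn
  obtain ⟨⟨⟨⟨⟨-, hVi⟩, hWi⟩, hZ⟩, hVa⟩, hWa⟩ := hn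
  have hcont : Continuous Θ.Z := by
    rw [continuous_iff_continuousAt]
    intro s
    have := (h.absCont (s - 1) (s + 1)).continuousOn
    rw [uIcc_of_le (by linarith)] at this
    exact this.continuousAt (Icc_mem_nhds (by linarith) (by linarith))
  obtain ⟨CZ, hCZ⟩ := exists_ae_bound_of_eLpNorm_top hZ
  obtain ⟨CV, hCV⟩ := exists_ae_bound_of_eLpNorm_top hVa
  obtain ⟨CW, hCW⟩ := exists_ae_bound_of_eLpNorm_top hWa
  have hZall : ∀ s, ‖Θ.Za s‖ ≤ CZ := by
    have hcl : IsClosed {s | ‖Θ.Za s‖ ≤ CZ} := by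
      refine isClosed_le ?_ continuous_const
      refine (hcont.sub ?_).norm
      exact continuous_pi fun i => by fin_cases i <;> simp <;> fun_prop
    have := (Measure.dense_of_ae hCZ).closure_eq
    rw [hcl.closure_eq] at this
    exact fun s => (this ▸ mem_univ s : s ∈ {s | ‖Θ.Za s‖ ≤ CZ})
  have hbV : ∀ᵐ X, ‖Θ.V X‖ ≤ CV + ‖(![1 / (2 * c 0), 1 / 2, 0, 0, 0] : Vec)‖ := by
    filter_upwards [hCV] with X hX
    have := norm_sub_norm_le (Θ.V X) (![1 / (2 * c 0), 1 / 2, 0, 0, 0] : Vec)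
    simp only [Va] at hX
    linarith
  have hbW : ∀ᵐ X, ‖Θ.W X‖ ≤ CW + ‖(![-(1 / (2 * c 0)), 1 / 2, 0, 0, 0] : Vec)‖ := by
    filter_upwards [hCW] with X hX
    have := norm_sub_norm_le (Θ.W X) (![-(1 / (2 * c 0)), 1 / 2, 0, 0, 0] : Vec)
    simp only [Wa] at hX
    linarith
  have hrV : ∀ᵐ X, Rel c 1 (Θ.Z (genInv Θ.X X) 2) (Θ.V X) := by
    filter_upwards [h.tx_V, h.JK_V, h.energy_V, ae_pos_of_essSup_inv hVi] with X h1 h2 h3 h4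
    exact ⟨by rw [one_mul]; exact h1, by rw [one_mul]; exact h2, h3, h4⟩
  have hrW : ∀ᵐ Y, Rel c (-1) (Θ.Z (genInv Θ.Y Y) 2) (Θ.W Y) := by
    filter_upwards [h.tx_W, h.JK_W, h.energy_W, ae_pos_of_essSup_inv hWi] with X h1 h2 h3 h4
    exact ⟨by rw [neg_one_mul]; exact h1, by rw [neg_one_mul]; exact h2, h3, h4⟩
  have hmV : Measurable fun X => Θ.Z (genInv Θ.X X) 2 :=
    (measurable_pi_apply 2).comp (hcont.measurable.comp h.curve.measurable_genInv)
  have hmW : Measurable fun X => Θ.Z (genInv Θ.Y X) 2 :=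
    (measurable_pi_apply 2).comp (hcont.measurable.comp h.curve.symm.measurable_genInv)
  obtain ⟨V', hV'm, hV', hV'b, hV'r⟩ :=
    exists_rel_representative hc (by norm_num) h.meas_V hmV hbV hrV
  obtain ⟨W', hW'm, hW', hW'b, hW'r⟩ :=
    exists_rel_representative hc (by norm_num) h.meas_W hmW hbW hrW
  have hsame : Θ.Same ⟨Θ.X, Θ.Y, Θ.Z, V', W'⟩ := ⟨rfl, rfl, rfl, hV', hW'⟩
  set BV := max (CV + ‖(![1 / (2 * c 0), 1 / 2, 0, 0, 0] : Vec)‖) (κ + 1)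
  set BW := max (CW + ‖(![-(1 / (2 * c 0)), 1 / 2, 0, 0, 0] : Vec)‖) (κ + 1)
  refine ⟨⟨Θ.X, Θ.Y, Θ.Z, V', W'⟩, max CZ (max BV BW),
    ⟨h.curve, hV'm, hW'm, fun X => (hV'b X).trans ?_, fun Y => (hW'b Y).trans ?_,
      fun s => (hZall s).trans (le_max_left _ _), h.absCont, (h.congr hsame).compat⟩,
    ⟨by norm_num, hV'r, hW'r⟩, hsame⟩
  · exact (le_max_left _ _).trans (le_max_right _ _)
  · exact (le_max_right _ _).trans (le_max_right _ _)

end Data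

/-! ### Existence in `ℋ` -/

namespace Data

variable {Θ : Data} {c : ℝ → ℝ} {κ m : ℝ} {f : ℝ → ℝ → Vec}

theorem Regular.ae_dX_potential (h : Θ.Regular m) (hf : LocBounded (Function.uncurry f)) :
    ∀ᵐ X, ∀ Y, DifferentiableAt ℝ (fun ξ => Θ.potential f ξ Y) X ∧
      dX (Θ.potential f) X Y = Θ.fieldX f X Y := by
  filter_upwards [h.ae_hasDerivAt_potential_left hf] with X hX Y
  exact ⟨(hX Y).differentiableAt, (hX Y).deriv⟩

theorem Regular.ae_dY_potential (h : Θ.Regular m) (hf : LocBounded (Function.uncurry f)) :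
    ∀ᵐ Y, ∀ X, DifferentiableAt ℝ (fun η => Θ.potential f X η) Y ∧
      dY (Θ.potential f) X Y = Θ.fieldY f X Y := by
  filter_upwards [h.ae_hasDerivAt_potential_right hf] with Y hY X
  exact ⟨(hY X).differentiableAt, (hY X).deriv⟩

theorem Regular.isSolutionOn_potential (h : Θ.Regular m) (hf : LocBounded (Function.uncurry f))
    (heq : ∀ X Y, f X Y = F c (Θ.potential f X Y) (Θ.fieldX f X Y) (Θ.fieldY f X Y))
    (Xl Xr Yl Yr : ℝ) : IsSolutionOn c (Θ.potential f) Xl Xr Yl Yr := by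
  set R := max (max |Xl| |Xr|) (max |Yl| |Yr|) with hR
  have hRX : ∀ X ∈ Icc Xl Xr, |X| ≤ R := fun X hX =>
    (abs_le_max_abs_abs hX.1 hX.2).trans (le_max_left _ _)
  have hRY : ∀ Y ∈ Icc Yl Yr, |Y| ≤ R := fun Y hY =>
    (abs_le_max_abs_abs hY.1 hY.2).trans (le_max_right _ _)
  refine ⟨?_, ?_, ?_, ?_, ?_⟩
  · obtain ⟨C, hC0, hC⟩ := h.potential_sub_le hf R
    refine ⟨(2 * C).toNNReal, LipschitzOnWith.of_dist_le_mul fun p hp q hq => ?_⟩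
    rw [dist_eq_norm, dist_eq_norm, Real.coe_toNNReal _ (by positivity)]
    refine (hC _ _ _ _ (hRX _ hp.1) (hRY _ hp.2) (hRX _ hq.1) (hRY _ hq.2)).trans ?_
    have h1 : |p.1 - q.1| ≤ ‖p - q‖ := norm_fst_le (p - q)
    have h2 : |p.2 - q.2| ≤ ‖p - q‖ := norm_snd_le (p - q)
    nlinarith
  · obtain ⟨C, hC0, hC⟩ := fieldX_sub_le (Θ := Θ) hf R
    refine ⟨C.toNNReal, ?_⟩
    filter_upwards [ae_restrict_of_ae (h.ae_dX_potential hf), ae_restrict_mem measurableSet_Icc]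
      with X hX hXI
    refine ⟨fun Y _ => (hX Y).1, LipschitzOnWith.of_dist_le_mul fun Y hY Y' hY' => ?_⟩
    rw [(hX Y).2, (hX Y').2, dist_eq_norm, Real.coe_toNNReal _ hC0]
    exact hC X Y Y' (hRX X hXI) (hRY Y hY) (hRY Y' hY')
  · obtain ⟨C, hC0, hC⟩ := fieldX_sub_le (Θ := Θ.swap) hf.flip R
    refine ⟨C.toNNReal, ?_⟩
    filter_upwards [ae_restrict_of_ae (h.ae_dY_potential hf), ae_restrict_mem measurableSet_Icc]
      with Y hY hYI
    refine ⟨fun X _ => (hY X).1, LipschitzOnWith.of_dist_le_mul fun X hX X' hX' => ?_⟩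
    rw [(hY X).2, (hY X').2, dist_eq_norm, Real.coe_toNNReal _ hC0]
    exact hC Y X X' (hRY Y hYI) (hRX X hX) (hRX X' hX')
  · refine ae_restrict_of_ae ?_
    filter_upwards [h.ae_dX_potential hf] with X hX
    refine ae_restrict_of_ae ?_
    filter_upwards [h.ae_dY_potential hf, (isPrimitive_fieldX hf X).ae_hasDerivAt (hf.left X)]
      with Y hY h1
    simp only [fun η => (hX η).2, (hY X).2]
    rw [← heq]
    exact h1
  · refine ae_restrict_of_ae ?_
    filter_upwards [h.ae_dY_potential hf] with Y hY
    refine ae_restrict_of_ae ?_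
    filter_upwards [h.ae_dX_potential hf, (isPrimitive_fieldY hf Y).ae_hasDerivAt (hf.right Y)]
      with X hX h1
    simp only [fun ξ => (hY ξ).2, (hX Y).2]
    rw [← heq]
    exact h1

/-- A global solution of the integrated equations belongs to `ℋ(Ω)` for all rectangles `Ω`. -/
theorem Regular.memHOn_potential (h : Θ.Regular m) (hc : Speed c κ)
    (hf : LocBounded (Function.uncurry f))
    (hsol : ∀ n : ℕ, ∃ R, Θ.Solves c 1 m R f {p | gap Θ.X Θ.Y p.1 p.2 ≤ n})
    (Xl Xr Yl Yr : ℝ) : MemHOn c (Θ.potential f) Xl Xr Yl Yr := by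
  have hS : ∀ X Y, ∃ (R : ℝ) (S : Set (ℝ × ℝ)), Θ.Solves c 1 m R f S ∧ (X, Y) ∈ S := fun X Y => by
    obtain ⟨n, hn⟩ := exists_nat_ge (gap Θ.X Θ.Y X Y)
    obtain ⟨R, hR⟩ := hsol n
    exact ⟨R, _, hR, hn⟩
  refine ⟨h.isSolutionOn_potential hf (fun X Y => ?_) Xl Xr Yl Yr, ?_, ?_⟩
  · obtain ⟨R, S, h1, h2⟩ := hS X Y
    exact h1.eq X Y h2
  · refine ae_restrict_of_ae ?_
    filter_upwards [h.ae_dX_potential hf] with X hX Y _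
    obtain ⟨R, S, h1, h2⟩ := hS X Y
    have h3 := h1.rel hc h2
    rw [(hX Y).2]
    have h4 := h3.tx
    have h5 := h3.JK
    rw [one_mul] at h4 h5
    exact ⟨h4, h5, h3.energy, h3.nonneg.1, h3.nonneg.2, h3.pos⟩
  · refine ae_restrict_of_ae ?_
    filter_upwards [h.ae_dY_potential hf] with Y hY X _
    obtain ⟨R, S, h1, h2⟩ := hS X Y
    have h3 := h1.rel_right hc h2
    rw [(hY X).2]
    have h4 := h3.tx
    have h5 := h3.JK
    rw [neg_one_mul] at h4 h5
    exact ⟨h4, h5, h3.energy, h3.nonneg.1, h3.nonneg.2, h3.pos⟩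

theorem Regular.same_bullet_potential (h : Θ.Regular m) (hf : LocBounded (Function.uncurry f)) :
    Θ.Same (bullet (Θ.potential f) Θ.X Θ.Y) := by
  refine ⟨rfl, rfl, ?_, ?_, ?_⟩
  · funext s
    exact (h.potential_curve hf s).symm
  · filter_upwards [h.ae_dX_potential hf] with X hX
    exact ((hX _).2.trans (Solves.fieldX_base Θ f X)).symm
  · filter_upwards [h.ae_dY_potential hf] with Y hY
    exact ((hY _).2.trans (Solves.fieldX_base Θ.swap (flip f) Y)).symm

/-- **Existence** of a global solution with given data. -/
theorem MemG.exists_solution (hc : Speed c κ) (h : Θ.MemG c) : ∃ Z ∈ H c, Matches Θ Z := by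
  obtain ⟨Θ', m, hreg, hadm, hsame⟩ := h.exists_regular hc
  obtain ⟨f, hf, hsol⟩ := hreg.exists_global_solution hadm hc
  have hb := hreg.same_bullet_potential hf
  refine ⟨Θ'.potential f, ⟨fun Xl Xr Yl Yr _ _ => hreg.memHOn_potential hc hf hsol Xl Xr Yl Yr,
    Θ'.X, Θ'.Y, hreg.curve, (h.congr hsame).congr hb⟩, ?_⟩
  have h1 := hsame.trans hb
  rwa [← hsame.1, ← hsame.2.1] at h1

end Data

/-! ### Uniqueness in `ℋ` -/

/-- A locally Lipschitz vector-valued function is a primitive of its almost everywhere derivative.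
-/
theorem isPrimitive_of_ae_hasDerivAt {G g : ℝ → Vec} (hG : LocallyLipschitz G)
    (hg : ∀ᵐ x, HasDerivAt G (g x) x) : IsPrimitive G g := by
  have hb : LocBounded (deriv G) := by
    refine ⟨(measurable_deriv G).stronglyMeasurable, fun R => ?_⟩
    obtain ⟨K, hK⟩ := (hG.locallyLipschitzOn (s := Icc (-(R + 1)) (R + 1))
      ).exists_lipschitzOnWith_of_compact isCompact_Icc
    refine ⟨K, fun x hx => norm_deriv_le_of_lipschitzOn (Icc_mem_nhds ?_ ?_) hK⟩
    · linarith [(abs_le.1 hx).1]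
    · linarith [(abs_le.1 hx).2]
  intro x y
  have hp : IsPrimitive (fun y => 0 + ∫ t in x..y, deriv G t) (deriv G) :=
    isPrimitive_const_add_integral hb 0 x
  have hcongr : ∫ t in x..y, g t = ∫ t in x..y, deriv G t := by
    refine intervalIntegral.integral_congr_ae ?_
    filter_upwards [hg] with t ht _ using ht.deriv.symm
  obtain ⟨e, he⟩ := AbsolutelyContinuousOnInterval.const_of_ae_hasDerivAt_zero
    (f := fun y => G y - (0 + ∫ t in x..y, deriv G t)) (a := x) (b := y)
    (absolutelyContinuousOnInterval_of_locallyLipschitz (hG.sub (hp.locallyLipschitz hb)) _ _) (by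
      filter_upwards [hg, hp.ae_hasDerivAt hb] with t h1 h2 _
      have := h1.sub h2
      rwa [h1.deriv, sub_self] at this)
  have h1 := he x left_mem_uIcc
  have h2 := he y right_mem_uIcc
  simp only [intervalIntegral.integral_same, zero_add, sub_zero] at h1 h2
  rw [hcongr, h1, ← h2]
  abel

/-- Solutions on all rectangles. -/
def IsEntire (c : ℝ → ℝ) (Z : ℝ → ℝ → Vec) : Prop :=
  ∀ Xl Xr Yl Yr : ℝ, Xl < Xr → Yl < Yr → IsSolutionOn c Z Xl Xr Yl Yr

theorem IsSolutionOn.flip {c : ℝ → ℝ} {Z : ℝ → ℝ → Vec} {Xl Xr Yl Yr : ℝ}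
    (h : IsSolutionOn c Z Xl Xr Yl Yr) : IsSolutionOn c (flip Z) Yl Yr Xl Xr where
  lipschitz := by
    obtain ⟨L, hL⟩ := h.lipschitz
    refine ⟨L, LipschitzOnWith.of_dist_le_mul fun p hp q hq => ?_⟩
    have := hL.dist_le_mul p.swap ⟨hp.2, hp.1⟩ q.swap ⟨hq.2, hq.1⟩
    rwa [Prod.dist_eq, max_comm] at this
  reg_X := h.reg_Y
  reg_Y := h.reg_X
  eq_XY := by
    filter_upwards [h.eq_YX] with Y hY
    filter_upwards [hY] with X hX
    rw [F_symm]
    exact hX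
  eq_YX := by
    filter_upwards [h.eq_XY] with X hX
    filter_upwards [hX] with Y hY
    rw [F_symm]
    exact hY

namespace IsEntire

variable {c : ℝ → ℝ} {Z : ℝ → ℝ → Vec}

theorem flip (h : IsEntire c Z) : IsEntire c (flip Z) :=
  fun Xl Xr Yl Yr hX hY => (h Yl Yr Xl Xr hY hX).flip

theorem exists_lipschitzOnWith (h : IsEntire c Z) (R : ℝ) : ∃ L : ℝ≥0,
    LipschitzOnWith L (fun p : ℝ × ℝ => Z p.1 p.2) (Icc (-R) R ×ˢ Icc (-R) R) := by
  rcases lt_or_ge 0 R with hR | hR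
  · exact (h (-R) R (-R) R (by linarith) (by linarith)).lipschitz
  · refine ⟨0, LipschitzOnWith.of_dist_le_mul fun p hp q hq => ?_⟩
    have e1 : p.1 = q.1 := by linarith [hp.1.1, hp.1.2, hq.1.1, hq.1.2]
    have e2 : p.2 = q.2 := by linarith [hp.2.1, hp.2.2, hq.2.1, hq.2.2]
    simp [e1, e2]

theorem continuous (h : IsEntire c Z) : Continuous fun p : ℝ × ℝ => Z p.1 p.2 := by
  rw [continuous_iff_continuousAt]
  rintro ⟨X, Y⟩
  obtain ⟨L, hL⟩ := h.exists_lipschitzOnWith (max |X| |Y| + 1)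
  refine hL.continuousOn.continuousAt (prod_mem_nhds (Icc_mem_nhds ?_ ?_) (Icc_mem_nhds ?_ ?_))
  · linarith [neg_abs_le X, le_max_left |X| |Y|]
  · linarith [le_abs_self X, le_max_left |X| |Y|]
  · linarith [neg_abs_le Y, le_max_right |X| |Y|]
  · linarith [le_abs_self Y, le_max_right |X| |Y|]

theorem locallyLipschitz_right (h : IsEntire c Z) (X : ℝ) : LocallyLipschitz (Z X) := by
  intro Y
  obtain ⟨L, hL⟩ := h.exists_lipschitzOnWith (max |X| |Y| + 1)
  have hX : X ∈ Icc (-(max |X| |Y| + 1)) (max |X| |Y| + 1) :=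
    ⟨by linarith [neg_abs_le X, le_max_left |X| |Y|],
      by linarith [le_abs_self X, le_max_left |X| |Y|]⟩
  refine ⟨L, _, Icc_mem_nhds (a := -(max |X| |Y| + 1)) (b := max |X| |Y| + 1) ?_ ?_,
    LipschitzOnWith.of_dist_le_mul fun y hy y' hy' => ?_⟩
  · linarith [neg_abs_le Y, le_max_right |X| |Y|]
  · linarith [le_abs_self Y, le_max_right |X| |Y|]
  · have := hL.dist_le_mul (X, y) ⟨hX, hy⟩ (X, y') ⟨hX, hy'⟩
    rwa [Prod.dist_eq, dist_self, max_eq_right dist_nonneg] at this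

theorem exists_dY_bound (h : IsEntire c Z) (R : ℝ) :
    ∃ C, ∀ X Y, |X| ≤ R → |Y| ≤ R → ‖dY Z X Y‖ ≤ C := by
  obtain ⟨L, hL⟩ := h.exists_lipschitzOnWith (R + 1)
  refine ⟨L, fun X Y hX hY => ?_⟩
  have hX' := abs_le.1 hX
  have hY' := abs_le.1 hY
  refine norm_deriv_le_of_lipschitzOn (s := Icc (-(R + 1)) (R + 1))
    (Icc_mem_nhds (by linarith [hY'.1]) (by linarith [hY'.2]))
    (LipschitzOnWith.of_dist_le_mul fun y hy y' hy' => ?_)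
  have hXI : X ∈ Icc (-(R + 1)) (R + 1) := ⟨by linarith [hX'.1], by linarith [hX'.2]⟩
  have := hL.dist_le_mul (X, y) ⟨hXI, hy⟩ (X, y') ⟨hXI, hy'⟩
  rwa [Prod.dist_eq, dist_self, max_eq_right dist_nonneg] at this

theorem exists_bound (h : IsEntire c Z) (R : ℝ) :
    ∃ C, ∀ X Y, |X| ≤ R → |Y| ≤ R → |Z X Y 2| ≤ C ∧ ‖dX Z X Y‖ ≤ C ∧ ‖dY Z X Y‖ ≤ C := by
  obtain ⟨C₁, h₁⟩ := h.exists_dY_bound R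
  obtain ⟨C₂, h₂⟩ := h.flip.exists_dY_bound R
  obtain ⟨C₃, h₃⟩ := (isCompact_closedBall (0 : ℝ × ℝ) R).exists_bound_of_continuousOn
    h.continuous.continuousOn
  refine ⟨max C₃ (max C₂ C₁), fun X Y hX hY => ⟨?_, ?_, ?_⟩⟩
  · refine (norm_le_pi_norm (Z X Y) 2).trans ((h₃ (X, Y) ?_).trans (le_max_left _ _))
    rw [mem_closedBall_zero_iff]
    exact norm_pair_le.2 ⟨hX, hY⟩
  · exact (h₂ Y X hY hX).trans ((le_max_left _ _).trans (le_max_right _ _))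
  · exact (h₁ X Y hX hY).trans ((le_max_right _ _).trans (le_max_right _ _))

/-- On almost every vertical line `Z_X` exists and solves the equation. -/
theorem ae_dX (h : IsEntire c Z) : ∀ᵐ X, (∀ Y, DifferentiableAt ℝ (fun ξ => Z ξ Y) X) ∧
    LocallyLipschitz (fun Y => dX Z X Y) ∧
    ∀ᵐ Y, HasDerivAt (fun η => dX Z X η) (F c (Z X Y) (dX Z X Y) (dY Z X Y)) Y := by
  have hs : ∀ n : ℕ, IsSolutionOn c Z (-(n + 1)) (n + 1) (-(n + 1)) (n + 1) := fun n =>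
    h _ _ _ _ (by linarith [n.cast_nonneg (α := ℝ)]) (by linarith [n.cast_nonneg (α := ℝ)])
  have h1 := fun n => (hs n).reg_X
  choose L hL using h1
  have h2 : ∀ᵐ X : ℝ, ∀ n : ℕ, X ∈ Icc (-((n : ℝ) + 1)) (n + 1) →
      (∀ Y ∈ Icc (-((n : ℝ) + 1)) (n + 1), DifferentiableAt ℝ (fun ξ => Z ξ Y) X) ∧
        LipschitzOnWith (L n) (fun Y => dX Z X Y) (Icc (-((n : ℝ) + 1)) (n + 1)) := by
    rw [ae_all_iff]
    exact fun n => (ae_restrict_iff' measurableSet_Icc).1 (hL n)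
  have h3 : ∀ᵐ X : ℝ, ∀ n : ℕ, X ∈ Icc (-((n : ℝ) + 1)) (n + 1) →
      ∀ᵐ Y : ℝ, Y ∈ Icc (-((n : ℝ) + 1)) (n + 1) →
        HasDerivAt (fun η => dX Z X η) (F c (Z X Y) (dX Z X Y) (dY Z X Y)) Y := by
    rw [ae_all_iff]
    intro n
    filter_upwards [(ae_restrict_iff' measurableSet_Icc).1 (hs n).eq_XY] with X hX hXI
    exact (ae_restrict_iff' measurableSet_Icc).1 (hX hXI)
  have hmem : ∀ {n : ℕ} {x : ℝ}, |x| ≤ n → x ∈ Ioo (-((n : ℝ) + 1)) (n + 1) := fun hx =>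
    ⟨by linarith [(abs_le.1 hx).1], by linarith [(abs_le.1 hx).2]⟩
  filter_upwards [h2, h3] with X hX2 hX3
  have hn : ∀ Y : ℝ, ∃ n : ℕ, |X| ≤ n ∧ |Y| ≤ n := fun Y => by
    obtain ⟨n, hn⟩ := exists_nat_ge (max |X| |Y|)
    exact ⟨n, max_le_iff.1 hn⟩
  refine ⟨fun Y => ?_, fun Y => ?_, ?_⟩
  · obtain ⟨n, hnX, hnY⟩ := hn Y
    exact (hX2 n (Ioo_subset_Icc_self (hmem hnX))).1 Y (Ioo_subset_Icc_self (hmem hnY))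
  · obtain ⟨n, hnX, hnY⟩ := hn Y
    exact ⟨L n, _, Icc_mem_nhds (hmem hnY).1 (hmem hnY).2,
      (hX2 n (Ioo_subset_Icc_self (hmem hnX))).2⟩
  · have h4 : ∀ᵐ Y : ℝ, ∀ n : ℕ, X ∈ Icc (-((n : ℝ) + 1)) (n + 1) →
        Y ∈ Icc (-((n : ℝ) + 1)) (n + 1) →
        HasDerivAt (fun η => dX Z X η) (F c (Z X Y) (dX Z X Y) (dY Z X Y)) Y := by
      rw [ae_all_iff]
      intro n
      by_cases hXn : X ∈ Icc (-((n : ℝ) + 1)) (n + 1)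
      · filter_upwards [hX3 n hXn] with Y hY _ using hY
      · exact Eventually.of_forall fun Y hXn' => absurd hXn' hXn
    filter_upwards [h4] with Y hY
    obtain ⟨n, hnX, hnY⟩ := hn Y
    exact hY n (Ioo_subset_Icc_self (hmem hnX)) (Ioo_subset_Icc_self (hmem hnY))

theorem ae_dY (h : IsEntire c Z) : ∀ᵐ Y, (∀ X, DifferentiableAt ℝ (fun η => Z X η) Y) ∧
    LocallyLipschitz (fun X => dY Z X Y) ∧
    ∀ᵐ X, HasDerivAt (fun ξ => dY Z ξ Y) (F c (Z X Y) (dX Z X Y) (dY Z X Y)) X := by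
  filter_upwards [h.flip.ae_dX] with Y hY
  refine ⟨hY.1, hY.2.1, ?_⟩
  filter_upwards [hY.2.2] with X hX
  rw [F_symm]
  exact hX

end IsEntire

theorem IsCurve.abs_genInv_le_of_between {χ ψ : ℝ → ℝ} (h : IsCurve χ ψ) {X Y η T : ℝ}
    (hη : η ∈ uIoo (ψ (genInv χ X)) Y) (hX : |genInv χ X| ≤ T) (hY : |genInv ψ Y| ≤ T) :
    |genInv ψ η| ≤ T := by
  rw [abs_le] at *
  rcases h.genInv_mem_of_between hη with ⟨h1, h2, h3⟩ | ⟨h1, h2, h3⟩ <;>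
    constructor <;> linarith [hX.1, hX.2, hY.1, hY.2]

/-- A point is the value of a curve at a bounded parameter, hence bounded. -/
theorem IsCurve.exists_abs_le (h : IsCurve χ ψ) (T : ℝ) :
    ∃ R, ∀ X, |genInv χ X| ≤ T → |X| ≤ R := by
  obtain ⟨M, hM⟩ := h.bounded_left
  refine ⟨T + M, fun X hX => ?_⟩
  have h1 := hM (genInv χ X)
  rw [h.apply_genInv] at h1
  rw [abs_le] at *
  constructor <;> linarith [h1.1, h1.2, hX.1, hX.2]

/-- **Uniqueness** of the solution on all rectangles with given data. -/
theorem IsEntire.unique {c : ℝ → ℝ} {κ : ℝ} (hc : Speed c κ) {Θ : Data} (hΘ : IsCurve Θ.X Θ.Y)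
    {Z Z' : ℝ → ℝ → Vec} (h : IsEntire c Z) (h' : IsEntire c Z') (hm : Matches Θ Z)
    (hm' : Matches Θ Z') : Z = Z' := by
  have hcurve : ∀ s, Z (Θ.X s) (Θ.Y s) = Z' (Θ.X s) (Θ.Y s) := fun s =>
    (congrFun hm.2.2.1 s).symm.trans (congrFun hm'.2.2.1 s)
  have hbase : ∀ X, Z X (Θ.Y (genInv Θ.X X)) = Z' X (Θ.Y (genInv Θ.X X)) := fun X => by
    have := hcurve (genInv Θ.X X)
    rwa [hΘ.apply_genInv] at this
  -- `GX X` and `GY Y` collect what holds on almost every vertical and horizontal line.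
  set GX : ℝ → Prop := fun X =>
    (LocallyLipschitz (fun Y => dX Z X Y) ∧
      ∀ᵐ Y, HasDerivAt (fun η => dX Z X η) (F c (Z X Y) (dX Z X Y) (dY Z X Y)) Y) ∧
    (LocallyLipschitz (fun Y => dX Z' X Y) ∧
      ∀ᵐ Y, HasDerivAt (fun η => dX Z' X η) (F c (Z' X Y) (dX Z' X Y) (dY Z' X Y)) Y) ∧
    dX Z X (Θ.Y (genInv Θ.X X)) = dX Z' X (Θ.Y (genInv Θ.X X)) with hGX
  set GY : ℝ → Prop := fun Y =>
    (LocallyLipschitz (fun X => dY Z X Y) ∧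
      ∀ᵐ X, HasDerivAt (fun ξ => dY Z ξ Y) (F c (Z X Y) (dX Z X Y) (dY Z X Y)) X) ∧
    (LocallyLipschitz (fun X => dY Z' X Y) ∧
      ∀ᵐ X, HasDerivAt (fun ξ => dY Z' ξ Y) (F c (Z' X Y) (dX Z' X Y) (dY Z' X Y)) X) ∧
    dY Z (Θ.X (genInv Θ.Y Y)) Y = dY Z' (Θ.X (genInv Θ.Y Y)) Y with hGY
  have aeX : ∀ᵐ X, GX X := by
    filter_upwards [h.ae_dX, h'.ae_dX, hm.2.2.2.1, hm'.2.2.2.1] with X h1 h2 h3 h4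
    exact ⟨h1.2, h2.2, h3.symm.trans h4⟩
  have aeY : ∀ᵐ Y, GY Y := by
    filter_upwards [h.ae_dY, h'.ae_dY, hm.2.2.2.2, hm'.2.2.2.2] with Y h1 h2 h3 h4
    exact ⟨h1.2, h2.2, h3.symm.trans h4⟩
  have hint : ∀ X Y, Z X Y - Z' X Y =
      ∫ η in (Θ.Y (genInv Θ.X X))..Y, (dY Z X η - dY Z' X η) := fun X Y => by
    have := isPrimitive_of_ae_hasDerivAt (G := fun η => Z X η - Z' X η)
      (g := fun η => dY Z X η - dY Z' X η)
      ((h.locallyLipschitz_right X).sub (h'.locallyLipschitz_right X)) (by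
        filter_upwards [h.ae_dY, h'.ae_dY] with η h1 h2
        exact (h1.1 X).hasDerivAt.sub (h2.1 X).hasDerivAt) (Θ.Y (genInv Θ.X X)) Y
    simpa only [hbase, sub_self, sub_zero] using this
  have key : ∀ T : ℝ, ∀ X Y, (X, Y) ∈ {p : ℝ × ℝ | (|genInv Θ.X p.1| ≤ T ∧ |genInv Θ.Y p.2| ≤ T) ∧
      GX p.1 ∧ GY p.2} → Z X Y 2 = Z' X Y 2 ∧ dX Z X Y = dX Z' X Y ∧ dY Z X Y = dY Z' X Y := by
    intro T
    obtain ⟨R₁, hR₁⟩ := hΘ.exists_abs_le T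
    obtain ⟨R₂, hR₂⟩ := hΘ.symm.exists_abs_le T
    obtain ⟨C₁, hC₁⟩ := h.exists_bound (max R₁ R₂)
    obtain ⟨C₂, hC₂⟩ := h'.exists_bound (max R₁ R₂)
    refine hΘ.solution_unique (R := max C₁ C₂) hc ?_ ?_ ?_ ?_ (fun X Y _ => hint X Y) ?_ ?_
    · rintro X Y ⟨⟨h1, h2⟩, h3, h4⟩
      filter_upwards [aeY, ae_uIoc_of_uIoo fun η hη => hΘ.abs_genInv_le_of_between hη h1 h2]
        with η h5 h6 hη
      exact ⟨⟨h1, h6 hη⟩, h3, h5⟩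
    · rintro X Y ⟨⟨h1, h2⟩, h3, h4⟩
      filter_upwards [aeX, ae_uIoc_of_uIoo fun ξ hξ => hΘ.symm.abs_genInv_le_of_between hξ h2 h1]
        with ξ h5 h6 hξ
      exact ⟨⟨h6 hξ, h2⟩, h5, h4⟩
    · rintro X Y ⟨⟨h1, h2⟩, h3, h4⟩
      obtain ⟨a1, a2, a3⟩ := hC₁ X Y ((hR₁ X h1).trans (le_max_left _ _))
        ((hR₂ Y h2).trans (le_max_right _ _))
      exact ⟨a1.trans (le_max_left _ _), a2.trans (le_max_left _ _), a3.trans (le_max_left _ _)⟩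
    · rintro X Y ⟨⟨h1, h2⟩, h3, h4⟩
      obtain ⟨a1, a2, a3⟩ := hC₂ X Y ((hR₁ X h1).trans (le_max_left _ _))
        ((hR₂ Y h2).trans (le_max_right _ _))
      exact ⟨a1.trans (le_max_right _ _), a2.trans (le_max_right _ _), a3.trans (le_max_right _ _)⟩
    · rintro X Y ⟨-, h3, -⟩
      have := isPrimitive_of_ae_hasDerivAt (h3.1.1.sub h3.2.1.1) (by
        filter_upwards [h3.1.2, h3.2.1.2] with η h5 h6 using h5.sub h6)
        (Θ.Y (genInv Θ.X X)) Y
      rw [h3.2.2, sub_self, sub_zero] at this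
      exact ⟨_, this, Eventually.of_forall fun η _ => rfl⟩
    · rintro X Y ⟨-, -, h4⟩
      have := isPrimitive_of_ae_hasDerivAt (h4.1.1.sub h4.2.1.1) (by
        filter_upwards [h4.1.2, h4.2.1.2] with ξ h5 h6 using h5.sub h6)
        (Θ.X (genInv Θ.Y Y)) X
      rw [h4.2.2, sub_self, sub_zero] at this
      exact ⟨_, this, Eventually.of_forall fun ξ _ => rfl⟩
  have hgood : ∀ X, GX X → ∀ Y, Z X Y = Z' X Y := fun X hX Y => by
    rw [← sub_eq_zero, hint]
    refine intervalIntegral.integral_zero_ae ?_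
    filter_upwards [aeY, ae_uIoc_of_uIoo fun η hη => hΘ.abs_genInv_le_of_between (X := X) (Y := Y)
      (T := max |genInv Θ.X X| |genInv Θ.Y Y|) hη (le_max_left _ _) (le_max_right _ _)]
      with η h5 h6 hη
    exact sub_eq_zero.2 (key _ X η ⟨⟨le_max_left _ _, h6 hη⟩, hX, h5⟩).2.2
  funext X Y
  have hcl : IsClosed {X | Z X Y = Z' X Y} :=
    isClosed_eq (h.continuous.comp (Continuous.prodMk_left Y))
      (h'.continuous.comp (Continuous.prodMk_left Y))
  have hd : Dense {X | Z X Y = Z' X Y} :=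
    Measure.dense_of_ae (aeX.mono fun X hX => hgood X hX Y)
  have hall := hd.closure_eq
  rw [hcl.closure_eq] at hall
  exact (hall ▸ mem_univ X : X ∈ {X | Z X Y = Z' X Y})

end NVW

theorem mainTheorem3 (c : ℝ → ℝ) (κ : ℝ) (hκ : 0 < κ) (hc : ContDiff ℝ 1 c)
    (hc_lip : LocallyLipschitz (deriv c)) (hc_bd : ∀ u, κ⁻¹ ≤ c u ∧ c u ≤ κ) :
    (∀ Θ ∈ NVW.G c, ∃! Z : ℝ → ℝ → NVW.Vec, Z ∈ NVW.H c ∧ NVW.Matches Θ Z) ∧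
      ∃! S : NVW.G c → NVW.H c,
        (∀ Θ : NVW.G c, NVW.Matches Θ.1 (S Θ).1) ∧
          ∀ Θ Θ' : NVW.G c, Θ.1.Same Θ'.1 → S Θ = S Θ' := by
  have hs : NVW.Speed c κ := ⟨hκ, hc, hc_lip, hc_bd⟩
  have huniq : ∀ Θ ∈ NVW.G c, ∀ Z ∈ NVW.H c, ∀ Z' ∈ NVW.H c, NVW.Matches Θ Z →
      NVW.Matches Θ Z' → Z = Z' := fun Θ hΘ Z hZ Z' hZ' hm hm' =>
    NVW.IsEntire.unique hs hΘ.curve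
      (fun Xl Xr Yl Yr hX hY => (hZ.1 Xl Xr Yl Yr hX hY).isSolution)
      (fun Xl Xr Yl Yr hX hY => (hZ'.1 Xl Xr Yl Yr hX hY).isSolution) hm hm'
  have hex : ∀ Θ : NVW.G c, ∃ Z : NVW.H c, NVW.Matches Θ.1 Z.1 := fun Θ => by
    obtain ⟨Z, hZ, hm⟩ := NVW.Data.MemG.exists_solution hs Θ.2
    exact ⟨⟨Z, hZ⟩, hm⟩
  refine ⟨fun Θ hΘ => ?_, ?_⟩
  · obtain ⟨Z, hm⟩ := hex ⟨Θ, hΘ⟩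
    exact ⟨Z.1, ⟨Z.2, hm⟩, fun Z' hZ' => huniq Θ hΘ Z' hZ'.1 Z.1 Z.2 hZ'.2 hm⟩
  · choose S hS using hex
    refine ⟨S, ⟨hS, fun Θ Θ' hsame => ?_⟩, fun S' hS' => ?_⟩
    · -- A solution which takes the data `Θ'` also takes the data `Θ`.
      have hm : NVW.Matches Θ.1 (S Θ').1 := by
        have := hsame.trans (hS Θ')
        rwa [← hsame.1, ← hsame.2.1] at this
      exact Subtype.ext (huniq Θ.1 Θ.2 _ (S Θ).2 _ (S Θ').2 (hS Θ) hm)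
    · funext Θ
      exact Subtype.ext (huniq Θ.1 Θ.2 _ (S' Θ).2 _ (S Θ).2 (hS'.1 Θ) (hS Θ))
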